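/- Let $G$ be a compact topological group with normalized (regular) Haar measure $dU$, let $U=U_g$ be a continuous unitary representation of $G$ on $\mathcal H=\mathbb C^d$, $d\ge 1$ (for instance a closed group of $d\times d$ unitaries), and let $N,M\ge 0$. Write $|A\rangle\!\rangle=\sum_{m,n}\langle m|A|n\rangle\,|m\rangle|n\rangle$. **Learning boards.** Let $\mathcal H_{2k+1}$ and $\mathcal H_{2k+2}$ ($0\le k<N$) be the input and the output of the $k$-th use of the unknown unitary, $\mathcal H_i$ and $\mathcal H_o$ the tensor products of all these inputs and outputs, $\mathcal H_{2N+2}$ and $\mathcal H_{2N+3}$ (both $\cong\mathcal H^{\otimes M}$) the final input, received after all $N$ uses, and the final output; $\mathcal H_0=\mathcal H_{2N+1}=\mathbb C$. The board is described by its comb: an operator $L\ge 0$ on the tensor product of all these spaces such that there are positive operators $L^{(k)}$ on $\mathcal H_0\otimes\cdots\otimes\mathcal H_{2k+1}$ with $L^{(N+1)}=L$, $L^{(-1)}=1$, $\operatorname{Tr}_{2k+1}[L^{(k)}]=I_{2k}\otimes L^{(k-1)}$ for $0\le k\le N+1$. With the $N$ uses of $U$ plugged in, one obtains the channel with Choi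 operator $\mathcal C_U=\operatorname{Tr}_{i,o}[L\,(I\otimes(|U\rangle\!\rangle\langle\!\langle U|^{\otimes N})^T)]$. The figure of merit for the inversion task (producing $M$ copies of $U^\dagger$ from $N$ uses of $U$) is $$F'(L)=\frac1{d^{2M}}\int_G\langle\!\langle U^{\dagger}|^{\otimes M}\,\mathcal C_U\,|U^{\dagger}\rangle\!\rangle^{\otimes M}\,dU .$$ **Measure-and-rotate.** The representation $U^{\otimes N}$ has a decomposition $U^{\otimes N}\simeq\bigoplus_j U_j\otimes I_{m_j}$ into pairwise inequivalent irreducible unitary representations $U_j$ on $\mathcal H_j$, $d_j=\dim\mathcal H_j$, with multiplicities $m_j\ge1$. Fix any such decomposition. Let $\widetilde{\mathcal H}=\bigoplus_j\mathcal H_j\otimes\mathcal H_j$, which carries $\widetilde U=\bigoplus_jU_j\otimes I_j$ and is isometrically embedded in $\mathcal H^{\otimes N}\otimes\mathcal H^{\otimes N}$ so that $\widetilde U$ is the restriction of $U^{\otimes N}\otimes I$. For a probability vector $p=(p_j)$ put $|\varphi^p\rangle=\bigoplus_j\sqrt{p_j/d_j}\,|I_j\rangle\!\rangle$. For $|\varphi\rangle\in\widetilde{\mathcal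 H}$ put $|\varphi_U\rangle=\widetilde U|\varphi\rangle$. Let $P_{\hat U}=|\eta_{\hat U}\rangle\langle\eta_{\hat U}|$ with $|\eta_{\hat U}\rangle=\bigoplus_j\sqrt{d_j}\,|\hat U_j\rangle\!\rangle$. The measure-and-rotate retrieving measures $P_{\hat U}\,d\hat U$ on the memory and applies $\hat U^{\dagger\otimes M}$ to the new input, conditionally on the outcome $\hat U$. (When the memory is taken to be all of $\mathcal H^{\otimes N}\otimes\mathcal H^{\otimes N}$, the measurement is completed by a uniformly random outcome on the complement of $\widetilde{\mathcal H}$, where no state is ever stored.) **Realignment of reference frames.** Alice sends a token $|\varphi\rangle\in\widetilde{\mathcal H}$ and a message $|\psi\rangle\in\mathcal H^{\otimes M}$; Bob receives $\sigma_\psi=\int_G|\varphi_U\rangle\langle\varphi_U|\otimes U^{\otimes M}|\psi\rangle\langle\psi|U^{\dagger\otimes M}\,dU$ and applies a channel $\mathcal R'$ from $\widetilde{\mathcal H}\otimes\mathcal H^{\otimes M}$ to $\mathcal H^{\otimes M}$ with Choi operator $R'$. The figure of merit is $f(\varphi,\mathcal R')=\int\langle\psi|\mathcal R'(\sigma_\psi)|\psi\rangle\,d\psi$,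 where $d\psi$ is the uniform probability measure on unit vectors. Let also $F'(\varphi,\mathcal R')=d^{-2M}\int_G\langle\!\langle U^\dagger|^{\otimes M}\langle\varphi_U^*|R'|U^\dagger\rangle\!\rangle^{\otimes M}|\varphi_U^*\rangle\,dU$ be the inversion fidelity of the retrieving channel $\mathcal R'$. **Theorem.** $P_{\hat U}\,d\hat U$ is a POVM on $\widetilde{\mathcal H}$ (and its completion is a POVM on $\mathcal H^{\otimes N}\otimes\mathcal H^{\otimes N}$), measure-and-rotate is a channel, and: 1. For every probability vector $p$, measure-and-rotate maximizes both $F'(\varphi^p,\mathcal R')$ and $f(\varphi^p,\mathcal R')$ over all channels $\mathcal R'$. 2. Maximizing $f$ is equivalent to maximizing $F'$: for all unit vectors $\varphi_1,\varphi_2\in\widetilde{\mathcal H}$ and channels $\mathcal R_1,\mathcal R_2$, $f(\varphi_1,\mathcal R_1)\le f(\varphi_2,\mathcal R_2)$ if and only if $F'(\varphi_1,\mathcal R_1)\le F'(\varphi_2,\mathcal R_2)$. 3. There is a probability vector $p$ (which may depend on $M$) such that (a) the strategy that applies $U^{\otimes N}$ in parallel to the state $|\varphi^p\rangle$ (a unit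 vector), measures $P_{\hat U}$ on the memory and applies $\hat U^{\dagger\otimes M}$ to the new input is a learning board, and its fidelity $F'$ is maximal among all learning boards; (b) with the same $p$, the token $|\varphi^p\rangle$ and measure-and-rotate maximize $f(\varphi,\mathcal R')$ over all unit vectors $\varphi\in\widetilde{\mathcal H}$ and all channels $\mathcal R'$. -/

import Mathlib

open MeasureTheory Matrix
open scoped Kronecker ComplexOrder

noncomputable section

namespace UnitaryInversion

/-! ### Linear algebra conventions -/

/-- Labels of the computational basis of `(ℂ^d)^{⊗ n}`. -/
abbrev Idx (d n : ℕ) : Type := Fin n → Fin d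

/-- The tensor power `A^{⊗ n}` of an operator on `ℂ^d`. -/
def tensorPow {d : ℕ} (n : ℕ) (A : Matrix (Fin d) (Fin d) ℂ) : Matrix (Idx d n) (Idx d n) ℂ :=
  Matrix.of fun x y => ∏ i, A (x i) (y i)

/-- The bipartite vector `|A⟩⟩ = ∑ ⟨m|A|n⟩ |m⟩|n⟩`. -/
def dket {m n : Type*} (A : Matrix m n ℂ) : m × n → ℂ := fun q => A q.1 q.2

/-- The rank one operator `|v⟩⟨v|`. -/
def ketbra {ι : Type*} (v : ι → ℂ) : Matrix ι ι ℂ := Matrix.vecMulVec v (star v)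

/-- `v` is a unit vector (a pure state). -/
def IsUnitVector {ι : Type*} [Fintype ι] (v : ι → ℂ) : Prop := ∑ x, ‖v x‖ ^ 2 = 1

/-! ### Choi operators, link product, channels, fidelity -/

section Choi

variable {O I S : Type*}

/-- The link product of an operator on `(O ⊗ I) ⊗ S` with an operator on `S`,
`L * C = Tr_S[L (1 ⊗ Cᵀ)]`. -/
def link [Fintype S] (L : Matrix ((O × I) × S) ((O × I) × S) ℂ) (C : Matrix S S ℂ) :
    Matrix (O × I) (O × I) ℂ :=
  Matrix.of fun a b => ∑ s, ∑ s', L (a, s) (b, s') * C s s'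

/-- `R` is the Choi operator of a channel (completely positive and trace preserving) with input
`I ⊗ S` and output `O`: it is positive and `Tr_O[R] = 1_I ⊗ 1_S`. -/
def IsChannel [Fintype O] [Fintype I] [Fintype S] [DecidableEq I] [DecidableEq S]
    (R : Matrix ((O × I) × S) ((O × I) × S) ℂ) : Prop :=
  R.PosSemidef ∧ ∀ i s i' s', ∑ o, R ((o, i), s) ((o, i'), s') = if (i, s) = (i', s') then 1 else 0

/-- The action `ρ ↦ Tr_{I S}[R (1 ⊗ ρᵀ)]` of the channel with Choi operator `R`. -/
def applyChoi [Fintype I] [Fintype S] (R : Matrix ((O × I) × S) ((O × I) × S) ℂ)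
    (ρ : Matrix (I × S) (I × S) ℂ) : Matrix O O ℂ :=
  Matrix.of fun o o' => ∑ q, ∑ q', R ((o, q.1), q.2) ((o', q'.1), q'.2) * ρ q q'

/-- The fidelity `⟨⟨T| C |T⟩⟩ / D²` between the Choi state `C / D` of a channel on a space of
dimension `D` and the Choi state `|T⟩⟩⟨⟨T| / D` of the unitary `T`. -/
def channelFidelity [Fintype I] (C : Matrix (I × I) (I × I) ℂ) (T : Matrix I I ℂ) : ℝ :=
  (star (dket T) ⬝ᵥ (C *ᵥ dket T)).re / (Fintype.card I : ℝ) ^ 2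

end Choi

/-! ### Learning boards as quantum combs -/

/-- `IsStorageComb N K`: the positive operator `K` on `H_o ⊗ H_i` (`H_o` = outputs, `H_i` = inputs
of the `N` uses of the black box, in temporal order) is of the form `1_{2N} ⊗ L^{(N-1)}`, where
`Tr_{2k+1}[L^{(k)}] = 1_{2k} ⊗ L^{(k-1)}` for `k = 0, …, N - 1` and `L^{(-1)} = 1`; here
`H_{2k+1}`, `H_{2k+2}` are the input and the output of the use number `k`, and `H_0` is trivial. -/
def IsStorageComb {d : ℕ} : (N : ℕ) → Matrix (Idx d N × Idx d N) (Idx d N × Idx d N) ℂ → Prop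
  | 0, K => K = 1
  | N + 1, K => ∃ Q : Matrix (Idx d N × Idx d (N + 1)) (Idx d N × Idx d (N + 1)) ℂ,
      Q.PosSemidef ∧
      (∀ (y y' : Idx d N) (b b' : Fin d) (x x' : Idx d (N + 1)),
        K (Fin.snoc y b, x) (Fin.snoc y' b', x') = if b = b' then Q (y, x) (y', x') else 0) ∧
      IsStorageComb N (Matrix.of fun s s' =>
        ∑ a : Fin d, Q (s.1, Fin.snoc s.2 a) (s'.1, Fin.snoc s'.2 a))

/-- The combs of the learning boards with `N` uses of the black box: positive operators `L` on
`(H_{2N+3} ⊗ H_{2N+2}) ⊗ (H_o ⊗ H_i)` satisfying the comb normalization. The input `H_{2N+2}` is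
received after the `N` uses; `H_{2N+2} = H_{2N+3} = (ℂ^d)^{⊗ M}`. -/
def IsLearningComb {d : ℕ} (N M : ℕ)
    (L : Matrix ((Idx d M × Idx d M) × (Idx d N × Idx d N))
      ((Idx d M × Idx d M) × (Idx d N × Idx d N)) ℂ) : Prop :=
  L.PosSemidef ∧ ∃ K, IsStorageComb N K ∧
    ∀ i s i' s', ∑ o, L ((o, i), s) ((o, i'), s') = if i = i' then K s s' else 0

/-- The comb of the strategy that applies the `N` uses in parallel to the first factor of
`φ ∈ H_i ⊗ A` (`A` an ancilla), keeps the result in a memory `H_o ⊗ A`, and later uses the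
retrieving channel with Choi operator `R` from `H_{2N+2} ⊗ (H_o ⊗ A)` to `H_{2N+3}`. -/
def parallelComb {d N : ℕ} {O I A : Type*} [Fintype A] (φ : Idx d N × A → ℂ)
    (R : Matrix ((O × I) × (Idx d N × A)) ((O × I) × (Idx d N × A)) ℂ) :
    Matrix ((O × I) × (Idx d N × Idx d N)) ((O × I) × (Idx d N × Idx d N)) ℂ :=
  Matrix.of fun q q' => ∑ a, ∑ a',
    R (q.1, (q.2.1, a)) (q'.1, (q'.2.1, a')) * (φ (q.2.2, a) * star (φ (q'.2.2, a')))

section Group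

variable {G : Type*} [Group G] [MeasurableSpace G] {d : ℕ}

/-- The figure of merit of a learning board `L` for the inversion task: with the channel
`C_U = L * |U⟩⟩⟨⟨U|^{⊗ N}` obtained by plugging in the `N` uses of `U`, the fidelity between `C_U`
and `U^{† ⊗ M}`, averaged over the group. -/
def inversionFidelity (μ : Measure G) (U : G →* Matrix.unitaryGroup (Fin d) ℂ) (N M : ℕ)
    (L : Matrix ((Idx d M × Idx d M) × (Idx d N × Idx d N))
      ((Idx d M × Idx d M) × (Idx d N × Idx d N)) ℂ) : ℝ :=
  ∫ g, channelFidelity (link L (ketbra (dket (tensorPow N (U g : Matrix (Fin d) (Fin d) ℂ)))))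
    (tensorPow M (U g : Matrix (Fin d) (Fin d) ℂ)ᴴ) ∂μ

/-- The inversion fidelity of a retrieving channel `R` acting on the input and on a memory that is
in the state `φ_U`. -/
def retrievalFidelity {S : Type*} [Fintype S] (μ : Measure G)
    (U : G →* Matrix.unitaryGroup (Fin d) ℂ) (M : ℕ) (φU : G → S → ℂ)
    (R : Matrix ((Idx d M × Idx d M) × S) ((Idx d M × Idx d M) × S) ℂ) : ℝ :=
  ∫ g, channelFidelity (link R (ketbra (φU g)))
    (tensorPow M (U g : Matrix (Fin d) (Fin d) ℂ)ᴴ) ∂μ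

/-- `P` is the density, with respect to `μ`, of a POVM with outcomes in `G`. -/
def IsPOVM {S : Type*} [Fintype S] [DecidableEq S] (μ : Measure G) (P : G → Matrix S S ℂ) : Prop :=
  (∀ g, (P g).PosSemidef) ∧
    ∀ s s', Integrable (fun g => P g s s') μ ∧ ∫ g, P g s s' ∂μ = if s = s' then 1 else 0

/-- The Choi operator `∫ |Û†⟩⟩⟨⟨Û†|^{⊗ M} ⊗ P_Ûᵀ dÛ` of the measure-and-rotate channel
`ρ ⊗ σ ↦ ∫ Tr[P_Û σ] Û^{† ⊗ M} ρ Û^{⊗ M} dÛ`. -/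
def measureRotate {S : Type*} (μ : Measure G) (U : G →* Matrix.unitaryGroup (Fin d) ℂ) (M : ℕ)
    (P : G → Matrix S S ℂ) : Matrix ((Idx d M × Idx d M) × S) ((Idx d M × Idx d M) × S) ℂ :=
  Matrix.of fun q q' =>
    ∫ g, ketbra (dket (tensorPow M (U g : Matrix (Fin d) (Fin d) ℂ)ᴴ)) q.1 q'.1 * P g q'.2 q.2 ∂μ

/-! ### Realignment of reference frames -/

/-- The uniform probability measure on the unit vectors of `ℂ^ι`. -/
def uniformPure (ι : Type*) [Fintype ι] :
    Measure (Metric.sphere (0 : EuclideanSpace ℂ ι) 1) :=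
  ((Measure.addHaar : Measure (EuclideanSpace ℂ ι)).toSphere Set.univ)⁻¹ •
    (Measure.addHaar : Measure (EuclideanSpace ℂ ι)).toSphere

/-- The state `σ_ψ = ∫ U^{⊗ M}|ψ⟩⟨ψ|U^{† ⊗ M} ⊗ |φ_U⟩⟨φ_U| dU` received by Bob. -/
def receivedState {S : Type*} (μ : Measure G) (U : G →* Matrix.unitaryGroup (Fin d) ℂ) (M : ℕ)
    (φU : G → S → ℂ) (ψ : Idx d M → ℂ) : Matrix (Idx d M × S) (Idx d M × S) ℂ :=
  Matrix.of fun q q' =>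
    ∫ g, ketbra (tensorPow M (U g : Matrix (Fin d) (Fin d) ℂ) *ᵥ ψ) q.1 q'.1 *
      ketbra (φU g) q.2 q'.2 ∂μ

/-- The fidelity `f = ∫ ⟨ψ| R'(σ_ψ) |ψ⟩ dψ` of the retrieved message. -/
def messageFidelity {S : Type*} [Fintype S] (μ : Measure G)
    (U : G →* Matrix.unitaryGroup (Fin d) ℂ) (M : ℕ) (φU : G → S → ℂ)
    (R : Matrix ((Idx d M × Idx d M) × S) ((Idx d M × Idx d M) × S) ℂ) : ℝ :=
  ∫ ψ : Metric.sphere (0 : EuclideanSpace ℂ (Idx d M)) 1,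
    (star (ψ.1.ofLp) ⬝ᵥ
      (applyChoi R (receivedState μ U M φU ψ.1.ofLp) *ᵥ ψ.1.ofLp)).re ∂(uniformPure (Idx d M))

end Group

/-! ### Irreducible decomposition, optimal states and POVM -/

/-- A unitary matrix representation as a representation on `ℂ^n`. -/
def toRep {G : Type*} [Group G] {n : ℕ} (V : G →* Matrix.unitaryGroup (Fin n) ℂ) :
    Representation ℂ G (Fin n → ℂ) where
  toFun g := Matrix.toLin' (V g : Matrix (Fin n) (Fin n) ℂ)
  map_one' := by simp [Module.End.one_eq_id]
  map_mul' g h := by simp [Matrix.toLin'_mul, Module.End.mul_eq_comp]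

/-- A decomposition of a unitary representation `ρ` (given by its matrices) into irreducible
representations, `ρ ≃ ⨁_j U_j ⊗ 1_{m_j}` by a unitary change of basis, with pairwise inequivalent
irreducible unitary `U_j` of dimension `d_j` and multiplicities `m_j ≥ 1`. -/
structure IrrepDecomposition {G : Type*} [Group G] {ι : Type*} [Fintype ι] [DecidableEq ι]
    (ρ : G → Matrix ι ι ℂ) where
  /-- the number of inequivalent irreducible components -/
  num : ℕ
  /-- the dimensions `d_j` -/
  dim : Fin num → ℕ
  /-- the multiplicities `m_j` -/
  mult : Fin num → ℕ
  mult_pos : ∀ j, 0 < mult j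
  /-- the irreducible representations `U_j` -/
  rep : ∀ j, G →* Matrix.unitaryGroup (Fin (dim j)) ℂ
  irreducible : ∀ j, (toRep (rep j)).IsIrreducible
  inequivalent : ∀ j k, j ≠ k → IsEmpty ((toRep (rep j)).Equiv (toRep (rep k)))
  /-- the change of basis -/
  basis : Matrix (Σ j, Fin (dim j) × Fin (mult j)) ι ℂ
  basis_mul : basis * basisᴴ = 1
  mul_basis : basisᴴ * basis = 1
  decomp : ∀ g, basis * ρ g * basisᴴ = Matrix.blockDiagonal' fun j =>
    (rep j g : Matrix (Fin (dim j)) (Fin (dim j)) ℂ) ⊗ₖ (1 : Matrix (Fin (mult j)) (Fin (mult j)) ℂ)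

namespace IrrepDecomposition

variable {G : Type*} [Group G] {ι : Type*} [Fintype ι] [DecidableEq ι] {ρ : G → Matrix ι ι ℂ}
  (D : IrrepDecomposition ρ)

/-- Basis labels of `H̃ = ⨁_j H_j ⊗ H_j`. -/
abbrev Mem : Type := Σ j, Fin (D.dim j) × Fin (D.dim j)

/-- The representation `Ũ = ⨁_j U_j ⊗ 1_j` on `H̃`. -/
def memRep (g : G) : Matrix D.Mem D.Mem ℂ :=
  Matrix.blockDiagonal' fun j =>
    (D.rep j g : Matrix (Fin (D.dim j)) (Fin (D.dim j)) ℂ) ⊗ₖ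
      (1 : Matrix (Fin (D.dim j)) (Fin (D.dim j)) ℂ)

/-- The state `|φ⟩ = ⨁_j √(p_j / d_j) |1_j⟩⟩ ∈ H̃`. -/
def state (p : Fin D.num → ℝ) : D.Mem → ℂ := fun q =>
  (Real.sqrt (p q.1 / D.dim q.1) : ℂ) *
    dket (1 : Matrix (Fin (D.dim q.1)) (Fin (D.dim q.1)) ℂ) q.2

/-- The state `|φ_U⟩ = Ũ|φ⟩`. -/
def stored (φ : D.Mem → ℂ) (g : G) : D.Mem → ℂ := D.memRep g *ᵥ φ

/-- The vector `|η_Û⟩ = ⨁_j √d_j |Û_j⟩⟩ ∈ H̃`. -/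
def eta (g : G) : D.Mem → ℂ := fun q =>
  (Real.sqrt (D.dim q.1) : ℂ) *
    dket (D.rep q.1 g : Matrix (Fin (D.dim q.1)) (Fin (D.dim q.1)) ℂ) q.2

/-- The POVM density `P_Û = |η_Û⟩⟨η_Û|` on `H̃`. -/
def povm (g : G) : Matrix D.Mem D.Mem ℂ := ketbra (D.eta g)

/-- The isometric embedding of `H̃` into `H ⊗ H`, where `H ≃ ⨁_j H_j ⊗ ℂ^{m_j}` carries `ρ`, through
one copy of each `H_j` in the first factor and the complex conjugate vectors in the second factor
(so that it maps `|A⟩⟩`, `A` on `H_j`, to `|A'⟩⟩`, `A'` being `A` on that copy and `0` on its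
orthogonal complement). It intertwines `Ũ` with `ρ ⊗ 1`. -/
def embed : Matrix (ι × ι) D.Mem ℂ := Matrix.of fun x q =>
  star (D.basis ⟨q.1, q.2.1, ⟨0, D.mult_pos q.1⟩⟩ x.1) *
    D.basis ⟨q.1, q.2.2, ⟨0, D.mult_pos q.1⟩⟩ x.2

/-- The POVM density `P_Û` on the subspace `H̃` of `H ⊗ H`, completed to a POVM on all of `H ⊗ H` by
a uniformly random outcome on the orthogonal complement of `H̃` (where no state is ever stored). -/
def fullPovm (g : G) : Matrix (ι × ι) (ι × ι) ℂ :=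
  D.embed * D.povm g * D.embedᴴ + (1 - D.embed * D.embedᴴ)

end IrrepDecomposition

/-- The comb of the strategy that stores `U^{⊗ N}` in parallel on the state
`|φ⟩ = ⨁_j √(p_j / d_j) |1_j⟩⟩` in `H̃ ⊆ H_i ⊗ A`, `A ≃ (ℂ^d)^{⊗ N}`, measures the POVM `P_Û` on the
memory, and performs `Û^{† ⊗ M}` on the new input. -/
def measureRotateComb {G : Type*} [Group G] [MeasurableSpace G] (μ : Measure G) {d : ℕ}
    (U : G →* Matrix.unitaryGroup (Fin d) ℂ) (N M : ℕ)
    (D : IrrepDecomposition fun g => tensorPow N (U g : Matrix (Fin d) (Fin d) ℂ))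
    (p : Fin D.num → ℝ) :
    Matrix ((Idx d M × Idx d M) × (Idx d N × Idx d N))
      ((Idx d M × Idx d M) × (Idx d N × Idx d N)) ℂ :=
  parallelComb (D.embed *ᵥ D.state p) (measureRotate μ U M D.fullPovm)

end UnitaryInversion

end

open UnitaryInversion

noncomputable section

namespace UnitaryInversion

/-! ### Averages over a compact group -/

section Averages

set_option linter.unusedSectionVars false

variable {G : Type*} [Group G] [TopologicalSpace G] [IsTopologicalGroup G] [CompactSpace G]
  [MeasurableSpace G] [BorelSpace G] (μ : Measure G)

/-! Write `χ` for the character of `U^{⊗ M}`, `χ_j` for that of `U_j`, and `merit p = ∑_{j,k} √p_j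
√p_k ∫ |χ|² χ_k χ̄_j`. Every strategy is bounded by `merit q` for some probability vector `q`, and
measure-and-rotate on `φ^p` attains `merit p`; the optimal `p` maximizes the continuous function
`merit` on the compact simplex.

Upper bound. The stored states of a token, and `|U⟩⟩^{⊗ N}` for a general board, are linear images
`J (⨁_j |U_j⟩⟩)` of one orbit. Pulling the operator back along `J` (`overlap_pullback`,
`pullback_marginal`) gives `R ≥ 0` on output, input and `H̃` with `Tr_O R = 1 ⊗ K`, and the averaged
overlap is the trace of `R` against an orbit average of rank one projections. The central inequality
is `orbit_average_le`: if `f(g) = ⟨w, W_g w⟩` is a class function, then `∫ W_g |w⟩⟨w| W_g† ≤ ∫ f̄(g)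
W_g`. Here `W = 1 ⊗ Ū^{⊗ M} ⊗ conj Ũ` acts trivially on the output, so the trace of `R` against the
right-hand side sees only `K`, and by Schur's lemma only the weights `q_j = (∑_a K_aa) / d_j`, the
sum running over the diagonal entries of block `j`. The seed `w` may carry any positive weight on
each block; choosing the square of the weight close to `√q_j` yields `merit q`
(`integral_overlap_le`). Orthogonality of matrix coefficients and the normalization of combs or
channels give `∑ q_j = 1` (`sum_weight_eq_one`, `IsStorageComb.sum_unitary`). For `φ^p` the weights
are exactly `p` (`weight_tokenMatrix_state`), so measure-and-rotate is the best retrieving for each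
`p` separately.

Attainment. The amplitude `⟨η_h, φ^p_g⟩` is `∑_j √p_j χ_j(h⁻¹ g)` and the overlap of the two
rotations is `χ̄(h⁻¹ g)`; invariance of Haar measure turns the fidelity into `merit p / d^{2M}`
(`overlap_measureRotate_state`).

Reference frames. The message fidelity is quartic in `ψ`, and the fourth moments of a uniform unit
vector (`pureMoment_eq`) make it the increasing affine function `(1 + D F') / (D + 1)` of the
inversion fidelity, with `D = d^M` (`messageFidelity_eq`). -/

theorem isMulRightInvariant_of_compact [μ.IsHaarMeasure] [IsProbabilityMeasure μ] :
    μ.IsMulRightInvariant := by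
  constructor
  intro g
  have : (μ.map (· * g)).IsHaarMeasure := Measure.isHaarMeasure_map_mul_right μ g
  have : IsProbabilityMeasure (μ.map (· * g)) :=
    Measure.isProbabilityMeasure_map (measurable_mul_const g).aemeasurable
  exact Measure.isHaarMeasure_eq_of_isProbabilityMeasure _ _

/-- Inversion exchanges left and right invariance, so `μ.inv` is again a Haar probability measure
and uniqueness applies. Right invariance comes from uniqueness in the same way. -/
theorem isInvInvariant_of_compact [μ.IsHaarMeasure] [IsProbabilityMeasure μ] :
    μ.IsInvInvariant := by
  have := isMulRightInvariant_of_compact μ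
  constructor
  have : IsProbabilityMeasure μ.inv :=
    Measure.isProbabilityMeasure_map measurable_inv.aemeasurable
  have : IsFiniteMeasureOnCompacts μ.inv := inferInstance
  have : μ.inv.IsOpenPosMeasure :=
    (Homeomorph.inv G).continuous.isOpenPosMeasure_map (Homeomorph.inv G).surjective
  have : μ.inv.IsHaarMeasure := {}
  exact Measure.isHaarMeasure_eq_of_isProbabilityMeasure _ _

theorem integrable_of_continuous_compact [IsFiniteMeasureOnCompacts μ] {f : G → ℂ}
    (hf : Continuous f) : Integrable f μ :=
  hf.integrable_of_hasCompactSupport (HasCompactSupport.of_compactSpace f)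

/-- The entrywise average of a matrix valued function. -/
def average {m n : Type*} (F : G → Matrix m n ℂ) : Matrix m n ℂ :=
  Matrix.of fun i j => ∫ g, F g i j ∂μ

variable {l m n : Type*}

section

variable [IsFiniteMeasureOnCompacts μ]

theorem average_mul_left [Fintype m] (A : Matrix l m ℂ) {F : G → Matrix m n ℂ}
    (hF : Continuous F) : average μ (fun g => A * F g) = A * average μ F := by
  ext i j
  have h : ∀ k, Continuous fun g => F g k j := fun k => hF.matrix_elem k j
  simp only [average, Matrix.of_apply, Matrix.mul_apply]
  rw [integral_finsetSum _ fun k _ =>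
    (integrable_of_continuous_compact μ (h k)).const_mul (A i k)]
  simp [integral_const_mul]

theorem average_mul_right [Fintype m] {F : G → Matrix l m ℂ} (hF : Continuous F)
    (A : Matrix m n ℂ) : average μ (fun g => F g * A) = average μ F * A := by
  ext i j
  have h : ∀ k, Continuous fun g => F g i k := fun k => hF.matrix_elem i k
  simp only [average, Matrix.of_apply, Matrix.mul_apply]
  rw [integral_finsetSum _ fun k _ =>
    (integrable_of_continuous_compact μ (h k)).mul_const (A k j)]
  simp [integral_mul_const]

theorem trace_average [Fintype m] {F : G → Matrix m m ℂ} (hF : Continuous F) :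
    (average μ F).trace = ∫ g, (F g).trace ∂μ := by
  simp only [average, Matrix.trace, Matrix.diag, Matrix.of_apply]
  rw [integral_finsetSum _ fun k _ =>
    integrable_of_continuous_compact μ (hF.matrix_elem k k)]

theorem dotProduct_average_mulVec [Fintype m] {F : G → Matrix m m ℂ} (hF : Continuous F)
    (u v : m → ℂ) : u ⬝ᵥ (average μ F *ᵥ v) = ∫ g, u ⬝ᵥ (F g *ᵥ v) ∂μ := by
  have h : ∀ i k, Continuous fun g => F g i k := fun i k => hF.matrix_elem i k
  simp only [dotProduct, mulVec, average, Matrix.of_apply, Finset.mul_sum]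
  rw [integral_finsetSum _ fun i _ => integrable_of_continuous_compact μ (by
    exact continuous_finsetSum _ fun k _ => by have := h i k; fun_prop)]
  refine Finset.sum_congr rfl fun i _ => ?_
  rw [integral_finsetSum _ fun k _ => integrable_of_continuous_compact μ (by
    have := h i k; fun_prop)]
  simp [integral_const_mul, integral_mul_const]

end

theorem conjTranspose_average (F : G → Matrix l m ℂ) :
    (average μ F)ᴴ = average μ fun g => (F g)ᴴ := by
  ext i j
  exact (integral_conj (f := fun g => F g j i)).symm

theorem average_posSemidef [IsFiniteMeasureOnCompacts μ] [Fintype m] {F : G → Matrix m m ℂ}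
    (hF : Continuous F) (h : ∀ g, (F g).PosSemidef) : (average μ F).PosSemidef := by
  refine PosSemidef.of_dotProduct_mulVec_nonneg ?_ fun x => ?_
  · rw [IsHermitian, conjTranspose_average]
    exact congrArg _ (funext fun g => (h g).isHermitian)
  · rw [dotProduct_average_mulVec μ hF]
    exact integral_nonneg fun g => (h g).dotProduct_mulVec_nonneg x

theorem average_mul_const [μ.IsHaarMeasure] [IsProbabilityMeasure μ] (F : G → Matrix l m ℂ)
    (h : G) : average μ (fun g => F (g * h)) = average μ F := by
  have := isMulRightInvariant_of_compact μ
  ext i j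
  exact integral_mul_right_eq_self (fun g => F g i j) h

theorem average_const_mul [μ.IsMulLeftInvariant] (F : G → Matrix l m ℂ) (h : G) :
    average μ (fun g => F (h * g)) = average μ F := by
  ext i j
  exact integral_mul_left_eq_self (fun g => F g i j) h

theorem average_inv [μ.IsHaarMeasure] [IsProbabilityMeasure μ] (F : G → Matrix l m ℂ) :
    average μ (fun g => F g⁻¹) = average μ F := by
  have := isInvInvariant_of_compact μ
  ext i j
  exact integral_inv_eq_self (fun g => F g i j) μ

theorem average_const [IsProbabilityMeasure μ] (A : Matrix l m ℂ) :
    average μ (fun _ => A) = A := by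
  ext i j
  simp [average]

end Averages

/-! ### Positivity of matrices. -/

section Domination

theorem trace_mul_nonneg {n : Type*} [Fintype n] [DecidableEq n] {A B : Matrix n n ℂ}
    (hA : A.PosSemidef) (hB : B.PosSemidef) : 0 ≤ (A * B).trace := by
  open scoped MatrixOrder in
  obtain ⟨C, rfl⟩ := CStarAlgebra.nonneg_iff_eq_star_mul_self.mp hB.nonneg
  rw [star_eq_conjTranspose, ← Matrix.mul_assoc, Matrix.trace_mul_comm, ← Matrix.mul_assoc]
  exact (hA.mul_mul_conjTranspose_same C).trace_nonneg

/-- The eigenvalues of `Z * Z * Z` are the cubes of those of `Z`, and an odd power keeps the sign.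
-/
theorem posSemidef_of_cube {n : Type*} [Fintype n] [DecidableEq n] {Z : Matrix n n ℂ}
    (hZ : Z.IsHermitian) (h : (Z * Z * Z).PosSemidef) : Z.PosSemidef := by
  rw [hZ.posSemidef_iff_eigenvalues_nonneg]
  intro i
  have h1 := hZ.mulVec_eigenvectorBasis i
  have h2 := h.dotProduct_mulVec_nonneg (hZ.eigenvectorBasis i).ofLp
  have h3 : star (hZ.eigenvectorBasis i).ofLp ⬝ᵥ (hZ.eigenvectorBasis i).ofLp = 1 := by
    have := (orthonormal_iff_ite.1 hZ.eigenvectorBasis.orthonormal) i i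
    rw [EuclideanSpace.inner_eq_star_dotProduct, if_pos rfl] at this
    rw [dotProduct_comm]
    exact this
  rw [← mulVec_mulVec, ← mulVec_mulVec, h1, mulVec_smul, h1, mulVec_smul, mulVec_smul, h1,
    dotProduct_smul, dotProduct_smul, dotProduct_smul, h3] at h2
  have h4 : (0 : ℂ) ≤ ((hZ.eigenvalues i ^ 3 : ℝ) : ℂ) := by
    convert h2 using 1
    simp [pow_succ, mul_assoc]
  have h5 : 0 ≤ hZ.eigenvalues i ^ 3 := by exact_mod_cast h4
  exact (Odd.pow_nonneg_iff (by decide)).1 h5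

end Domination

/-! ### Orbit averages and class functions. -/

section ClassFunctions

set_option linter.unusedSectionVars false

variable {G : Type*} [Group G] [TopologicalSpace G] [IsTopologicalGroup G] [CompactSpace G]
  [MeasurableSpace G] [BorelSpace G] (μ : Measure G) [μ.IsHaarMeasure] [IsProbabilityMeasure μ]

/-- The average of a representation weighted by a class function commutes with it. -/
theorem average_class_smul_commute {n : Type*} [Fintype n] [DecidableEq n]
    (W : G →* Matrix n n ℂ) (hW : Continuous W) {k : G → ℂ} (hk : Continuous k)
    (hcl : ∀ g h, k (h * g * h⁻¹) = k g) (h : G) :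
    W h * average μ (fun g => k g • W g) = average μ (fun g => k g • W g) * W h := by
  have hc : Continuous fun g => k g • W g := hk.smul hW
  rw [← average_mul_left μ _ hc, ← average_mul_right μ hc,
    ← average_mul_const μ (fun g => W h * (k g • W g)) h,
    ← average_const_mul μ (fun g => (k g • W g) * W h) h]
  congr 1
  funext g
  have h1 : k (h * g) = k (g * h) := by rw [← hcl (g * h) h]; congr 1; group
  rw [h1]
  simp only [map_mul, Matrix.mul_smul, Matrix.smul_mul, Matrix.mul_assoc]

theorem ketbra_mulVec {n m : Type*} [Fintype n] (A : Matrix m n ℂ) (w : n → ℂ) :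
    ketbra (A *ᵥ w) = A * ketbra w * Aᴴ := by
  rw [ketbra, ketbra, star_mulVec, mul_vecMulVec, vecMulVec_mul]

theorem ketbra_posSemidef {n : Type*} [Fintype n] (w : n → ℂ) : (ketbra w).PosSemidef :=
  posSemidef_vecMulVec_self_star w

theorem ketbra_mul_mul_ketbra {n : Type*} [Fintype n] (w : n → ℂ) (A : Matrix n n ℂ) :
    ketbra w * A * ketbra w = (star w ⬝ᵥ (A *ᵥ w)) • ketbra w := by
  rw [ketbra, vecMulVec_mul, vecMulVec_mul_vecMulVec, ← dotProduct_mulVec]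
  ext i j
  simp [vecMulVec_apply]
  ring

/-- For a unitary representation `W` and a vector `w` whose matrix coefficient
`f g = ⟨w, W g w⟩` is a class function, the orbit average `∫ W g |w⟩⟨w| (W g)ᴴ` is dominated by
`∫ star (f g) W g`. -/
theorem orbit_average_le {n : Type*} [Fintype n] [DecidableEq n]
    (W : G →* Matrix n n ℂ) (hW : Continuous W) (hu : ∀ g, (W g)ᴴ = W g⁻¹) (w : n → ℂ)
    (hcl : ∀ g h, star w ⬝ᵥ (W (h * g * h⁻¹) *ᵥ w) = star w ⬝ᵥ (W g *ᵥ w)) :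
    (average μ (fun g => star (star w ⬝ᵥ (W g *ᵥ w)) • W g) -
      average μ (fun g => ketbra (W g *ᵥ w))).PosSemidef := by
  -- With `A` the weighted average of `W` and `X` the orbit average, `A ≥ 0` and `X² = XA = AX`, so
  -- an eigenvalue of `X` is either `0` or the corresponding eigenvalue of `A`. In matrix form: `(A
  -- - X) X = 0`, hence `(A - X)³ = (A - X) A (A - X) ≥ 0`.
  set f : G → ℂ := fun g => star w ⬝ᵥ (W g *ᵥ w) with hf
  have hfc : Continuous f := by
    rw [hf]; exact continuous_const.dotProduct (hW.matrix_mulVec continuous_const)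
  have hfs : Continuous fun g => star (f g) := continuous_star.comp hfc
  have hinv : ∀ g, star (f g) = f g⁻¹ := by
    intro g
    simp only [hf]
    rw [← star_dotProduct_star, star_star, star_mulVec, hu, ← dotProduct_mulVec]
  have hWm : Continuous fun g => star (f g) • W g := hfs.smul hW
  have hk : ∀ g, ketbra (W g *ᵥ w) = W g * ketbra w * W g⁻¹ := by
    intro g; rw [ketbra_mulVec, hu]
  have hconj : ∀ C : Matrix n n ℂ, Continuous fun g => W g * C * W g⁻¹ := fun C =>
    (hW.matrix_mul continuous_const).matrix_mul (hW.comp continuous_inv)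
  have hXc : Continuous fun g => ketbra (W g *ᵥ w) := by
    simp only [hk]
    exact hconj _
  set A := average μ (fun g => star (f g) • W g) with hA
  set X := average μ (fun g => ketbra (W g *ᵥ w)) with hX
  have hXh : X.PosSemidef := average_posSemidef μ hXc fun g => ketbra_posSemidef _
  have hAherm : Aᴴ = A := by
    rw [hA, conjTranspose_average, ← average_inv μ (fun g => star (f g) • W g)]
    congr 1
    funext g
    rw [conjTranspose_smul, hu, star_star, hinv, inv_inv]
  have hAcomm : ∀ h, W h * A = A * W h := fun h =>
    average_class_smul_commute μ W hW hfs
      (fun g h => by simp only [hf]; rw [hcl g h]) h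
  -- `A` is positive, because it is the Gram average of the operators `∫ W g |u⟩⟨w| (W g)ᴴ`
  have hApos : A.PosSemidef := by
    refine PosSemidef.of_dotProduct_mulVec_nonneg hAherm fun u => ?_
    have hBc : Continuous fun g => W g * vecMulVec u (star w) * W g⁻¹ :=
      hconj _
    set B := average μ (fun g => W g * vecMulVec u (star w) * W g⁻¹) with hB
    have hBcomm : ∀ h, W h * B * W h⁻¹ = B := by
      intro h
      conv_lhs => rw [hB, ← average_mul_left μ _ hBc, ← average_mul_right μ (continuous_const.matrix_mul hBc)]
      rw [hB, ← average_const_mul μ (fun g => W g * vecMulVec u (star w) * W g⁻¹) h]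
      congr 1
      funext g
      simp only [map_mul, _root_.mul_inv_rev, Matrix.mul_assoc]
    -- `B` commutes with `W`, so one of the two averages in `Bᴴ * B` is redundant. The trace is then
    -- `⟨u, B w⟩ = ∫ ⟨u, W_g u⟩ f(g⁻¹)`, and `f(g⁻¹)` is the conjugate of `f(g)`.
    have h1 : (Bᴴ * B).trace = star u ⬝ᵥ (A *ᵥ u) := by
      have h2 : Bᴴ * B = average μ fun g => W g * (vecMulVec w (star u) * B) * W g⁻¹ := by
        rw [hB, conjTranspose_average, ← hB, ← average_mul_right μ]
        · congr 1
          funext g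
          rw [conjTranspose_mul, conjTranspose_mul, hu, hu, inv_inv, conjTranspose_vecMulVec,
            star_star]
          conv_lhs => rw [← hBcomm g]
          have h3 : W g⁻¹ * W g = 1 := by rw [← map_mul]; simp
          calc W g * (vecMulVec w (star u) * W g⁻¹) * (W g * B * W g⁻¹)
              = W g * (vecMulVec w (star u) * (W g⁻¹ * W g) * B) * W g⁻¹ := by
                simp only [Matrix.mul_assoc]
            _ = _ := by rw [h3, Matrix.mul_one]
        · exact continuous_star.comp hBc |>.congr fun g => rfl
      rw [h2, trace_average μ (hconj _)]
      have h4 : ∀ g, (W g * (vecMulVec w (star u) * B) * W g⁻¹).trace =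
          (vecMulVec w (star u) * B).trace := by
        intro g
        rw [Matrix.trace_mul_comm, ← Matrix.mul_assoc, ← map_mul]
        simp
      simp only [h4]
      rw [integral_const, probReal_univ, one_smul, vecMulVec_mul, trace_vecMulVec,
        dotProduct_comm, ← dotProduct_mulVec, hB, dotProduct_average_mulVec μ hBc,
        hA, dotProduct_average_mulVec μ hWm]
      refine integral_congr_ae (Filter.Eventually.of_forall fun g => ?_)
      simp only [mul_vecMulVec, vecMulVec_mul, smul_mulVec, dotProduct_smul, smul_eq_mul]
      rw [vecMulVec_mulVec, hinv]
      simp only [hf, dotProduct_smul, dotProduct_mulVec, MulOpposite.smul_eq_mul_unop,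
        MulOpposite.unop_op, mul_comm]
    rw [← h1]
    exact (posSemidef_conjTranspose_mul_self B).trace_nonneg
  have hXX : X * X = X * A := by
    rw [hX, ← average_mul_right μ hXc, ← average_mul_right μ hXc]
    congr 1
    funext g
    rw [← hX]
    have h1 : X = W g * X * W g⁻¹ := by
      conv_rhs => rw [hX, ← average_mul_left μ _ hXc, ← average_mul_right μ (continuous_const.matrix_mul hXc)]
      rw [hX, ← average_const_mul μ (fun g => ketbra (W g *ᵥ w)) g]
      congr 1
      funext h
      rw [hk, hk]
      simp only [map_mul, _root_.mul_inv_rev, Matrix.mul_assoc]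
    have h3 : W g⁻¹ * W g = 1 := by rw [← map_mul]; simp
    -- Between two copies of `|w⟩⟨w|`, `W_k` contributes only the number `f k`; what remains is
    -- `|w⟩⟨w| ∫ f(k) W_k⁻¹`, and the integral is `Aᴴ = A`.
    have h5 : ketbra w * X = ketbra w * A := by
      rw [hX, ← average_mul_left μ _ hXc]
      rw [← hAherm, hA, conjTranspose_average, ← average_mul_left μ]
      · congr 1
        funext k
        rw [hk, ← Matrix.mul_assoc, ← Matrix.mul_assoc, ketbra_mul_mul_ketbra, conjTranspose_smul,
          star_star, hu]
        simp [hf]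
      · exact continuous_star.comp hWm |>.congr fun g => rfl
    calc ketbra (W g *ᵥ w) * X = W g * ketbra w * W g⁻¹ * (W g * X * W g⁻¹) := by rw [← h1, hk]
      _ = W g * (ketbra w * (W g⁻¹ * W g) * X) * W g⁻¹ := by simp only [Matrix.mul_assoc]
      _ = W g * (ketbra w * A) * W g⁻¹ := by rw [h3, Matrix.mul_one, h5]
      _ = W g * ketbra w * (A * W g⁻¹) := by simp only [Matrix.mul_assoc]
      _ = ketbra (W g *ᵥ w) * A := by rw [← hAcomm, hk, Matrix.mul_assoc _ _ A]
  have hXA : A * X = X * X := by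
    have := congrArg conjTranspose hXX
    rw [conjTranspose_mul, conjTranspose_mul, hXh.isHermitian, hAherm] at this
    exact this.symm
  have hZh : (A - X).IsHermitian := by
    rw [IsHermitian, conjTranspose_sub, hAherm, hXh.isHermitian]
  refine posSemidef_of_cube hZh ?_
  have h6 : (A - X) * X = 0 := by rw [Matrix.sub_mul, hXA, sub_self]
  have h7 : (A - X) * (A - X) * (A - X) = (A - X)ᴴ * A * (A - X) := by
    rw [hZh, Matrix.mul_sub (A - X) A X, h6, sub_zero]
  rw [h7]
  exact hApos.conjTranspose_mul_mul_same _

end ClassFunctions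

/-! ### Schur's lemma and orthogonality of matrix coefficients. -/

section Schur

set_option linter.unusedSectionVars false

variable {G : Type*} [Group G] {m n : ℕ}
  {V : G →* Matrix.unitaryGroup (Fin m) ℂ} {W : G →* Matrix.unitaryGroup (Fin n) ℂ}

/-- The intertwining map given by an intertwining matrix. -/
def intertwiner (B : Matrix (Fin n) (Fin m) ℂ)
    (h : ∀ g, (W g : Matrix (Fin n) (Fin n) ℂ) * B = B * (V g : Matrix (Fin m) (Fin m) ℂ)) :
    (toRep V).IntertwiningMap (toRep W) :=
  (Matrix.toLin' B).intertwiningMap_of_isIntertwiningMap _ _ (by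
    intro g v
    change Matrix.toLin' B (Matrix.toLin' _ v) = Matrix.toLin' _ (Matrix.toLin' B v)
    rw [toLin'_apply, toLin'_apply, toLin'_apply, toLin'_apply, mulVec_mulVec, mulVec_mulVec, h])

theorem intertwiner_eq_zero (hV : (toRep V).IsIrreducible) (hW : (toRep W).IsIrreducible)
    (hVW : IsEmpty ((toRep V).Equiv (toRep W))) (B : Matrix (Fin n) (Fin m) ℂ)
    (h : ∀ g, (W g : Matrix (Fin n) (Fin n) ℂ) * B = B * (V g : Matrix (Fin m) (Fin m) ℂ)) :
    B = 0 := by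
  -- Schur's lemma enters as the instance making the intertwining maps between inequivalent
  -- irreducibles a subsingleton.
  have h1 : intertwiner B h = 0 := Subsingleton.elim _ _
  have h2 : Matrix.toLin' B = 0 := congrArg (fun f => f.toLinearMap) h1
  simpa using h2

theorem intertwiner_scalar (hV : (toRep V).IsIrreducible) (B : Matrix (Fin m) (Fin m) ℂ)
    (h : ∀ g, (V g : Matrix (Fin m) (Fin m) ℂ) * B = B * (V g : Matrix (Fin m) (Fin m) ℂ)) :
    ∃ z : ℂ, B = z • 1 := by
  obtain ⟨z, hz⟩ := (Representation.IsIrreducible.algebraMap_intertwiningMap_bijective_of_isAlgClosed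
    (ρ := toRep V)).2 (intertwiner B h)
  refine ⟨z, ?_⟩
  have h2 : Matrix.toLin' (z • (1 : Matrix (Fin m) (Fin m) ℂ)) = Matrix.toLin' B := by
    rw [map_smul, toLin'_one]
    exact congrArg (fun f => f.toLinearMap) hz
  exact (Matrix.toLin'.injective h2).symm

theorem dim_pos_of_isIrreducible (hV : (toRep V).IsIrreducible) : 0 < m := by
  rcases Nat.eq_zero_or_pos m with rfl | h
  · exfalso
    obtain ⟨a, b, hab⟩ := hV.toNontrivial
    apply hab
    apply Subrepresentation.toSubmodule_injective
    exact Subsingleton.elim _ _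
  · exact h

variable [TopologicalSpace G] [IsTopologicalGroup G] [CompactSpace G]
  [MeasurableSpace G] [BorelSpace G] (μ : Measure G) [μ.IsHaarMeasure] [IsProbabilityMeasure μ]

/-- A class function integrated against an irreducible representation gives a scalar. -/
theorem integral_class_mul_rep (hV : (toRep V).IsIrreducible) (hVc : Continuous V) {k : G → ℂ}
    (hk : Continuous k) (hcl : ∀ g h, k (h * g * h⁻¹) = k g) (a b : Fin m) :
    ∫ g, k g * (V g : Matrix (Fin m) (Fin m) ℂ) a b ∂μ =
      if a = b then (∫ g, k g * (V g : Matrix (Fin m) (Fin m) ℂ).trace ∂μ) / m else 0 := by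
  have hm : (m : ℂ) ≠ 0 := Nat.cast_ne_zero.2 (dim_pos_of_isIrreducible hV).ne'
  let V' : G →* Matrix (Fin m) (Fin m) ℂ := (Submonoid.subtype _).comp V
  have hV' : Continuous V' := continuous_subtype_val.comp hVc
  have hc : Continuous fun g => k g • V' g := hk.smul hV'
  obtain ⟨z, hz⟩ := intertwiner_scalar hV (average μ fun g => k g • V' g)
    (average_class_smul_commute μ V' hV' hk hcl)
  have h1 := trace_average μ hc
  rw [hz] at h1
  simp only [trace_smul, trace_one, Fintype.card_fin, smul_eq_mul] at h1
  have h2 : ∫ g, k g * (V g : Matrix (Fin m) (Fin m) ℂ) a b ∂μ = (z • (1 : Matrix (Fin m) (Fin m) ℂ)) a b := by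
    rw [← hz]; rfl
  rw [h2]
  change z * m = ∫ g, k g * (V g : Matrix (Fin m) (Fin m) ℂ).trace ∂μ at h1
  rw [← h1, Matrix.smul_apply, Matrix.one_apply]
  split_ifs <;> simp [hm]

theorem rep_average_intertwines (hVc : Continuous V) (hWc : Continuous W)
    (B : Matrix (Fin n) (Fin m) ℂ) (h : G) :
    (W h : Matrix (Fin n) (Fin n) ℂ) *
        average μ (fun g => (W g : Matrix (Fin n) (Fin n) ℂ) * B * (V g : Matrix (Fin m) (Fin m) ℂ)ᴴ) =
      average μ (fun g => (W g : Matrix (Fin n) (Fin n) ℂ) * B * (V g : Matrix (Fin m) (Fin m) ℂ)ᴴ) *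
        (V h : Matrix (Fin m) (Fin m) ℂ) := by
  have hc : Continuous fun g =>
      (W g : Matrix (Fin n) (Fin n) ℂ) * B * (V g : Matrix (Fin m) (Fin m) ℂ)ᴴ :=
    ((continuous_subtype_val.comp hWc).matrix_mul continuous_const).matrix_mul
      (continuous_subtype_val.comp hVc).matrix_conjTranspose
  rw [← average_mul_left μ _ hc, ← average_mul_right μ hc]
  conv_rhs => rw [← average_const_mul μ _ h]
  congr 1
  funext g
  have h1 : (V h : Matrix (Fin m) (Fin m) ℂ)ᴴ * V h = 1 := Unitary.coe_star_mul_self (V h)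
  simp only [map_mul, Submonoid.coe_mul, conjTranspose_mul, Matrix.mul_assoc]
  rw [h1, Matrix.mul_one]

/-- The average of `V_g E_{be} V_g†` over the group is a scalar by Schur's lemma, and its trace,
that of the matrix unit `E_{be}`, determines the scalar. -/
theorem orthogonality_self (hV : (toRep V).IsIrreducible) (hVc : Continuous V)
    (a b c e : Fin m) :
    ∫ g, (V g : Matrix (Fin m) (Fin m) ℂ) a b * star ((V g : Matrix (Fin m) (Fin m) ℂ) c e) ∂μ =
      if a = c ∧ b = e then (m : ℂ)⁻¹ else 0 := by
  have hm : (m : ℂ) ≠ 0 := Nat.cast_ne_zero.2 (dim_pos_of_isIrreducible hV).ne'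
  have hc : Continuous fun g => (V g : Matrix (Fin m) (Fin m) ℂ) * Matrix.single b e (1 : ℂ) *
      (V g : Matrix (Fin m) (Fin m) ℂ)ᴴ :=
    ((continuous_subtype_val.comp hVc).matrix_mul continuous_const).matrix_mul
      (continuous_subtype_val.comp hVc).matrix_conjTranspose
  obtain ⟨z, hz⟩ := intertwiner_scalar hV _
    (rep_average_intertwines μ hVc hVc (Matrix.single b e (1 : ℂ)))
  have h1 := trace_average μ hc
  have h2 : ∀ g, ((V g : Matrix (Fin m) (Fin m) ℂ) * Matrix.single b e (1 : ℂ) *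
      (V g : Matrix (Fin m) (Fin m) ℂ)ᴴ).trace = if b = e then 1 else 0 := by
    intro g
    have h3 : (V g : Matrix (Fin m) (Fin m) ℂ)ᴴ * V g = 1 := Unitary.coe_star_mul_self (V g)
    rw [Matrix.trace_mul_comm, ← Matrix.mul_assoc, h3, Matrix.one_mul]
    split_ifs with h
    · subst h; simp
    · exact trace_single_eq_of_ne _ _ _ h
  rw [hz] at h1
  simp only [h2, trace_smul, trace_one, Fintype.card_fin, smul_eq_mul, integral_const,
    probReal_univ, one_smul] at h1
  have h3 : ∫ g, (V g : Matrix (Fin m) (Fin m) ℂ) a b * star ((V g : Matrix (Fin m) (Fin m) ℂ) c e) ∂μ =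
      (z • (1 : Matrix (Fin m) (Fin m) ℂ)) a c := by
    rw [← hz]
    refine integral_congr_ae (Filter.Eventually.of_forall fun g => ?_)
    simp [Matrix.mul_apply, Matrix.single_apply, ite_and]
  rw [h3, Matrix.smul_apply, Matrix.one_apply]
  have h4 : z = (if b = e then 1 else 0) * (m : ℂ)⁻¹ := by rw [← h1]; field_simp
  rw [h4]
  by_cases h5 : a = c <;> by_cases h6 : b = e <;> simp [h5, h6]

theorem orthogonality_ne (hV : (toRep V).IsIrreducible) (hW : (toRep W).IsIrreducible)
    (hVc : Continuous V) (hWc : Continuous W) (hVW : IsEmpty ((toRep V).Equiv (toRep W)))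
    (a b : Fin n) (c e : Fin m) :
    ∫ g, (W g : Matrix (Fin n) (Fin n) ℂ) a b * star ((V g : Matrix (Fin m) (Fin m) ℂ) c e) ∂μ =
      0 := by
  have hz := intertwiner_eq_zero hV hW hVW _
    (rep_average_intertwines μ hVc hWc (Matrix.single b e (1 : ℂ)))
  have h3 : ∫ g, (W g : Matrix (Fin n) (Fin n) ℂ) a b *
      star ((V g : Matrix (Fin m) (Fin m) ℂ) c e) ∂μ = (0 : Matrix (Fin n) (Fin m) ℂ) a c := by
    rw [← hz]
    refine integral_congr_ae (Filter.Eventually.of_forall fun g => ?_)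
    simp [Matrix.mul_apply, Matrix.single_apply, ite_and]
  rw [h3]; rfl

end Schur

/-! ### Existence of irreducible decompositions -/

section Decomposition

set_option linter.unusedSectionVars false

variable {G : Type*} [Group G] {ι : Type*} [Fintype ι] [DecidableEq ι]

theorem unitary_conjTranspose_inv (ρ : G →* Matrix.unitaryGroup ι ℂ) (g : G) :
    (ρ g : Matrix ι ι ℂ)ᴴ = ρ g⁻¹ := by
  rw [map_inv]; rfl

/-- `T` is an isometry intertwining the unitary representation `V` with `ρ`. -/
structure IsCopy (ρ : G →* Matrix.unitaryGroup ι ℂ) {n : ℕ}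
    (V : G →* Matrix.unitaryGroup (Fin n) ℂ) (T : Matrix ι (Fin n) ℂ) : Prop where
  isometry : Tᴴ * T = 1
  intertwines : ∀ g, (ρ g : Matrix ι ι ℂ) * T = T * (V g : Matrix (Fin n) (Fin n) ℂ)

theorem IsCopy.conjTranspose_intertwines {ρ : G →* Matrix.unitaryGroup ι ℂ} {n : ℕ}
    {V : G →* Matrix.unitaryGroup (Fin n) ℂ} {T : Matrix ι (Fin n) ℂ} (h : IsCopy ρ V T) (g : G) :
    Tᴴ * (ρ g : Matrix ι ι ℂ) = (V g : Matrix (Fin n) (Fin n) ℂ) * Tᴴ := by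
  have h1 := congrArg conjTranspose (h.intertwines g⁻¹)
  rwa [conjTranspose_mul, conjTranspose_mul, unitary_conjTranspose_inv, unitary_conjTranspose_inv,
    inv_inv] at h1

theorem IsCopy.comp {ρ : G →* Matrix.unitaryGroup ι ℂ} {n m : ℕ}
    {V : G →* Matrix.unitaryGroup (Fin n) ℂ} {T : Matrix ι (Fin n) ℂ} (h : IsCopy ρ V T)
    {W : G →* Matrix.unitaryGroup (Fin m) ℂ} {S : Matrix (Fin n) (Fin m) ℂ} (h' : IsCopy V W S) :
    IsCopy ρ W (T * S) where
  isometry := by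
    rw [conjTranspose_mul, Matrix.mul_assoc, ← Matrix.mul_assoc _ T, h.isometry, Matrix.one_mul,
      h'.isometry]
  intertwines g := by
    rw [← Matrix.mul_assoc, h.intertwines, Matrix.mul_assoc, h'.intertwines, Matrix.mul_assoc]

/-- An isometry whose range is invariant under `ρ` is a copy of some unitary representation. -/
theorem exists_isCopy_of_range (ρ : G →* Matrix.unitaryGroup ι ℂ) {n : ℕ}
    (T : Matrix ι (Fin n) ℂ) (hT : Tᴴ * T = 1)
    (hr : ∀ g, T * Tᴴ * ((ρ g : Matrix ι ι ℂ) * T) = (ρ g : Matrix ι ι ℂ) * T) :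
    ∃ V : G →* Matrix.unitaryGroup (Fin n) ℂ, IsCopy ρ V T := by
  have hmul : ∀ g h, (Tᴴ * (ρ g : Matrix ι ι ℂ) * T) * (Tᴴ * (ρ h : Matrix ι ι ℂ) * T) =
      Tᴴ * (ρ (g * h) : Matrix ι ι ℂ) * T := by
    intro g h
    calc (Tᴴ * (ρ g : Matrix ι ι ℂ) * T) * (Tᴴ * (ρ h : Matrix ι ι ℂ) * T)
        = Tᴴ * (ρ g : Matrix ι ι ℂ) * (T * Tᴴ * ((ρ h : Matrix ι ι ℂ) * T)) := by
          simp only [Matrix.mul_assoc]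
      _ = _ := by rw [hr, map_mul, Submonoid.coe_mul]; simp only [Matrix.mul_assoc]
  have hone : Tᴴ * (ρ 1 : Matrix ι ι ℂ) * T = 1 := by
    rw [map_one, OneMemClass.coe_one, Matrix.mul_one, hT]
  refine ⟨{ toFun := fun g => ⟨Tᴴ * (ρ g : Matrix ι ι ℂ) * T, ?_⟩
            map_one' := Subtype.ext hone
            map_mul' := fun g h => Subtype.ext (hmul g h).symm }, hT, fun g => ?_⟩
  · rw [Matrix.mem_unitaryGroup_iff, star_eq_conjTranspose, conjTranspose_mul, conjTranspose_mul,
      conjTranspose_conjTranspose, unitary_conjTranspose_inv, ← Matrix.mul_assoc Tᴴ, hmul,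
      mul_inv_cancel, hone]
  · change _ = T * (Tᴴ * (ρ g : Matrix ι ι ℂ) * T)
    conv_lhs => rw [← hr g]
    simp only [Matrix.mul_assoc]

/-- An orthonormal basis of a subspace, as an isometry. -/
theorem exists_isometry_of_submodule (W : Submodule ℂ (ι → ℂ)) :
    ∃ T : Matrix ι (Fin (Module.finrank ℂ W)) ℂ, Tᴴ * T = 1 ∧ (∀ x, T *ᵥ x ∈ W) ∧
      ∀ w ∈ W, (T * Tᴴ) *ᵥ w = w := by
  let e : EuclideanSpace ℂ ι ≃ₗ[ℂ] (ι → ℂ) := WithLp.linearEquiv 2 ℂ (ι → ℂ)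
  let W' : Submodule ℂ (EuclideanSpace ℂ ι) := W.comap e.toLinearMap
  have hfr : Module.finrank ℂ W' = Module.finrank ℂ W := by
    have : W'.map e.toLinearMap = W := Submodule.map_comap_eq_of_surjective e.surjective W
    rw [← this]
    exact (LinearEquiv.finrank_map_eq e W').symm
  let b : OrthonormalBasis (Fin (Module.finrank ℂ W)) ℂ W' :=
    (stdOrthonormalBasis ℂ W').reindex (finCongr hfr)
  let T : Matrix ι (Fin (Module.finrank ℂ W)) ℂ := Matrix.of fun i a => (b a : EuclideanSpace ℂ ι) i
  have hTm : ∀ x, T *ᵥ x = e ((∑ a, x a • b a : W') : EuclideanSpace ℂ ι) := by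
    intro x
    ext i
    simp [T, e, mulVec, dotProduct, mul_comm]
  have hT : Tᴴ * T = 1 := by
    ext a c
    have := (orthonormal_iff_ite.1 b.orthonormal) a c
    rw [Submodule.coe_inner, EuclideanSpace.inner_eq_star_dotProduct] at this
    rw [Matrix.mul_apply, Matrix.one_apply, ← this, dotProduct]
    refine Finset.sum_congr rfl fun i _ => ?_
    simp [T, mul_comm]
  refine ⟨T, hT, fun x => ?_, fun w hw => ?_⟩
  · rw [hTm]
    exact (∑ a, x a • b a : W').2
  · obtain ⟨x, hx⟩ : ∃ x, T *ᵥ x = w := by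
      let w' : W' := ⟨e.symm w, by simpa [W'] using hw⟩
      refine ⟨fun a => b.repr w' a, ?_⟩
      rw [hTm, b.sum_repr]
      simp [w']
    rw [← hx, mulVec_mulVec, Matrix.mul_assoc, hT, Matrix.mul_one]

theorem exists_isCopy_of_submodule (ρ : G →* Matrix.unitaryGroup ι ℂ) (W : Submodule ℂ (ι → ℂ))
    (hW : ∀ g, ∀ w ∈ W, (ρ g : Matrix ι ι ℂ) *ᵥ w ∈ W) :
    ∃ (V : G →* Matrix.unitaryGroup (Fin (Module.finrank ℂ W)) ℂ)
      (T : Matrix ι (Fin (Module.finrank ℂ W)) ℂ), IsCopy ρ V T ∧ ∀ x, T *ᵥ x ∈ W := by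
  obtain ⟨T, hT, hr, hp⟩ := exists_isometry_of_submodule W
  obtain ⟨V, hV⟩ := exists_isCopy_of_range ρ T hT (by
    intro g
    refine Matrix.ext_of_mulVec_single fun i => ?_
    rw [← mulVec_mulVec _ (T * Tᴴ), ← mulVec_mulVec (Pi.single i 1) (ρ g).1 T]
    exact hp _ (hW g _ (hr _)))
  exact ⟨V, T, hV, hr⟩

/-- A nonzero invariant subspace contains a copy of an irreducible representation. -/
theorem exists_irreducible_isCopy (ρ : G →* Matrix.unitaryGroup ι ℂ) (W : Submodule ℂ (ι → ℂ))
    (hW : ∀ g, ∀ w ∈ W, (ρ g : Matrix ι ι ℂ) *ᵥ w ∈ W) (hne : W ≠ ⊥) :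
    ∃ (n : ℕ) (V : G →* Matrix.unitaryGroup (Fin n) ℂ) (T : Matrix ι (Fin n) ℂ),
      (toRep V).IsIrreducible ∧ IsCopy ρ V T ∧ ∀ x, T *ᵥ x ∈ W := by
  classical
  -- A copy of least positive dimension inside `W` is irreducible: a nonzero subrepresentation
  -- contains a copy of positive dimension, which by minimality cannot be smaller.
  have hex : ∃ n, 0 < n ∧ ∃ (V : G →* Matrix.unitaryGroup (Fin n) ℂ) (T : Matrix ι (Fin n) ℂ),
      IsCopy ρ V T ∧ ∀ x, T *ᵥ x ∈ W := by
    obtain ⟨V, T, h⟩ := exists_isCopy_of_submodule ρ W hW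
    exact ⟨_, Nat.pos_of_ne_zero fun h0 => hne (Submodule.finrank_eq_zero.1 h0), V, T, h⟩
  obtain ⟨hpos, V, T, hT, hr⟩ := Nat.find_spec hex
  refine ⟨Nat.find hex, V, T, ?_, hT, hr⟩
  have : Nonempty (Fin (Nat.find hex)) := ⟨⟨0, hpos⟩⟩
  have hnt : Nontrivial (Subrepresentation (toRep V)) := by
    refine ⟨⊥, ⊤, fun h => ?_⟩
    exact bot_ne_top (α := Submodule ℂ (Fin (Nat.find hex) → ℂ))
      (congrArg Subrepresentation.toSubmodule h)
  refine ⟨fun σ => or_iff_not_imp_left.2 fun hσ => ?_⟩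
  obtain ⟨V', S, hS, hrS⟩ := exists_isCopy_of_submodule V σ.toSubmodule
    (fun g w hw => σ.apply_mem_toSubmodule g hw)
  have hσ' : σ.toSubmodule ≠ ⊥ := fun h => hσ (Subrepresentation.toSubmodule_injective h)
  have hle := Nat.find_min' hex ⟨Nat.pos_of_ne_zero fun h0 => hσ' (Submodule.finrank_eq_zero.1 h0),
    V', T * S, hT.comp hS, fun x => by rw [← mulVec_mulVec]; exact hr _⟩
  apply Subrepresentation.toSubmodule_injective
  refine Submodule.eq_top_of_finrank_eq (le_antisymm (Submodule.finrank_le _) ?_)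
  rw [Module.finrank_fin_fun]
  exact hle

/-- Equivalent irreducible unitary representations have the same copies. -/
theorem IsCopy.of_equiv {ρ : G →* Matrix.unitaryGroup ι ℂ} {n m : ℕ}
    {V : G →* Matrix.unitaryGroup (Fin n) ℂ} {T : Matrix ι (Fin n) ℂ} (h : IsCopy ρ V T)
    {W : G →* Matrix.unitaryGroup (Fin m) ℂ} (hV : (toRep V).IsIrreducible)
    (hW : (toRep W).IsIrreducible) (e : (toRep V).Equiv (toRep W)) :
    ∃ C : Matrix (Fin m) (Fin n) ℂ, IsCopy ρ W (T * Cᴴ) := by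
  let B : Matrix (Fin m) (Fin n) ℂ := LinearMap.toMatrix' e.toLinearMap
  have hB : ∀ g, (W g : Matrix (Fin m) (Fin m) ℂ) * B = B * (V g : Matrix (Fin n) (Fin n) ℂ) := by
    intro g
    refine Matrix.ext_of_mulVec_single fun i => ?_
    rw [← mulVec_mulVec, ← mulVec_mulVec]
    simp only [B, LinearMap.toMatrix'_mulVec]
    exact (Representation.IntertwiningMap.isIntertwining _ _ e.toIntertwiningMap g (Pi.single i 1)).symm
  have hBH : ∀ g, (V g : Matrix (Fin n) (Fin n) ℂ) * Bᴴ = Bᴴ * (W g : Matrix (Fin m) (Fin m) ℂ) := by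
    intro g
    have h1 := congrArg conjTranspose (hB g⁻¹)
    rw [conjTranspose_mul, conjTranspose_mul, unitary_conjTranspose_inv, unitary_conjTranspose_inv,
      inv_inv] at h1
    exact h1.symm
  -- By Schur's lemma `Bᴴ * B` is a scalar, positive because `B ≠ 0`; dividing `B` by the square
  -- root of the scalar makes the equivalence an isometry.
  obtain ⟨z, hz⟩ := intertwiner_scalar hV (Bᴴ * B) fun g => by
    rw [← Matrix.mul_assoc, hBH, Matrix.mul_assoc, hB, Matrix.mul_assoc]
  have hn := dim_pos_of_isIrreducible hV
  have hB0 : B ≠ 0 := by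
    intro h0
    have h1 : e.toLinearMap = 0 := by simpa [B] using h0
    have h2 : (Pi.single ⟨0, hn⟩ 1 : Fin n → ℂ) = 0 := by
      apply e.toLinearEquiv.injective
      rw [map_zero]
      exact congrArg (fun f => f (Pi.single ⟨0, hn⟩ 1)) h1
    simpa using congrFun h2 ⟨0, hn⟩
  have hz0 : 0 ≤ z := by
    have h1 := (posSemidef_conjTranspose_mul_self B).diag_nonneg (i := ⟨0, hn⟩)
    rw [hz] at h1
    simpa using h1
  have hz1 : z ≠ 0 := by
    rintro rfl
    rw [zero_smul] at hz
    exact hB0 (conjTranspose_mul_self_eq_zero.1 hz)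
  obtain ⟨r, hr0, hr⟩ : ∃ r : ℝ, r ≠ 0 ∧ z = (r : ℂ) * r := by
    refine ⟨Real.sqrt z.re, ?_, ?_⟩
    · have : 0 < z := lt_of_le_of_ne hz0 (Ne.symm hz1)
      exact (Real.sqrt_pos.2 (Complex.pos_iff.1 this).1).ne'
    · rw [← Complex.ofReal_mul, Real.mul_self_sqrt (Complex.nonneg_iff.1 hz0).1]
      exact Complex.ext rfl (Complex.nonneg_iff.1 hz0).2.symm
  have hrc : (r : ℂ) ≠ 0 := Complex.ofReal_ne_zero.2 hr0
  let C : Matrix (Fin m) (Fin n) ℂ := ((r : ℂ)⁻¹) • B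
  have hC1 : Cᴴ * C = 1 := by
    simp only [C, conjTranspose_smul, Matrix.smul_mul, Matrix.mul_smul, hz, hr, smul_smul]
    simp [hrc]
  have hCB : ∀ g, (W g : Matrix (Fin m) (Fin m) ℂ) * C = C * (V g : Matrix (Fin n) (Fin n) ℂ) := by
    intro g; simp only [C, Matrix.mul_smul, Matrix.smul_mul, hB]
  have hCH : ∀ g, (V g : Matrix (Fin n) (Fin n) ℂ) * Cᴴ = Cᴴ * (W g : Matrix (Fin m) (Fin m) ℂ) := by
    intro g; simp only [C, conjTranspose_smul, Matrix.mul_smul, Matrix.smul_mul, hBH]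
  -- The dimensions `m` and `n` are not identified, so `C * Cᴴ = 1` needs a second use of Schur's
  -- lemma; the scalar is `1` because `C * Cᴴ * C = C`.
  obtain ⟨y, hy⟩ := intertwiner_scalar hW (C * Cᴴ) fun g => by
    rw [← Matrix.mul_assoc, hCB, Matrix.mul_assoc, hCH, Matrix.mul_assoc]
  have hC0 : C ≠ 0 := by
    simp [C, hB0, hr0]
  have hy1 : y = 1 := by
    have h1 : y • C = C := by
      calc y • C = (C * Cᴴ) * C := by rw [hy, Matrix.smul_mul, Matrix.one_mul]
        _ = C := by rw [Matrix.mul_assoc, hC1, Matrix.mul_one]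
    have h2 : (y - 1) • C = 0 := by rw [sub_smul, h1, one_smul, sub_self]
    rcases smul_eq_zero.1 h2 with h3 | h3
    · exact sub_eq_zero.1 h3
    · exact absurd h3 hC0
  rw [hy1, one_smul] at hy
  refine ⟨C, ?_, fun g => ?_⟩
  · rw [conjTranspose_mul, conjTranspose_conjTranspose, Matrix.mul_assoc, ← Matrix.mul_assoc _ T,
      h.isometry, Matrix.one_mul, hy]
  · rw [← Matrix.mul_assoc, h.intertwines, Matrix.mul_assoc, hCH, Matrix.mul_assoc]

end Decomposition

/-! ### Complete orthogonal families of irreducible copies. -/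

section DecompositionExists

set_option linter.unusedSectionVars false

variable {G : Type*} [Group G] {ι : Type*} [Fintype ι] [DecidableEq ι]

/-- A pairwise orthogonal family of copies in `ρ` of irreducible representations which are equal or
inequivalent. -/
structure IsOrthogonalFamily (ρ : G →* Matrix.unitaryGroup ι ℂ)
    (F : Finset (Σ k : (Σ n, G →* Matrix.unitaryGroup (Fin n) ℂ), Matrix ι (Fin k.1) ℂ)) :
    Prop where
  irreducible : ∀ t ∈ F, (toRep t.1.2).IsIrreducible
  isCopy : ∀ t ∈ F, IsCopy ρ t.1.2 t.2
  orthogonal : ∀ s ∈ F, ∀ t ∈ F, s ≠ t → s.2ᴴ * t.2 = 0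
  inequivalent : ∀ s ∈ F, ∀ t ∈ F, s.1 ≠ t.1 → IsEmpty ((toRep s.1.2).Equiv (toRep t.1.2))

variable {ρ : G →* Matrix.unitaryGroup ι ℂ}
  {F : Finset (Σ k : (Σ n, G →* Matrix.unitaryGroup (Fin n) ℂ), Matrix ι (Fin k.1) ℂ)}

theorem IsOrthogonalFamily.conjTranspose_mul_sum (hF : IsOrthogonalFamily ρ F) {s}
    (hs : s ∈ F) : s.2ᴴ * ∑ t ∈ F, t.2 * t.2ᴴ = s.2ᴴ := by
  rw [Matrix.mul_sum, Finset.sum_eq_single_of_mem s hs, ← Matrix.mul_assoc,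
    (hF.isCopy s hs).isometry, Matrix.one_mul]
  intro t ht hts
  rw [← Matrix.mul_assoc, hF.orthogonal s hs t ht hts.symm, Matrix.zero_mul]

theorem IsOrthogonalFamily.isHermitian_sum (F : Finset (Σ k : (Σ n, G →* Matrix.unitaryGroup (Fin n) ℂ), Matrix ι (Fin k.1) ℂ)) :
    (∑ t ∈ F, t.2 * t.2ᴴ)ᴴ = ∑ t ∈ F, t.2 * t.2ᴴ := by
  rw [conjTranspose_sum]
  exact Finset.sum_congr rfl fun t _ => by rw [conjTranspose_mul, conjTranspose_conjTranspose]

theorem IsOrthogonalFamily.sum_mul_sum (hF : IsOrthogonalFamily ρ F) :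
    (∑ t ∈ F, t.2 * t.2ᴴ) * ∑ t ∈ F, t.2 * t.2ᴴ = ∑ t ∈ F, t.2 * t.2ᴴ := by
  conv_lhs => rw [Matrix.sum_mul]
  exact Finset.sum_congr rfl fun t ht => by
    rw [Matrix.mul_assoc, hF.conjTranspose_mul_sum ht]

/-- The sum of the range projections is a projection whose trace is the sum of the dimensions, each
at least `1`; a projection has trace at most the dimension of the space. -/
theorem IsOrthogonalFamily.card_le (hF : IsOrthogonalFamily ρ F) : F.card ≤ Fintype.card ι := by
  set P := ∑ t ∈ F, t.2 * t.2ᴴ with hP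
  have h1 : (1 - P) = (1 - P)ᴴ * (1 - P) := by
    rw [conjTranspose_sub, conjTranspose_one, IsOrthogonalFamily.isHermitian_sum,
      ← hP, Matrix.sub_mul, Matrix.mul_sub, Matrix.mul_sub, hF.sum_mul_sum, ← hP]
    simp
  have h2 : 0 ≤ (1 - P).trace := by
    rw [h1]; exact (posSemidef_conjTranspose_mul_self _).trace_nonneg
  have h3 : P.trace = ((∑ t ∈ F, t.1.1 : ℕ) : ℂ) := by
    rw [hP, trace_sum, Nat.cast_sum]
    refine Finset.sum_congr rfl fun t ht => ?_
    rw [Matrix.trace_mul_comm, (hF.isCopy t ht).isometry]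
    simp
  rw [trace_sub, trace_one, h3, sub_nonneg, Nat.cast_le] at h2
  refine le_trans ?_ h2
  rw [Finset.card_eq_sum_ones]
  exact Finset.sum_le_sum fun t ht => dim_pos_of_isIrreducible (hF.irreducible t ht)

/-- The kernel of the projection `P` on the sum of the copies is invariant, and nonzero when `P ≠
1`, so it contains one more irreducible copy, orthogonal to the others. -/
theorem IsOrthogonalFamily.exists_insert (hF : IsOrthogonalFamily ρ F)
    (hne : ∑ t ∈ F, t.2 * t.2ᴴ ≠ 1) :
    ∃ F', IsOrthogonalFamily ρ F' ∧ F.card < F'.card := by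
  classical
  set P := ∑ t ∈ F, t.2 * t.2ᴴ with hP
  let W : Submodule ℂ (ι → ℂ) := LinearMap.ker P.mulVecLin
  have hPcomm : ∀ g, (ρ g : Matrix ι ι ℂ) * P = P * (ρ g : Matrix ι ι ℂ) := by
    intro g
    rw [hP, Matrix.mul_sum, Matrix.sum_mul]
    refine Finset.sum_congr rfl fun t ht => ?_
    rw [← Matrix.mul_assoc, (hF.isCopy t ht).intertwines, Matrix.mul_assoc, Matrix.mul_assoc,
      (hF.isCopy t ht).conjTranspose_intertwines]
  have hW : ∀ g, ∀ w ∈ W, (ρ g : Matrix ι ι ℂ) *ᵥ w ∈ W := by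
    intro g w hw
    simp only [W, LinearMap.mem_ker, mulVecLin_apply] at hw ⊢
    rw [mulVec_mulVec, ← hPcomm, ← mulVec_mulVec, hw, mulVec_zero]
  have hWne : W ≠ ⊥ := by
    intro h
    apply hne
    refine Matrix.ext_of_mulVec_single fun i => ?_
    have h1 : (Pi.single i 1 - P *ᵥ Pi.single i 1 : ι → ℂ) ∈ W := by
      simp only [W, LinearMap.mem_ker, mulVecLin_apply]
      rw [mulVec_sub, mulVec_mulVec, hF.sum_mul_sum, sub_self]
    rw [h, Submodule.mem_bot, sub_eq_zero] at h1
    rw [one_mulVec, ← h1]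
  obtain ⟨n, V, T, hV, hT, hTW⟩ := exists_irreducible_isCopy ρ W hW hWne
  -- replace the new copy by a copy of an equivalent representation of the family, if any
  obtain ⟨t, ht1, ht2, ht3, ht4⟩ : ∃ t : (Σ k : (Σ n, G →* Matrix.unitaryGroup (Fin n) ℂ),
      Matrix ι (Fin k.1) ℂ), (toRep t.1.2).IsIrreducible ∧ IsCopy ρ t.1.2 t.2 ∧
      (∀ s ∈ F, s.1 ≠ t.1 → IsEmpty ((toRep s.1.2).Equiv (toRep t.1.2))) ∧ P * t.2 = 0 := by
    have hPT : P * T = 0 := by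
      refine Matrix.ext_of_mulVec_single fun i => ?_
      rw [← mulVec_mulVec, zero_mulVec]
      exact hTW _
    by_cases h : ∃ s ∈ F, Nonempty ((toRep s.1.2).Equiv (toRep V))
    · obtain ⟨s, hs, ⟨e⟩⟩ := h
      obtain ⟨C, hC⟩ := hT.of_equiv hV (hF.irreducible s hs) e.symm
      refine ⟨⟨s.1, T * Cᴴ⟩, hF.irreducible s hs, hC, fun r hr => hF.inequivalent r hr s hs, ?_⟩
      rw [← Matrix.mul_assoc, hPT, Matrix.zero_mul]
    · refine ⟨⟨⟨n, V⟩, T⟩, hV, hT, fun s hs _ => ?_, hPT⟩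
      by_contra hc
      exact h ⟨s, hs, not_isEmpty_iff.1 hc⟩
  have horth : ∀ s ∈ F, s.2ᴴ * t.2 = 0 := by
    intro s hs
    rw [← hF.conjTranspose_mul_sum hs, Matrix.mul_assoc, ← hP, ht4, Matrix.mul_zero]
  have hnot : t ∉ F := by
    intro h
    have h1 := horth t h
    rw [ht2.isometry] at h1
    have : Nonempty (Fin t.1.1) := ⟨⟨0, dim_pos_of_isIrreducible ht1⟩⟩
    exact one_ne_zero h1
  refine ⟨insert t F, ⟨?_, ?_, ?_, ?_⟩, by rw [Finset.card_insert_of_notMem hnot]; omega⟩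
  · intro s hs
    rcases Finset.mem_insert.1 hs with rfl | hs
    exacts [ht1, hF.irreducible s hs]
  · intro s hs
    rcases Finset.mem_insert.1 hs with rfl | hs
    exacts [ht2, hF.isCopy s hs]
  · intro r hr s hs hrs
    rcases Finset.mem_insert.1 hr with rfl | hr <;> rcases Finset.mem_insert.1 hs with rfl | hs
    · exact absurd rfl hrs
    · have h1 := congrArg conjTranspose (horth s hs)
      rwa [conjTranspose_mul, conjTranspose_conjTranspose, conjTranspose_zero] at h1
    · exact horth r ‹_›
    · exact hF.orthogonal r hr s hs hrs
  · intro r hr s hs hrs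
    rcases Finset.mem_insert.1 hr with rfl | hr <;> rcases Finset.mem_insert.1 hs with rfl | hs
    · exact absurd rfl hrs
    · exact ⟨fun e => (ht3 s hs (Ne.symm hrs)).false e.symm⟩
    · exact ht3 r ‹_› hrs
    · exact hF.inequivalent r hr s hs hrs

theorem exists_complete_family (ρ : G →* Matrix.unitaryGroup ι ℂ) :
    ∃ F, IsOrthogonalFamily ρ F ∧ ∑ t ∈ F, t.2 * t.2ᴴ = 1 := by
  -- If no family were complete, families could be enlarged indefinitely, against the bound
  -- `card_le`.
  by_contra! hcon
  have h : ∀ n : ℕ, ∃ F, IsOrthogonalFamily ρ F ∧ n ≤ F.card := by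
    intro n
    induction n with
    | zero => exact ⟨∅, ⟨by simp, by simp, by simp, by simp⟩, by simp⟩
    | succ n ih =>
      obtain ⟨F, hF, hn⟩ := ih
      obtain ⟨F', hF', hlt⟩ := hF.exists_insert (hcon F hF)
      exact ⟨F', hF', by omega⟩
  obtain ⟨F, hF, hn⟩ := h (Fintype.card ι + 1)
  have := hF.card_le
  omega

/-- Every finite-dimensional unitary representation has an irreducible decomposition. -/
theorem nonempty_irrepDecomposition (ρ : G →* Matrix.unitaryGroup ι ℂ) :
    Nonempty (IrrepDecomposition fun g => (ρ g : Matrix ι ι ℂ)) := by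
  classical
  obtain ⟨F, hF, hsum⟩ := exists_complete_family ρ
  -- Representations in the family are equal or inequivalent, so the distinct ones label the
  -- isotypic components; the multiplicity of a label is the number of isometries of `F` lying over
  -- it.
  let J := F.image Sigma.fst
  let e : Fin J.card ≃ J := J.equivFin.symm
  let κ : Fin J.card → Σ n, G →* Matrix.unitaryGroup (Fin n) ℂ := fun j => (e j).1
  have hκ : Function.Injective κ := fun a b h => e.injective (Subtype.ext h)
  let fib (j : Fin J.card) := {T : Matrix ι (Fin (κ j).1) ℂ // (⟨κ j, T⟩ :
    Σ k : (Σ n, G →* Matrix.unitaryGroup (Fin n) ℂ), Matrix ι (Fin k.1) ℂ) ∈ F}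
  have hfin : ∀ j, Finite (fib j) := fun j =>
    Finite.of_injective (fun T : fib j => (⟨⟨κ j, T.1⟩, T.2⟩ : F)) fun S T h => by
      exact Subtype.ext (by simpa using h)
  let φ (j : Fin J.card) : Fin (Nat.card (fib j)) ≃ fib j := (Finite.equivFin (fib j)).symm
  have hex : ∀ j, ∃ T, (⟨κ j, T⟩ :
      Σ k : (Σ n, G →* Matrix.unitaryGroup (Fin n) ℂ), Matrix ι (Fin k.1) ℂ) ∈ F := by
    intro j
    obtain ⟨t, ht, htj⟩ := Finset.mem_image.1 (e j).2
    obtain ⟨k, T⟩ := t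
    change k = κ j at htj
    subst htj
    exact ⟨T, ht⟩
  have hmem : ∀ j m, (⟨κ j, (φ j m).1⟩ :
      Σ k : (Σ n, G →* Matrix.unitaryGroup (Fin n) ℂ), Matrix ι (Fin k.1) ℂ) ∈ F :=
    fun j m => (φ j m).2
  -- The change of basis stacks the adjoints of all isometries, so that a block of `b * A * bᴴ` is
  -- `Tᴴ * A * T'` for two members `T`, `T'` of the family.
  let b : Matrix (Σ j : Fin J.card, Fin (κ j).1 × Fin (Nat.card (fib j))) ι ℂ :=
    Matrix.of fun q x => star ((φ q.1 q.2.2).1 x q.2.1)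
  have hgram : ∀ j k (a : Fin (κ j).1) (m : Fin (Nat.card (fib j))) (c : Fin (κ k).1)
      (n : Fin (Nat.card (fib k))) (A : Matrix ι ι ℂ),
      (b * A * bᴴ) ⟨j, a, m⟩ ⟨k, c, n⟩ = ((φ j m).1ᴴ * A * (φ k n).1) a c := by
    intro j k a m c n A
    simp [b, Matrix.mul_apply]
  have horth : ∀ j k (m : Fin (Nat.card (fib j))) (n : Fin (Nat.card (fib k))),
      (⟨j, m⟩ : Σ j : Fin J.card, Fin (Nat.card (fib j))) ≠ ⟨k, n⟩ →
      (φ j m).1ᴴ * (φ k n).1 = 0 := by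
    intro j k m n hne
    refine hF.orthogonal _ (hmem j m) _ (hmem k n) fun h => hne ?_
    have h1 : j = k := hκ (congrArg Sigma.fst h)
    subst h1
    have h2 : (φ j m).1 = (φ j n).1 := eq_of_heq (Sigma.mk.inj h).2
    rw [(φ j).injective (Subtype.ext h2)]
  exact ⟨{
    num := J.card
    dim := fun j => (κ j).1
    mult := fun j => Nat.card (fib j)
    mult_pos := fun j => by
      obtain ⟨T, hT⟩ := hex j
      have : Nonempty (fib j) := ⟨⟨T, hT⟩⟩
      exact Nat.card_pos
    rep := fun j => (κ j).2
    irreducible := fun j => by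
      obtain ⟨T, hT⟩ := hex j
      exact hF.irreducible _ hT
    inequivalent := fun j k hjk => by
      obtain ⟨T, hT⟩ := hex j
      obtain ⟨S, hS⟩ := hex k
      exact hF.inequivalent _ hT _ hS fun h => hjk (hκ h)
    basis := b
    basis_mul := by
      ext ⟨j, a, m⟩ ⟨k, c, n⟩
      have h1 := hgram j k a m c n 1
      rw [Matrix.mul_one, Matrix.mul_one] at h1
      rw [h1]
      by_cases h : (⟨j, m⟩ : Σ j : Fin J.card, Fin (Nat.card (fib j))) = ⟨k, n⟩
      · obtain rfl : j = k := congrArg Sigma.fst h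
        obtain rfl : m = n := eq_of_heq (Sigma.mk.inj h).2
        rw [(hF.isCopy _ (hmem j m)).isometry]
        simp [Matrix.one_apply]
      · rw [horth j k m n h, Matrix.zero_apply, Matrix.one_apply, if_neg]
        intro h2
        apply h
        obtain rfl : j = k := congrArg Sigma.fst h2
        have h3 := eq_of_heq (Sigma.mk.inj h2).2
        rw [(Prod.mk.inj h3).2]
    mul_basis := by
      rw [← hsum]
      have h1 : bᴴ * b = ∑ q : (Σ j : Fin J.card, Fin (Nat.card (fib j))),
          (φ q.1 q.2).1 * (φ q.1 q.2).1ᴴ := by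
        ext x y
        simp only [Matrix.mul_apply, Matrix.sum_apply, Fintype.sum_sigma, Fintype.sum_prod_type]
        refine Finset.sum_congr rfl fun j _ => ?_
        rw [Finset.sum_comm]
        simp [b]
      rw [h1]
      refine Finset.sum_bij (fun q _ => ⟨κ q.1, (φ q.1 q.2).1⟩) (fun q _ => hmem q.1 q.2) ?_ ?_
        (fun q _ => rfl)
      · rintro ⟨j, m⟩ - ⟨k, n⟩ - h
        obtain rfl : j = k := hκ (congrArg Sigma.fst h)
        have h2 : (φ j m).1 = (φ j n).1 := eq_of_heq (Sigma.mk.inj h).2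
        rw [(φ j).injective (Subtype.ext h2)]
      · rintro ⟨k, T⟩ ht
        obtain ⟨j, rfl⟩ : ∃ j, κ j = k :=
          ⟨e.symm ⟨k, Finset.mem_image_of_mem Sigma.fst ht⟩, by simp [κ]⟩
        exact ⟨⟨j, (φ j).symm ⟨T, ht⟩⟩, Finset.mem_univ _, by simp⟩
    decomp := fun g => by
      ext ⟨j, a, m⟩ ⟨k, c, n⟩
      rw [hgram, Matrix.mul_assoc, (hF.isCopy _ (hmem k n)).intertwines, ← Matrix.mul_assoc]
      by_cases h : (⟨j, m⟩ : Σ j : Fin J.card, Fin (Nat.card (fib j))) = ⟨k, n⟩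
      · obtain rfl : j = k := congrArg Sigma.fst h
        obtain rfl : m = n := eq_of_heq (Sigma.mk.inj h).2
        rw [(hF.isCopy _ (hmem j m)).isometry, Matrix.one_mul, blockDiagonal'_apply_eq]
        simp
      · rw [horth j k m n h, Matrix.zero_mul, Matrix.zero_apply]
        by_cases hjk : j = k
        · subst hjk
          have hmn : m ≠ n := fun h2 => h (by rw [h2])
          rw [blockDiagonal'_apply_eq]
          simp [hmn]
        · rw [blockDiagonal'_apply_ne _ _ _ hjk] }⟩

end DecompositionExists

/-! ### Second moments of the uniform measure on pure states -/

section Sphere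

open Metric
open scoped Pointwise

variable {E : Type*} [NormedAddCommGroup E] [NormedSpace ℝ E] [FiniteDimensional ℝ E]
  [MeasurableSpace E] [BorelSpace E]

/-- Uniqueness leaves a scalar factor, which is `1` because the unit ball is preserved and has
positive finite measure. -/
theorem addHaar_map_linearIsometryEquiv (ν : Measure E) [ν.IsAddHaarMeasure] (L : E ≃ₗᵢ[ℝ] E) :
    ν.map L = ν := by
  have h1 : (ν.map L).IsAddHaarMeasure :=
    L.toLinearEquiv.toAddEquiv.isAddHaarMeasure_map ν L.continuous L.symm.continuous
  obtain ⟨c, hc0, hct, hc⟩ : ∃ c : ENNReal, c ≠ 0 ∧ c ≠ ⊤ ∧ ν.map L = c • ν := by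
    have := Measure.isAddLeftInvariant_eq_smul (ν.map L) ν
    exact ⟨_, by simpa using (Measure.addHaarScalarFactor_pos_of_isAddHaarMeasure _ _).ne',
      ENNReal.coe_ne_top, this⟩
  have h2 : (ν.map L) (ball 0 1) = ν (ball 0 1) := by
    rw [Measure.map_apply L.continuous.measurable measurableSet_ball, L.preimage_ball, map_zero]
  have h3 : c = 1 := by
    rw [hc, Measure.smul_apply, smul_eq_mul] at h2
    have h4 : ν (ball 0 1) ≠ 0 := (measure_ball_pos ν 0 one_pos).ne'
    have h5 : ν (ball 0 1) ≠ ⊤ := measure_ball_lt_top.ne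
    exact (ENNReal.mul_eq_right h4 h5).1 h2
  rw [hc, h3, one_smul]

/-- The action of a linear isometry on the unit sphere. -/
def sphereHomeomorph (L : E ≃ₗᵢ[ℝ] E) : sphere (0 : E) 1 ≃ₜ sphere (0 : E) 1 :=
  L.toHomeomorph.subtype fun x => by simp

/-- The measure of a subset of the sphere is defined through the volume of the cone over it, and a
linear isometry carries cones to cones. -/
theorem toSphere_map_sphereHomeomorph (ν : Measure E) [ν.IsAddHaarMeasure] (L : E ≃ₗᵢ[ℝ] E) :
    ν.toSphere.map (sphereHomeomorph L) = ν.toSphere := by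
  ext s hs
  have hm := (sphereHomeomorph L).continuous.measurable
  rw [Measure.map_apply hm hs, ν.toSphere_apply' hs, ν.toSphere_apply' (hm hs)]
  congr 1
  conv_rhs => rw [← addHaar_map_linearIsometryEquiv ν L]
  refine Eq.trans ?_ (L.toHomeomorph.toMeasurableEquiv.map_apply _).symm
  congr 1
  ext x
  simp only [Set.mem_smul, Set.mem_image, Set.mem_preimage]
  constructor
  · rintro ⟨r, hr, _, ⟨y, hy, rfl⟩, rfl⟩
    exact ⟨r, hr, _, ⟨_, hy, rfl⟩, (map_smul L r _).symm⟩
  · rintro ⟨r, hr, _, ⟨y, hy, rfl⟩, h⟩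
    refine ⟨r, hr, _, ⟨(sphereHomeomorph L).symm y, by simpa using hy, rfl⟩, ?_⟩
    apply L.injective
    rw [map_smul]
    refine Eq.trans ?_ h
    congr 1
    exact congrArg Subtype.val ((sphereHomeomorph L).apply_symm_apply y)

end Sphere

/-! ### Fourth moments of a uniform unit vector. -/

section Moments

variable {ι : Type*} [Fintype ι]

theorem integral_uniformPure_comp (L : EuclideanSpace ℂ ι ≃ₗᵢ[ℂ] EuclideanSpace ℂ ι)
    (f : EuclideanSpace ℂ ι → ℂ) :
    ∫ ψ, f (L ψ.1) ∂(uniformPure ι) = ∫ ψ, f ψ.1 ∂(uniformPure ι) := by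
  let L' : EuclideanSpace ℂ ι ≃ₗᵢ[ℝ] EuclideanSpace ℂ ι :=
    { L.toLinearEquiv.restrictScalars ℝ with norm_map' := L.norm_map }
  simp only [uniformPure, integral_smul_measure]
  congr 1
  conv_rhs => rw [← toSphere_map_sphereHomeomorph Measure.addHaar L']
  rw [(sphereHomeomorph L').measurableEmbedding.integral_map]
  rfl

instance [Nonempty ι] : IsProbabilityMeasure (uniformPure ι) := by
  constructor
  rw [uniformPure, Measure.smul_apply, smul_eq_mul]
  refine ENNReal.inv_mul_cancel ?_ (measure_ne_top _ _)
  rw [Measure.measure_univ_ne_zero]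
  exact Measure.toSphere_ne_zero _

instance : IsFiniteMeasure (uniformPure ι) := by
  cases isEmpty_or_nonempty ι
  · constructor
    have : IsEmpty (Metric.sphere (0 : EuclideanSpace ℂ ι) 1) := by
      constructor
      rintro ⟨x, hx⟩
      have : x = 0 := Subsingleton.elim _ _
      simp [this] at hx
    rw [Set.univ_eq_empty_iff.2 this]; simp
  · infer_instance

theorem integrable_uniformPure {f : EuclideanSpace ℂ ι → ℂ} (hf : Continuous f) :
    Integrable (fun ψ : Metric.sphere (0 : EuclideanSpace ℂ ι) 1 => f ψ.1) (uniformPure ι) := by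
  have : CompactSpace (Metric.sphere (0 : EuclideanSpace ℂ ι) 1) :=
    isCompact_iff_compactSpace.1 (isCompact_sphere _ _)
  exact (hf.comp continuous_subtype_val).integrable_of_hasCompactSupport
    (HasCompactSupport.of_compactSpace _)

/-- The moments of order four of the uniform measure on unit vectors. -/
def pureMoment (a b c e : ι) : ℂ :=
  ∫ ψ, ψ.1 a * ψ.1 b * star (ψ.1 c) * star (ψ.1 e) ∂(uniformPure ι)

theorem integral_unitary_moment [DecidableEq ι] {u : Matrix ι ι ℂ} (hu : uᴴ * u = 1)
    (a b c e : ι) :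
    ∫ ψ, (u *ᵥ ψ.1.ofLp) a * (u *ᵥ ψ.1.ofLp) b * star ((u *ᵥ ψ.1.ofLp) c) *
      star ((u *ᵥ ψ.1.ofLp) e) ∂(uniformPure ι) = pureMoment a b c e := by
  let L₀ : EuclideanSpace ℂ ι →ₗᵢ[ℂ] EuclideanSpace ℂ ι :=
    (Matrix.toEuclideanLin u).isometryOfInner fun x y => by
      rw [EuclideanSpace.inner_eq_star_dotProduct, EuclideanSpace.inner_eq_star_dotProduct]
      change (u *ᵥ y.ofLp) ⬝ᵥ star (u *ᵥ x.ofLp) = _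
      rw [star_mulVec, dotProduct_comm, ← dotProduct_mulVec, mulVec_mulVec, hu, one_mulVec,
        dotProduct_comm]
  let L := L₀.toLinearIsometryEquiv rfl
  exact integral_uniformPure_comp L fun ψ => ψ a * ψ b * star (ψ c) * star (ψ e)

/-- Multiplying one coordinate `k` by `i` is unitary and multiplies the moment by a power of `i`;
unless the indices match in pairs, some `k` gives a factor other than `1`. A sign change would not
suffice: it does not detect `a = b ≠ c = e`. -/
theorem pureMoment_eq_zero [DecidableEq ι] {a b c e : ι} (h1 : ¬(a = c ∧ b = e))
    (h2 : ¬(a = e ∧ b = c)) : pureMoment a b c e = 0 := by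
  have key : ∀ k, (if a = k then Complex.I else 1) * (if b = k then Complex.I else 1) *
      star (if c = k then Complex.I else 1) * star (if e = k then Complex.I else 1) *
      pureMoment a b c e = pureMoment a b c e := by
    intro k
    let u : Matrix ι ι ℂ := Matrix.diagonal fun x => if x = k then Complex.I else 1
    have hu : uᴴ * u = 1 := by
      rw [diagonal_conjTranspose, diagonal_mul_diagonal, ← diagonal_one]
      congr 1
      funext x
      by_cases hx : x = k <;> simp [hx]
    conv_rhs => rw [← integral_unitary_moment hu]
    rw [pureMoment, ← integral_const_mul]
    refine integral_congr_ae (Filter.Eventually.of_forall fun ψ => ?_)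
    simp only [u, mulVec_diagonal, star_mul']
    ring
  have aux : ∀ z : ℂ, z ≠ 1 → z * pureMoment a b c e = pureMoment a b c e →
      pureMoment a b c e = 0 := by
    intro z hz h
    have : (z - 1) * pureMoment a b c e = 0 := by rw [sub_mul, h, one_mul, sub_self]
    exact (mul_eq_zero.1 this).resolve_left (sub_ne_zero.2 hz)
  have hI : Complex.I ≠ 1 := fun h => by simpa using congrArg Complex.im h
  by_cases hac : a = c
  · subst hac
    have hbe : b ≠ e := fun h => h1 ⟨rfl, h⟩
    refine aux _ ?_ (key b)
    by_cases hab : a = b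
    · simpa [hab, Ne.symm hbe] using hI
    · simpa [hab, Ne.symm hbe] using hI
  · by_cases hae : a = e
    · subst hae
      have hbc : b ≠ c := fun h => h2 ⟨rfl, h⟩
      refine aux _ ?_ (key b)
      by_cases hab : a = b
      · simpa [hab, Ne.symm hbc] using hI
      · simpa [hab, Ne.symm hbc] using hI
    · refine aux _ ?_ (key a)
      by_cases hab : b = a
      · simp [hab, Ne.symm hac, Ne.symm hae]
        norm_num
      · simpa [hab, Ne.symm hac, Ne.symm hae] using hI

theorem pureMoment_swap_left (a b c e : ι) : pureMoment a b c e = pureMoment b a c e := by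
  simp only [pureMoment]; congr 1; funext ψ; ring

theorem pureMoment_swap_right (a b c e : ι) : pureMoment a b c e = pureMoment a b e c := by
  simp only [pureMoment]; congr 1; funext ψ; ring

/-- A balanced rotation in the plane of two coordinates relates the moments. -/
theorem pureMoment_rotation [DecidableEq ι] {a b : ι} (hab : a ≠ b) :
    4 * pureMoment a a a a = pureMoment a a a a + pureMoment b b b b + 4 * pureMoment a b a b := by
  let r : ℂ := ((Real.sqrt 2)⁻¹ : ℝ)
  have hr : r * r = 1 / 2 := by
    simp only [r]
    rw [← Complex.ofReal_mul, ← mul_inv, Real.mul_self_sqrt (by norm_num)]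
    norm_num
  have hrs : star r = r := Complex.conj_ofReal _
  -- The Hadamard matrix on the coordinates `a`, `b`, the identity on the others.
  let u : Matrix ι ι ℂ := Matrix.of fun x y =>
    if x = a then (if y = a then r else if y = b then r else 0) else
    if x = b then (if y = a then r else if y = b then -r else 0) else if x = y then 1 else 0
  have huv : ∀ v : ι → ℂ, (u *ᵥ v) a = r * (v a + v b) := by
    intro v
    simp only [mulVec, dotProduct, u, Matrix.of_apply, if_true]
    rw [Finset.sum_eq_add a b hab]
    · simp [hab.symm]; ring
    · rintro c - ⟨h1, h2⟩
      simp [h1, h2]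
    · simp
    · simp
  have huT : uᴴ = u := by
    ext x y
    simp only [conjTranspose_apply, u, Matrix.of_apply, apply_ite star, hrs, star_neg, star_zero,
      star_one]
    grind
  have hu : uᴴ * u = 1 := by
    rw [huT]
    refine Matrix.ext_of_mulVec_single fun i => ?_
    rw [← mulVec_mulVec, one_mulVec]
    have huvb : ∀ v : ι → ℂ, (u *ᵥ v) b = r * (v a - v b) := by
      intro v
      simp only [mulVec, dotProduct, u, Matrix.of_apply, if_true, if_neg hab.symm]
      rw [Finset.sum_eq_add a b hab]
      · simp [hab.symm]; ring
      · rintro c - ⟨h1, h2⟩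
        simp [h1, h2]
      · simp
      · simp
    have huvc : ∀ (v : ι → ℂ) x, x ≠ a → x ≠ b → (u *ᵥ v) x = v x := by
      intro v x h1 h2
      simp [mulVec, dotProduct, u, h1, h2]
    funext x
    by_cases hxa : x = a
    · subst hxa
      rw [huv, huv, huvb]
      linear_combination (2 * (Pi.single i (1 : ℂ) : ι → ℂ) x) * hr
    · by_cases hxb : x = b
      · subst hxb
        rw [huvb, huv, huvb]
        linear_combination (2 * (Pi.single i (1 : ℂ) : ι → ℂ) x) * hr
      · rw [huvc _ _ hxa hxb, huvc _ _ hxa hxb]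
  have h := integral_unitary_moment hu a a a a
  let s : Bool → ι := fun i => if i then a else b
  have hexp : ∀ ψ : Metric.sphere (0 : EuclideanSpace ℂ ι) 1,
      (u *ᵥ ψ.1.ofLp) a * (u *ᵥ ψ.1.ofLp) a * star ((u *ᵥ ψ.1.ofLp) a) *
        star ((u *ᵥ ψ.1.ofLp) a) = 4⁻¹ * ∑ q : Bool × Bool × Bool × Bool,
          ψ.1 (s q.1) * ψ.1 (s q.2.1) * star (ψ.1 (s q.2.2.1)) * star (ψ.1 (s q.2.2.2)) := by
    intro ψ
    rw [huv]
    simp only [Fintype.sum_prod_type, Fintype.sum_bool, s, star_mul', star_add, hrs, if_true,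
      Bool.false_eq_true, if_false]
    linear_combination (r * r + 1 / 2) * ((ψ.1 a + ψ.1 b) * (ψ.1 a + ψ.1 b) *
      (star (ψ.1 a) + star (ψ.1 b)) * (star (ψ.1 a) + star (ψ.1 b))) * hr
  simp only [hexp] at h
  rw [integral_const_mul, integral_finsetSum _ fun q _ => integrable_uniformPure
    (f := fun ψ => ψ (s q.1) * ψ (s q.2.1) * star (ψ (s q.2.2.1)) * star (ψ (s q.2.2.2)))
    (by fun_prop)] at h
  change 4⁻¹ * ∑ q : Bool × Bool × Bool × Bool,
    pureMoment (s q.1) (s q.2.1) (s q.2.2.1) (s q.2.2.2) = _ at h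
  have z := fun (c e f g : ι) => pureMoment_eq_zero (a := c) (b := e) (c := f) (e := g)
  simp only [Fintype.sum_prod_type, Fintype.sum_bool, s, if_true, Bool.false_eq_true,
    if_false] at h
  -- Of the sixteen moments with indices in `{a, b}`, ten are unbalanced and vanish; the four
  -- balanced mixed ones coincide by the two swaps.
  rw [z a a a b, z a a b a, z a a b b, z a b a a, z b a a a, z b b a a, z b b a b, z b b b a,
    z a b b b, z b a b b, pureMoment_swap_right a b b a, pureMoment_swap_left b a b a, 
    pureMoment_swap_left b a a b, pureMoment_swap_right a b b a] at h
  · linear_combination -4 * h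
  all_goals simp [hab, hab.symm]

theorem pureMoment_off_diag [DecidableEq ι] {a b : ι} (hab : a ≠ b) :
    pureMoment a a a a = pureMoment b b b b ∧ pureMoment a a a a = 2 * pureMoment a b a b := by
  have h1 := pureMoment_rotation hab
  have h2 := pureMoment_rotation hab.symm
  rw [pureMoment_swap_left b a, pureMoment_swap_right a b b a] at h2
  have h3 : pureMoment a a a a = pureMoment b b b b := by linear_combination (h1 - h2) / 4
  refine ⟨h3, ?_⟩
  linear_combination h1 / 2 - h3 / 2

theorem sum_pureMoment [Nonempty ι] : ∑ a : ι, ∑ b : ι, pureMoment a b a b = 1 := by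
  have h : ∀ ψ : Metric.sphere (0 : EuclideanSpace ℂ ι) 1,
      ∑ a, ∑ b, ψ.1 a * ψ.1 b * star (ψ.1 a) * star (ψ.1 b) = 1 := by
    intro ψ
    have h1 : ∑ a, ψ.1 a * star (ψ.1 a) = 1 := by
      have h2 : ‖ψ.1‖ = 1 := by simp
      have h3 := EuclideanSpace.inner_eq_star_dotProduct ψ.1 ψ.1
      rw [inner_self_eq_norm_sq_to_K, h2] at h3
      exact h3.symm.trans (by simp)
    calc ∑ a, ∑ b, ψ.1 a * ψ.1 b * star (ψ.1 a) * star (ψ.1 b)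
        = (∑ a, ψ.1 a * star (ψ.1 a)) * ∑ b, ψ.1 b * star (ψ.1 b) := by
          rw [Finset.sum_mul_sum]
          exact Finset.sum_congr rfl fun a _ => Finset.sum_congr rfl fun b _ => by ring
      _ = 1 := by rw [h1, one_mul]
  simp only [pureMoment]
  have h4 := fun a b : ι => integrable_uniformPure
    (f := fun ψ => ψ a * ψ b * star (ψ a) * star (ψ b)) (by fun_prop)
  simp_rw [← integral_finsetSum _ fun b _ => h4 _ b]
  rw [← integral_finsetSum _ fun a _ => integrable_finsetSum _ fun b _ => h4 a b]
  rw [integral_congr_ae (Filter.Eventually.of_forall h)]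
  simp

/-- The vanishing of unbalanced moments and the rotation relation leave a single constant, fixed by
`sum_pureMoment`: with `n` coordinates, `(n² + n) A / 2 = 1`. -/
theorem pureMoment_eq [DecidableEq ι] [Nonempty ι] (a b c e : ι) :
    pureMoment a b c e = ((if a = c ∧ b = e then 1 else 0) + if a = e ∧ b = c then 1 else 0) /
      ((Fintype.card ι : ℂ) * (Fintype.card ι + 1)) := by
  let o : ι := Classical.arbitrary ι
  set A := pureMoment o o o o with hA
  have hdiag : ∀ x : ι, pureMoment x x x x = A := by
    intro x
    by_cases h : x = o
    · rw [h]
    · exact (pureMoment_off_diag (ι := ι) h).1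
  have hall : ∀ x y : ι, pureMoment x y x y = (if x = y then 2 else 1) * (A / 2) := by
    intro x y
    split_ifs with h
    · subst h; rw [hdiag]; ring
    · have := (pureMoment_off_diag h).2
      rw [hdiag] at this
      rw [this]; ring
  have hsum := sum_pureMoment (ι := ι)
  have hn : (Fintype.card ι : ℂ) ≠ 0 := Nat.cast_ne_zero.2 (Fintype.card_ne_zero (α := ι))
  have hn1 : (Fintype.card ι : ℂ) + 1 ≠ 0 := Nat.cast_add_one_ne_zero _
  have hA2 : A / 2 = 1 / ((Fintype.card ι : ℂ) * (Fintype.card ι + 1)) := by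
    have h5 : ∀ x y : ι, (if x = y then (2 : ℂ) else 1) = 1 + if x = y then 1 else 0 := by
      intro x y; split_ifs <;> norm_num
    simp only [hall, h5, add_mul, Finset.sum_add_distrib, ite_mul, one_mul, zero_mul,
      Finset.sum_ite_eq, Finset.mem_univ, if_true, Finset.sum_const, Finset.card_univ,
      nsmul_eq_mul] at hsum
    rw [eq_div_iff (mul_ne_zero hn hn1)]
    linear_combination hsum
  by_cases h1 : a = c ∧ b = e
  · obtain ⟨rfl, rfl⟩ := h1
    rw [hall, hA2]
    by_cases h : a = b
    · subst h
      simp only [and_self, if_true]; field_simp; norm_num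
    · simp [h]
  · by_cases h2 : a = e ∧ b = c
    · obtain ⟨rfl, rfl⟩ := h2
      have h : a ≠ b := fun h => h1 ⟨h, h.symm⟩
      rw [pureMoment_swap_right, hall, hA2]
      simp [h]
    · rw [pureMoment_eq_zero h1 h2]
      simp [h1, h2]

end Moments

/-! ### Tensor powers of unitary representations -/

section TensorPow

variable {d : ℕ} (n : ℕ)

theorem tensorPow_apply (A : Matrix (Fin d) (Fin d) ℂ) (x y : Idx d n) :
    tensorPow n A x y = ∏ i, A (x i) (y i) := rfl

theorem tensorPow_mul (A B : Matrix (Fin d) (Fin d) ℂ) :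
    tensorPow n (A * B) = tensorPow n A * tensorPow n B := by
  ext x y
  simp only [tensorPow_apply, Matrix.mul_apply, ← Finset.prod_mul_distrib]
  rw [Finset.prod_univ_sum, Fintype.piFinset_univ]

theorem tensorPow_one : tensorPow n (1 : Matrix (Fin d) (Fin d) ℂ) = 1 := by
  ext x y
  rw [tensorPow_apply, Matrix.one_apply]
  split_ifs with h
  · subst h; simp
  · obtain ⟨i, hi⟩ := Function.ne_iff.1 h
    exact Finset.prod_eq_zero (Finset.mem_univ i) (Matrix.one_apply_ne hi)

theorem tensorPow_conjTranspose (A : Matrix (Fin d) (Fin d) ℂ) :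
    tensorPow n Aᴴ = (tensorPow n A)ᴴ := by
  ext x y
  simp [tensorPow_apply]

variable {G : Type*} [Group G] (U : G →* Matrix.unitaryGroup (Fin d) ℂ)

/-- The tensor power of a unitary representation. -/
def tensorRep : G →* Matrix.unitaryGroup (Idx d n) ℂ where
  toFun g := ⟨tensorPow n (U g : Matrix (Fin d) (Fin d) ℂ), by
    rw [Matrix.mem_unitaryGroup_iff, star_eq_conjTranspose, ← tensorPow_conjTranspose,
      ← tensorPow_mul, ← tensorPow_one]
    exact congrArg _ (Matrix.mem_unitaryGroup_iff.1 (U g).2)⟩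
  map_one' := Subtype.ext (by simp [tensorPow_one])
  map_mul' g h := Subtype.ext (by simp [tensorPow_mul])

theorem coe_tensorRep (g : G) : (tensorRep n U g : Matrix (Idx d n) (Idx d n) ℂ) =
    tensorPow n (U g : Matrix (Fin d) (Fin d) ℂ) := rfl

theorem continuous_tensorRep [TopologicalSpace G] (hU : Continuous U) :
    Continuous (tensorRep n U) := by
  refine Continuous.subtype_mk ?_ _
  refine continuous_matrix fun x y => ?_
  simp only [tensorPow_apply]
  exact continuous_finsetProd _ fun i _ =>
    (continuous_subtype_val.comp hU).matrix_elem (x i) (y i)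

end TensorPow

theorem unitary_sum_row {ι : Type*} [Fintype ι] [DecidableEq ι] (V : Matrix.unitaryGroup ι ℂ)
    (i j : ι) : ∑ x, (V : Matrix ι ι ℂ) i x * star ((V : Matrix ι ι ℂ) j x) =
      if i = j then 1 else 0 := by
  have h : (V : Matrix ι ι ℂ) * (V : Matrix ι ι ℂ)ᴴ = 1 := Unitary.coe_mul_star_self V
  have := congrFun (congrFun h i) j
  rwa [Matrix.mul_apply, Matrix.one_apply] at this

theorem unitary_sum_col {ι : Type*} [Fintype ι] [DecidableEq ι] (V : Matrix.unitaryGroup ι ℂ)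
    (i j : ι) : ∑ x, star ((V : Matrix ι ι ℂ) x i) * (V : Matrix ι ι ℂ) x j =
      if i = j then 1 else 0 := by
  have h : (V : Matrix ι ι ℂ)ᴴ * (V : Matrix ι ι ℂ) = 1 := Unitary.coe_star_mul_self V
  have := congrFun (congrFun h i) j
  rwa [Matrix.mul_apply, Matrix.one_apply] at this

theorem IsUnitVector.sum_mul_star {ι : Type*} [Fintype ι] {v : ι → ℂ} (h : IsUnitVector v) :
    ∑ x, v x * star (v x) = 1 := by
  have h1 : ∀ x, v x * star (v x) = ((‖v x‖ ^ 2 : ℝ) : ℂ) := fun x => by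
    rw [Complex.ofReal_pow]; exact Complex.mul_conj' (v x)
  simp only [h1]
  rw [← Complex.ofReal_sum, h, Complex.ofReal_one]

/-! ### The message fidelity in terms of the inversion fidelity -/

section MessageFidelity

set_option linter.unusedSectionVars false

variable {G : Type*} [Group G] [TopologicalSpace G] [IsTopologicalGroup G] [CompactSpace G]
  [MeasurableSpace G] [BorelSpace G] (μ : Measure G) [IsProbabilityMeasure μ]
  [IsFiniteMeasureOnCompacts μ]
  {d : ℕ} {U : G →* Matrix.unitaryGroup (Fin d) ℂ} {M : ℕ} {S : Type*} [Fintype S] [DecidableEq S]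

/-- The overlap `⟨⟨T| (R * |φ⟩⟨φ|) |T⟩⟩`. -/
def overlap {I : Type*} [Fintype I] (R : Matrix ((I × I) × S) ((I × I) × S) ℂ) (T : Matrix I I ℂ)
    (φ : S → ℂ) : ℂ :=
  star (dket T) ⬝ᵥ (link R (ketbra φ) *ᵥ dket T)

theorem continuous_overlap {I : Type*} [Fintype I] (R : Matrix ((I × I) × S) ((I × I) × S) ℂ)
    {T : G → Matrix I I ℂ} (hT : Continuous T) {φ : G → S → ℂ} (hφ : Continuous φ) :
    Continuous fun g => overlap R (T g) (φ g) := by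
  have h1 : ∀ i j, Continuous fun g => T g i j := fun i j => hT.matrix_elem i j
  have h2 : ∀ s, Continuous fun g => φ g s := fun s => (continuous_apply s).comp hφ
  simp only [overlap, link, ketbra, dotProduct, mulVec, dket, vecMulVec_apply, Pi.star_apply,
    Matrix.of_apply]
  fun_prop

/-- The integrand is quartic in `ψ`, and the moment formula pairs its indices in two ways. One
pairing produces the trace of the output of `R`, fixed by trace preservation; the other produces the
overlap with `U^{† ⊗ M}`, which is `D²` times the fidelity. -/
theorem messageFidelity_eq (hd : 0 < d) (hU : Continuous U) {φ : G → S → ℂ} (hφ : Continuous φ)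
    (hunit : ∀ g, IsUnitVector (φ g))
    {R : Matrix ((Idx d M × Idx d M) × S) ((Idx d M × Idx d M) × S) ℂ} (hR : IsChannel R) :
    messageFidelity μ U M φ R =
      (1 + Fintype.card (Idx d M) * retrievalFidelity μ U M φ R) /
        (Fintype.card (Idx d M) + 1) := by
  have hne : Nonempty (Idx d M) := ⟨fun _ => ⟨0, hd⟩⟩
  set D := Fintype.card (Idx d M) with hD
  have hD0 : (D : ℂ) ≠ 0 := Nat.cast_ne_zero.2 Fintype.card_ne_zero
  have hD1 : (D : ℂ) + 1 ≠ 0 := Nat.cast_add_one_ne_zero _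
  let V := tensorRep M U
  have hV : ∀ i j, Continuous fun g => (V g : Matrix (Idx d M) (Idx d M) ℂ) i j := fun i j =>
    (continuous_subtype_val.comp (continuous_tensorRep M U hU)).matrix_elem i j
  have hφ' : ∀ s, Continuous fun g => φ g s := fun s => (continuous_apply s).comp hφ
  -- The coefficient, at fixed group element, of `ψ̄_{t₁} ψ_{t₂} ψ_{t₃} ψ̄_{t₄}` in the fidelity of
  -- the message `ψ`.
  let k : G → Idx d M × Idx d M × Idx d M × Idx d M → ℂ := fun g t =>
    ∑ q : Idx d M × S, ∑ q' : Idx d M × S, R ((t.1, q.1), q.2) ((t.2.1, q'.1), q'.2) *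
      ((V g : Matrix (Idx d M) (Idx d M) ℂ) q.1 t.2.2.1 *
        star ((V g : Matrix (Idx d M) (Idx d M) ℂ) q'.1 t.2.2.2) *
        (φ g q.2 * star (φ g q'.2)))
  have hk : ∀ t, Continuous fun g => k g t := by
    intro t
    simp only [k]
    fun_prop
  have hexp : ∀ ψ : Idx d M → ℂ,
      star ψ ⬝ᵥ (applyChoi R (receivedState μ U M φ ψ) *ᵥ ψ) =
        ∑ t : Idx d M × Idx d M × Idx d M × Idx d M,
          (∫ g, k g t ∂μ) * (ψ t.2.1 * ψ t.2.2.1 * star (ψ t.1) * star (ψ t.2.2.2)) := by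
    intro ψ
    have hσ : ∀ q q', receivedState μ U M φ ψ q q' = ∑ x, ∑ x', ψ x * star (ψ x') *
        ∫ g, (V g : Matrix (Idx d M) (Idx d M) ℂ) q.1 x *
        star ((V g : Matrix (Idx d M) (Idx d M) ℂ) q'.1 x') * (φ g q.2 * star (φ g q'.2)) ∂μ := by
      intro q q'
      have h1 : ∀ x x', Integrable (fun g => ψ x * star (ψ x') *
          ((V g : Matrix (Idx d M) (Idx d M) ℂ) q.1 x *
          star ((V g : Matrix (Idx d M) (Idx d M) ℂ) q'.1 x') * (φ g q.2 * star (φ g q'.2)))) μ :=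
        fun x x' => integrable_of_continuous_compact μ (by fun_prop)
      simp_rw [← integral_const_mul]
      simp_rw [← integral_finsetSum _ fun x' _ => h1 _ x']
      rw [← integral_finsetSum _ fun x _ => integrable_finsetSum _ fun x' _ => h1 x x']
      refine integral_congr_ae (Filter.Eventually.of_forall fun g => ?_)
      simp only [ketbra, vecMulVec_apply, Pi.star_apply, mulVec, dotProduct, star_sum, star_mul']
      rw [Finset.sum_mul_sum, Finset.sum_mul]
      refine Finset.sum_congr rfl fun x _ => ?_
      rw [Finset.sum_mul]
      refine Finset.sum_congr rfl fun x' _ => ?_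
      simp only [V, coe_tensorRep]
      ring
    have hK : ∀ t, ∫ g, k g t ∂μ = ∑ q : Idx d M × S, ∑ q' : Idx d M × S,
        R ((t.1, q.1), q.2) ((t.2.1, q'.1), q'.2) *
        ∫ g, (V g : Matrix (Idx d M) (Idx d M) ℂ) q.1 t.2.2.1 *
        star ((V g : Matrix (Idx d M) (Idx d M) ℂ) q'.1 t.2.2.2) *
        (φ g q.2 * star (φ g q'.2)) ∂μ := by
      intro t
      have h1 : ∀ q q' : Idx d M × S, Integrable (fun g =>
          R ((t.1, q.1), q.2) ((t.2.1, q'.1), q'.2) *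
          ((V g : Matrix (Idx d M) (Idx d M) ℂ) q.1 t.2.2.1 *
          star ((V g : Matrix (Idx d M) (Idx d M) ℂ) q'.1 t.2.2.2) *
          (φ g q.2 * star (φ g q'.2)))) μ :=
        fun x x' => integrable_of_continuous_compact μ (by fun_prop)
      simp only [k]
      rw [integral_finsetSum _ fun q _ => integrable_finsetSum _ fun q' _ => h1 q q']
      refine Finset.sum_congr rfl fun q _ => ?_
      rw [integral_finsetSum _ fun q' _ => h1 q q']
      simp only [integral_const_mul]
    simp only [hK, Fintype.sum_prod_type (α₁ := Idx d M) (α₂ := Idx d M × Idx d M × Idx d M),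
      Fintype.sum_prod_type (α₁ := Idx d M) (α₂ := Idx d M × Idx d M),
      Fintype.sum_prod_type (α₁ := Idx d M) (α₂ := Idx d M)]
    simp only [dotProduct, mulVec, applyChoi, Matrix.of_apply, hσ, Pi.star_apply]
    refine Finset.sum_congr rfl fun o _ => ?_
    rw [Finset.mul_sum]
    refine Finset.sum_congr rfl fun o' _ => ?_
    simp only [Finset.mul_sum, Finset.sum_mul]
    rw [Finset.sum_congr rfl fun q _ => Finset.sum_comm (s := (Finset.univ : Finset (Idx d M × S)))]
    rw [Finset.sum_comm]
    refine Finset.sum_congr rfl fun x _ => ?_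
    rw [Finset.sum_congr rfl fun q _ => Finset.sum_comm (s := (Finset.univ : Finset (Idx d M × S)))]
    rw [Finset.sum_comm]
    refine Finset.sum_congr rfl fun x' _ => Finset.sum_congr rfl fun q _ =>
      Finset.sum_congr rfl fun q' _ => ?_
    ring
  have hint : ∀ t : Idx d M × Idx d M × Idx d M × Idx d M, Integrable
      (fun ψ : Metric.sphere (0 : EuclideanSpace ℂ (Idx d M)) 1 => (∫ g, k g t ∂μ) *
      (ψ.1 t.2.1 * ψ.1 t.2.2.1 * star (ψ.1 t.1) * star (ψ.1 t.2.2.2))) (uniformPure (Idx d M)) :=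
    fun t => integrable_uniformPure (f := fun ψ => (∫ g, k g t ∂μ) *
      (ψ t.2.1 * ψ t.2.2.1 * star (ψ t.1) * star (ψ t.2.2.2))) (by fun_prop)
  have h1 : messageFidelity μ U M φ R =
      (∑ t : Idx d M × Idx d M × Idx d M × Idx d M,
        (∫ g, k g t ∂μ) * pureMoment t.2.1 t.2.2.1 t.1 t.2.2.2).re := by
    simp only [messageFidelity, hexp]
    have h2 := integral_re (integrable_finsetSum Finset.univ fun t _ => hint t)
    refine Eq.trans h2 ?_
    rw [integral_finsetSum _ fun t _ => hint t]
    simp only [integral_const_mul]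
    rfl
  -- The sum over `x` replaces the message by the identity of trace `D`, and the sum over `o` traces
  -- the output.
  have hdiag : ∀ g, ∑ o, ∑ x, k g (o, o, x, x) = D := by
    intro g
    have h2 : ∀ o x, k g (o, o, x, x) = ∑ q : Idx d M × S, ∑ q' : Idx d M × S,
      R ((o, q.1), q.2) ((o, q'.1), q'.2) *
      ((V g : Matrix (Idx d M) (Idx d M) ℂ) q.1 x *
        star ((V g : Matrix (Idx d M) (Idx d M) ℂ) q'.1 x) *
        (φ g q.2 * star (φ g q'.2))) := fun o x => rfl
    simp only [h2]
    have h3 : ∑ o, ∑ x, ∑ q : Idx d M × S, ∑ q' : Idx d M × S,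
      R ((o, q.1), q.2) ((o, q'.1), q'.2) *
      ((V g : Matrix (Idx d M) (Idx d M) ℂ) q.1 x *
        star ((V g : Matrix (Idx d M) (Idx d M) ℂ) q'.1 x) *
        (φ g q.2 * star (φ g q'.2))) = ∑ q : Idx d M × S, ∑ q' : Idx d M × S,
        (∑ o, R ((o, q.1), q.2) ((o, q'.1), q'.2)) *
        (∑ x, (V g : Matrix (Idx d M) (Idx d M) ℂ) q.1 x *
        star ((V g : Matrix (Idx d M) (Idx d M) ℂ) q'.1 x)) * (φ g q.2 * star (φ g q'.2)) := by
      simp only [Finset.sum_mul_sum]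
      simp only [Finset.sum_mul]
      rw [Finset.sum_congr rfl fun o _ => Finset.sum_comm, Finset.sum_comm]
      refine Finset.sum_congr rfl fun q _ => ?_
      rw [Finset.sum_congr rfl fun o _ => Finset.sum_comm, Finset.sum_comm]
      refine Finset.sum_congr rfl fun q' _ => Finset.sum_congr rfl fun o _ =>
        Finset.sum_congr rfl fun x _ => ?_
      ring
    rw [h3]
    simp only [hR.2, unitary_sum_row, Fintype.sum_prod_type, Prod.mk.injEq]
    have h4 : ∑ x, φ g x * (starRingEnd ℂ) (φ g x) = 1 := (hunit g).sum_mul_star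
    simp [ite_and, h4, hD]
  have hoff : ∀ g, ∑ o, ∑ o', k g (o, o', o, o') =
      overlap R (tensorPow M (U g : Matrix (Fin d) (Fin d) ℂ)ᴴ) (φ g) := by
    intro g
    simp only [overlap, link, k, V, coe_tensorRep, dotProduct, mulVec, dket, Pi.star_apply,
      Matrix.of_apply, tensorPow_conjTranspose, conjTranspose_apply, star_star, ketbra,
      vecMulVec_apply]
    simp only [Fintype.sum_prod_type, Finset.mul_sum, Finset.sum_mul]
    refine Finset.sum_congr rfl fun o _ => ?_
    rw [Finset.sum_comm]
    refine Finset.sum_congr rfl fun i _ => ?_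
    refine Finset.sum_congr rfl fun o' _ => ?_
    rw [Finset.sum_comm]
    refine (Finset.sum_congr rfl fun i' _ => Finset.sum_congr rfl fun s _ =>
      Finset.sum_congr rfl fun s' _ => ?_)
    ring
  have hov : Continuous fun g =>
      overlap R (tensorPow M (U g : Matrix (Fin d) (Fin d) ℂ)ᴴ) (φ g) := by
    simp only [← hoff]
    fun_prop
  have h2 : ∑ t : Idx d M × Idx d M × Idx d M × Idx d M,
        (∫ g, k g t ∂μ) * pureMoment t.2.1 t.2.2.1 t.1 t.2.2.2 =
      (D + ∫ g, overlap R (tensorPow M (U g : Matrix (Fin d) (Fin d) ℂ)ᴴ) (φ g) ∂μ) /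
        (D * (D + 1)) := by
    have h3 : ∑ o, ∑ x, ∫ g, k g (o, o, x, x) ∂μ = D := by
      have h4 := fun o x => integrable_of_continuous_compact μ (hk (o, o, x, x))
      simp_rw [← integral_finsetSum _ fun x _ => h4 _ x]
      rw [← integral_finsetSum _ fun o _ => integrable_finsetSum _ fun x _ => h4 o x]
      simp [hdiag]
    have h5 : ∑ o, ∑ o', ∫ g, k g (o, o', o, o') ∂μ =
        ∫ g, overlap R (tensorPow M (U g : Matrix (Fin d) (Fin d) ℂ)ᴴ) (φ g) ∂μ := by
      have h4 := fun o x => integrable_of_continuous_compact μ (hk (o, x, o, x))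
      simp_rw [← integral_finsetSum _ fun x _ => h4 _ x]
      rw [← integral_finsetSum _ fun o _ => integrable_finsetSum _ fun x _ => h4 o x]
      simp only [hoff]
    have h6 : D + ∫ g, overlap R (tensorPow M (U g : Matrix (Fin d) (Fin d) ℂ)ᴴ) (φ g) ∂μ =
        ∑ o, ∑ x, ∫ g, k g (o, o, x, x) ∂μ + ∑ o, ∑ o', ∫ g, k g (o, o', o, o') ∂μ := by
      rw [h3, h5]
    rw [h6]
    simp only [pureMoment_eq, ← hD, mul_div_assoc', ← Finset.sum_div, Fintype.sum_prod_type]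
    congr 1
    simp only [mul_add, Finset.sum_add_distrib, ite_and, mul_ite, mul_one, mul_zero]
    congr 1
    · simp
    · simp
  rw [h1, h2]
  have h6 : retrievalFidelity μ U M φ R =
      (∫ g, overlap R (tensorPow M (U g : Matrix (Fin d) (Fin d) ℂ)ᴴ) (φ g) ∂μ).re / (D : ℝ) ^ 2 := by
    simp only [retrievalFidelity, channelFidelity]
    rw [integral_div]
    congr 1
    exact integral_re (integrable_of_continuous_compact μ hov)
  rw [h6]
  have hDr : (D : ℝ) ≠ 0 := Nat.cast_ne_zero.2 Fintype.card_ne_zero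
  have h7 : ((D : ℂ) * (D + 1)) = ((D * (D + 1) : ℝ) : ℂ) := by push_cast; ring
  rw [h7, Complex.div_ofReal_re, Complex.add_re, Complex.natCast_re]
  have : (D : ℝ) + 1 ≠ 0 := Nat.cast_add_one_ne_zero _
  field_simp

end MessageFidelity

/-! ### The representation on the memory and its characters. -/

namespace IrrepDecomposition

variable {G : Type*} [Group G] {ι : Type*} [Fintype ι] [DecidableEq ι] {ρ : G → Matrix ι ι ℂ}
  (D : IrrepDecomposition ρ)

theorem dim_pos (j : Fin D.num) : 0 < D.dim j := dim_pos_of_isIrreducible (D.irreducible j)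

theorem memRep_mul (g h : G) : D.memRep (g * h) = D.memRep g * D.memRep h := by
  rw [memRep, memRep, memRep, ← blockDiagonal'_mul]
  congr 1
  funext j
  rw [← mul_kronecker_mul, Matrix.one_mul, map_mul]
  rfl

theorem memRep_one : D.memRep 1 = 1 := by
  rw [memRep, ← blockDiagonal'_one]
  congr 1
  funext j
  simp

theorem memRep_conjTranspose (g : G) : (D.memRep g)ᴴ = D.memRep g⁻¹ := by
  rw [memRep, memRep, blockDiagonal'_conjTranspose]
  congr 1
  funext j
  rw [conjTranspose_kronecker, conjTranspose_one, unitary_conjTranspose_inv]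

theorem memRep_unitary (g : G) : (D.memRep g)ᴴ * D.memRep g = 1 := by
  rw [memRep_conjTranspose, ← memRep_mul, inv_mul_cancel, memRep_one]

theorem memRep_apply (g : G) (s t : D.Mem) : D.memRep g s t =
    if h : s.1 = t.1 then (D.rep s.1 g : Matrix (Fin (D.dim s.1)) (Fin (D.dim s.1)) ℂ) s.2.1
      (h ▸ t.2.1) * (if s.2.2 = h ▸ t.2.2 then 1 else 0) else 0 := by
  obtain ⟨j, a, b⟩ := s
  obtain ⟨k, a', b'⟩ := t
  by_cases h : j = k
  · subst h
    rw [memRep, blockDiagonal'_apply_eq]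
    simp [Matrix.one_apply]
  · rw [memRep, blockDiagonal'_apply_ne _ _ _ h]
    simp [h]

theorem memRep_mulVec (g : G) (φ : D.Mem → ℂ) (j : Fin D.num) (a b : Fin (D.dim j)) :
    (D.memRep g *ᵥ φ) ⟨j, a, b⟩ =
      ∑ c, (D.rep j g : Matrix (Fin (D.dim j)) (Fin (D.dim j)) ℂ) a c * φ ⟨j, c, b⟩ := by
  rw [mulVec, dotProduct, Fintype.sum_sigma, Finset.sum_eq_single j]
  · simp only [memRep, blockDiagonal'_apply_eq, Fintype.sum_prod_type, kroneckerMap_apply,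
      Matrix.one_apply]
    simp
  · intro k _ hk
    refine Finset.sum_eq_zero fun x _ => ?_
    rw [memRep, blockDiagonal'_apply_ne _ _ _ hk.symm, zero_mul]
  · simp

/-- The vector `⨁_j |U_j⟩⟩`. -/
def orbit (g : G) : D.Mem → ℂ := fun q =>
  (D.rep q.1 g : Matrix (Fin (D.dim q.1)) (Fin (D.dim q.1)) ℂ) q.2.1 q.2.2

variable [TopologicalSpace G]

/-- The decomposition carries no topology: continuity of `U_j` is read off from `ρ`, of which `U_j`
is a diagonal block, the multiplicity index `0` being available by `mult_pos`. -/
theorem continuous_rep (hρ : Continuous ρ) (j : Fin D.num) : Continuous (D.rep j) := by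
  refine continuous_induced_rng.2 (continuous_matrix fun a b => ?_)
  let m : Fin (D.mult j) := ⟨0, D.mult_pos j⟩
  have h : ∀ g, (D.rep j g : Matrix (Fin (D.dim j)) (Fin (D.dim j)) ℂ) a b =
      (D.basis * ρ g * D.basisᴴ) ⟨j, a, m⟩ ⟨j, b, m⟩ := by
    intro g
    rw [D.decomp, blockDiagonal'_apply_eq]
    simp
  have hc : Continuous fun g => D.basis * ρ g * D.basisᴴ :=
    (continuous_const.matrix_mul hρ).matrix_mul continuous_const
  exact (hc.matrix_elem ⟨j, a, m⟩ ⟨j, b, m⟩).congr fun g => (h g).symm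

theorem continuous_orbit (hρ : Continuous ρ) : Continuous D.orbit :=
  continuous_pi fun q =>
    (continuous_subtype_val.comp (D.continuous_rep hρ q.1)).matrix_elem q.2.1 q.2.2

theorem continuous_memRep (hρ : Continuous ρ) : Continuous D.memRep := by
  refine continuous_matrix fun s t => ?_
  simp only [memRep_apply]
  split_ifs with h
  · exact ((continuous_subtype_val.comp (D.continuous_rep hρ s.1)).matrix_elem _ _).mul
      continuous_const
  · simpa using continuous_const
  · exact continuous_const

/-- The character of the `j`-th irreducible component. -/
def char (j : Fin D.num) (g : G) : ℂ :=
  (D.rep j g : Matrix (Fin (D.dim j)) (Fin (D.dim j)) ℂ).trace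

theorem continuous_char (hρ : Continuous ρ) (j : Fin D.num) : Continuous (D.char j) :=
  (continuous_subtype_val.comp (D.continuous_rep hρ j)).matrix_trace

end IrrepDecomposition

theorem trace_rep_conj {G : Type*} [Group G] {ι : Type*} [Fintype ι] [DecidableEq ι]
    (V : G →* Matrix.unitaryGroup ι ℂ) (g h : G) :
    (V (h * g * h⁻¹) : Matrix ι ι ℂ).trace = (V g : Matrix ι ι ℂ).trace := by
  rw [map_mul, Submonoid.coe_mul, Matrix.trace_mul_comm, ← Submonoid.coe_mul, ← map_mul]
  simp

/-! ### The upper bound for operators with marginal `1 ⊗ K`. -/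

section Bound

variable {G : Type*} [Group G] [TopologicalSpace G] [IsTopologicalGroup G] [CompactSpace G]
  [MeasurableSpace G] [BorelSpace G] (μ : Measure G) [μ.IsHaarMeasure] [IsProbabilityMeasure μ]
  {ι : Type*} [Fintype ι] [DecidableEq ι] {ρ : G → Matrix ι ι ℂ} (D : IrrepDecomposition ρ)
  {I : Type*} [Fintype I] [DecidableEq I] (V : G →* Matrix.unitaryGroup I ℂ)

set_option linter.unusedSectionVars false

open IrrepDecomposition

/-- This makes only the diagonal of `K` enter the bound, summed over each block: a class function
averaged against an irreducible block is scalar, and its trace produces the character. -/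
theorem integral_class_mul_star_memRep (hρ : Continuous ρ) {k : G → ℂ} (hk : Continuous k)
    (hcl : ∀ g h, k (h * g * h⁻¹) = k g) (s t : D.Mem) :
    ∫ g, k g * star (D.memRep g t s) ∂μ =
      if t = s then (∫ g, k g * star (D.char s.1 g) ∂μ) / D.dim s.1 else 0 := by
  obtain ⟨j, a, b⟩ := s
  obtain ⟨j', a', b'⟩ := t
  by_cases hj : j' = j
  · subst hj
    have h1 := integral_class_mul_rep μ (D.irreducible j') (D.continuous_rep hρ j')
      (k := fun g => star (k g)) (continuous_star.comp hk) (fun g h => by rw [hcl]) a' a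
    have h2 := congrArg star h1
    rw [← starRingEnd_apply, ← integral_conj] at h2
    simp only [memRep, blockDiagonal'_apply_eq, kroneckerMap_apply, Matrix.one_apply, star_mul']
    by_cases hb : b' = b
    · subst hb
      have h3 : ∀ g, (starRingEnd ℂ) (star (k g) *
          (D.rep j' g : Matrix (Fin (D.dim j')) (Fin (D.dim j')) ℂ) a' a) = k g *
          star ((D.rep j' g : Matrix (Fin (D.dim j')) (Fin (D.dim j')) ℂ) a' a) := by
        intro g; simp
      simp only [h3] at h2
      simp only [if_true, star_one, mul_one]
      refine h2.trans ?_
      by_cases ha : a' = a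
      · subst ha
        simp only [if_true]
        rw [star_div₀, star_natCast, ← starRingEnd_apply, ← integral_conj]
        simp [IrrepDecomposition.char]
      · simp [ha]
    · simp [hb]
  · have : ∀ g, D.memRep g ⟨j', a', b'⟩ ⟨j, a, b⟩ = 0 := fun g => by
      rw [memRep, blockDiagonal'_apply_ne _ _ _ hj]
    simp [this, hj]

/-- The vector `|V gᴴ⟩⟩ ⊗ star (orbit g)`. -/
def target (g : G) : (I × I) × D.Mem → ℂ := fun q =>
  dket (V g : Matrix I I ℂ)ᴴ q.1 * star (D.orbit g q.2)

/-- The link product transposes the memory state, so the orbit appears conjugated in `target`. -/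
theorem overlap_orbit_eq (R : Matrix ((I × I) × D.Mem) ((I × I) × D.Mem) ℂ) (g : G) :
    overlap R (V g : Matrix I I ℂ)ᴴ (D.orbit g) =
      star (target D V g) ⬝ᵥ (R *ᵥ target D V g) := by
  simp only [overlap, link, ketbra, dotProduct, mulVec, target, vecMulVec_apply, Pi.star_apply,
    Matrix.of_apply, star_mul', star_star]
  rw [Fintype.sum_prod_type (α₁ := I × I)]
  refine Finset.sum_congr rfl fun q _ => ?_
  simp only [Finset.mul_sum, Finset.sum_mul, Fintype.sum_prod_type (α₁ := I × I)]
  rw [Finset.sum_comm]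
  refine Finset.sum_congr rfl fun s _ => Finset.sum_congr rfl fun q' _ =>
    Finset.sum_congr rfl fun s' _ => ?_
  ring

/-- The conjugate representation `1 ⊗ star V ⊗ star memRep`. -/
def conjRep : G →* Matrix ((I × I) × D.Mem) ((I × I) × D.Mem) ℂ where
  toFun g := ((1 : Matrix I I ℂ) ⊗ₖ (V g : Matrix I I ℂ)ᴴᵀ) ⊗ₖ (D.memRep g)ᴴᵀ
  map_one' := by simp [memRep_one]
  map_mul' g h := by
    rw [memRep_mul, map_mul, Submonoid.coe_mul]
    simp only [conjTranspose_mul, transpose_mul]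
    rw [← mul_kronecker_mul, ← mul_kronecker_mul, Matrix.one_mul]

theorem conjRep_conjTranspose (g : G) : (conjRep D V g)ᴴ = conjRep D V g⁻¹ := by
  change (((1 : Matrix I I ℂ) ⊗ₖ (V g : Matrix I I ℂ)ᴴᵀ) ⊗ₖ (D.memRep g)ᴴᵀ)ᴴ =
    ((1 : Matrix I I ℂ) ⊗ₖ (V g⁻¹ : Matrix I I ℂ)ᴴᵀ) ⊗ₖ (D.memRep g⁻¹)ᴴᵀ
  rw [conjTranspose_kronecker, conjTranspose_kronecker, conjTranspose_one,
    ← unitary_conjTranspose_inv, ← memRep_conjTranspose]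
  rfl

theorem continuous_conjRep (hρ : Continuous ρ) (hV : Continuous V) :
    Continuous (conjRep D V) := by
  refine continuous_matrix fun q q' => ?_
  have h1 := (continuous_subtype_val.comp hV).matrix_elem q.1.2 q'.1.2
  have h2 := (D.continuous_memRep hρ).matrix_elem q.2 q'.2
  change Continuous fun g => (1 : Matrix I I ℂ) q.1.1 q'.1.1 *
    star ((V g : Matrix I I ℂ) q.1.2 q'.1.2) * star (D.memRep g q.2 q'.2)
  exact (continuous_const.mul (continuous_star.comp h1)).mul (continuous_star.comp h2)

theorem conjRep_apply (g : G) (q q' : (I × I) × D.Mem) : conjRep D V g q q' =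
    (if q.1.1 = q'.1.1 then 1 else 0) * star ((V g : Matrix I I ℂ) q.1.2 q'.1.2) *
      star (D.memRep g q.2 q'.2) := by
  rw [← Matrix.one_apply]; rfl

/-- The seed vector `|1⟩⟩ ⊗ ⨁_j e_j |1_j⟩⟩`. -/
def seed (e : Fin D.num → ℝ) : (I × I) × D.Mem → ℂ := fun q =>
  (if q.1.1 = q.1.2 then 1 else 0) * ((e q.2.1 : ℂ) * if q.2.2.1 = q.2.2.2 then 1 else 0)

/-- From `(1 ⊗ V̄)|1⟩⟩ = |V†⟩⟩`: up to the block weights `e`, the target vectors form one orbit of a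
unitary representation, as `orbit_average_le` requires. -/
theorem conjRep_mulVec_seed (e : Fin D.num → ℝ) (g : G) (q : (I × I) × D.Mem) :
    (conjRep D V g *ᵥ seed D e) q = e q.2.1 * target D V g q := by
  obtain ⟨⟨o, i⟩, j, a, b⟩ := q
  have h1 : (conjRep D V g *ᵥ seed D e) ((o, i), ⟨j, a, b⟩) = star ((V g : Matrix I I ℂ) i o) *
      star ((D.memRep g *ᵥ fun s => (e s.1 : ℂ) * if s.2.1 = s.2.2 then 1 else 0) ⟨j, a, b⟩) := by
    simp only [mulVec, dotProduct, conjRep_apply, seed, Fintype.sum_prod_type (α₁ := I × I),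
      Fintype.sum_prod_type (α₁ := I), star_sum, Finset.mul_sum]
    rw [Finset.sum_eq_single o, Finset.sum_eq_single o]
    · refine Finset.sum_congr rfl fun s _ => ?_
      by_cases hs : s.2.1 = s.2.2
      · simp [hs, mul_assoc]
      · simp [hs]
    · intro b _ hb
      simp [hb.symm]
    · simp
    · intro b _ hb
      simp [hb.symm]
    · simp
  rw [h1, memRep_mulVec]
  simp [target, dket, orbit]
  ring

/-- Only characters appear, so the matrix coefficient of the seed is a class function, the other
requirement of `orbit_average_le`. -/
theorem seed_dotProduct (e : Fin D.num → ℝ) (g : G) :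
    star (seed D e) ⬝ᵥ (conjRep D V g *ᵥ seed D e) =
      star ((V g : Matrix I I ℂ).trace) * ∑ j, (e j : ℂ) ^ 2 * star (D.char j g) := by
  simp only [dotProduct, conjRep_mulVec_seed, Fintype.sum_prod_type (α₁ := I × I),
    Fintype.sum_prod_type (α₁ := I), Fintype.sum_sigma, Pi.star_apply, seed, target, dket, orbit,
    Fintype.sum_prod_type, Matrix.trace, IrrepDecomposition.char, star_sum, Finset.sum_mul_sum,
    Matrix.diag]
  refine Finset.sum_congr rfl fun o _ => ?_
  rw [Finset.sum_eq_single o]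
  · refine Finset.sum_congr rfl fun j _ => ?_
    simp only [Finset.mul_sum]
    refine Finset.sum_congr rfl fun a _ => ?_
    rw [Finset.sum_eq_single a]
    · simp; ring
    · intro b _ hb
      simp [hb.symm]
    · simp
  · intro i _ hi
    simp [hi.symm]
  · simp

/-- The overlaps `∫ |χ_V|² χ_k star χ_j` of the characters. -/
def charGram (j k : Fin D.num) : ℝ :=
  (∫ g, (V g : Matrix I I ℂ).trace * star ((V g : Matrix I I ℂ).trace) * D.char k g *
    star (D.char j g) ∂μ).re

/-- `conjRep` is the identity on the output factor, so the trace sees `R` only through its marginal.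
This makes the bound independent of the retrieving operation. -/
theorem trace_weighted_conjRep (R : Matrix ((I × I) × D.Mem) ((I × I) × D.Mem) ℂ)
    (K : Matrix D.Mem D.Mem ℂ)
    (hK : ∀ i s i' s', ∑ o, R ((o, i), s) ((o, i'), s') = if i = i' then K s s' else 0) (g : G) :
    (R * conjRep D V g).trace =
      star ((V g : Matrix I I ℂ).trace) * ∑ s, ∑ s', K s s' * star (D.memRep g s' s) := by
  have h1 : (R * conjRep D V g).trace = ∑ i, ∑ i', ∑ s, ∑ s',
      (∑ o, R ((o, i), s) ((o, i'), s')) *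
        (star ((V g : Matrix I I ℂ) i' i) * star (D.memRep g s' s)) := by
    simp only [Matrix.trace, Matrix.diag, Matrix.mul_apply, conjRep_apply,
      Fintype.sum_prod_type (α₁ := I × I), Fintype.sum_prod_type (α₁ := I), Finset.sum_mul]
    rw [Finset.sum_comm]
    refine Finset.sum_congr rfl fun i _ => ?_
    have h2 : ∀ o s, ∑ o', ∑ i', ∑ s', R ((o, i), s) ((o', i'), s') *
        ((if o' = o then 1 else 0) * star ((V g : Matrix I I ℂ) i' i) * star (D.memRep g s' s)) =
        ∑ i', ∑ s', R ((o, i), s) ((o, i'), s') *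
        (star ((V g : Matrix I I ℂ) i' i) * star (D.memRep g s' s)) := by
      intro o s
      rw [Finset.sum_eq_single o]
      · simp
      · intro b _ hb
        simp [hb]
      · simp
    simp only [h2]
    calc ∑ o, ∑ s, ∑ i', ∑ s', R ((o, i), s) ((o, i'), s') *
          (star ((V g : Matrix I I ℂ) i' i) * star (D.memRep g s' s))
        = ∑ o, ∑ i', ∑ s, ∑ s', R ((o, i), s) ((o, i'), s') *
          (star ((V g : Matrix I I ℂ) i' i) * star (D.memRep g s' s)) :=
          Finset.sum_congr rfl fun o _ => Finset.sum_comm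
      _ = ∑ i', ∑ o, ∑ s, ∑ s', R ((o, i), s) ((o, i'), s') *
          (star ((V g : Matrix I I ℂ) i' i) * star (D.memRep g s' s)) := Finset.sum_comm
      _ = _ := by
          refine Finset.sum_congr rfl fun i' _ => ?_
          rw [Finset.sum_comm]
          refine Finset.sum_congr rfl fun s _ => ?_
          rw [Finset.sum_comm]
  rw [h1]
  simp only [hK, ite_mul, zero_mul]
  simp only [Matrix.trace, Matrix.diag, star_sum, Finset.sum_mul]
  refine Finset.sum_congr rfl fun i _ => ?_
  rw [Finset.sum_eq_single i]
  · simp only [if_true, Finset.mul_sum]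
    refine Finset.sum_congr rfl fun s _ => Finset.sum_congr rfl fun s' _ => ?_
    ring
  · intro b _ hb
    simp [hb.symm]
  · simp

/-- The weight of the `j`-th component in an operator on the memory. -/
def weight (K : Matrix D.Mem D.Mem ℂ) (j : Fin D.num) : ℝ :=
  (∑ q : Fin (D.dim j) × Fin (D.dim j), (K ⟨j, q⟩ ⟨j, q⟩).re) / D.dim j

/-- `orbit_average_le` for the seed with block weights `e`, traced against `R` rescaled by `1 / e`
on both sides. The weights are free parameters, to be optimized afterwards. -/
theorem integral_overlap_le_of_pos [Nonempty I] (hρ : Continuous ρ) (hV : Continuous V)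
    {R : Matrix ((I × I) × D.Mem) ((I × I) × D.Mem) ℂ} (hR : R.PosSemidef)
    {K : Matrix D.Mem D.Mem ℂ}
    (hK : ∀ i s i' s', ∑ o, R ((o, i), s) ((o, i'), s') = if i = i' then K s s' else 0)
    {e : Fin D.num → ℝ} (he : ∀ j, 0 < e j) :
    (∫ g, overlap R (V g : Matrix I I ℂ)ᴴ (D.orbit g) ∂μ).re ≤
      ∑ j, ∑ k, weight D K j / e j ^ 2 * e k ^ 2 * charGram μ D V j k := by
  have hec : ∀ j, (e j : ℂ) ≠ 0 := fun j => Complex.ofReal_ne_zero.2 (he j).ne'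
  have hKreal : ∀ s, K s s = ((K s s).re : ℂ) := by
    intro s
    obtain ⟨i⟩ := ‹Nonempty I›
    have h1 : 0 ≤ K s s := by
      have := hK i s i s
      rw [if_pos rfl] at this
      rw [← this]
      exact Finset.sum_nonneg fun o _ => hR.diag_nonneg
    exact Complex.ext rfl (Complex.nonneg_iff.1 h1).2.symm
  let χ : G → ℂ := fun g => (V g : Matrix I I ℂ).trace
  have hχ : Continuous χ := (continuous_subtype_val.comp hV).matrix_trace
  have hW := continuous_conjRep D V hρ hV
  let w := seed D (I := I) e
  let f : G → ℂ := fun g => star w ⬝ᵥ (conjRep D V g *ᵥ w)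
  have hf : ∀ g, f g = star (χ g) * ∑ j, (e j : ℂ) ^ 2 * star (D.char j g) :=
    seed_dotProduct D V e
  have hχc : ∀ g h, χ (h * g * h⁻¹) = χ g := fun g h => trace_rep_conj V g h
  have hcc : ∀ j g h, D.char j (h * g * h⁻¹) = D.char j g := fun j g h =>
    trace_rep_conj (D.rep j) g h
  have hfcl : ∀ g h, f (h * g * h⁻¹) = f g := by
    intro g h
    rw [hf, hf, hχc]
    simp only [hcc]
  have hfc : Continuous f := by
    have := D.continuous_char hρ
    simp only [funext hf]
    fun_prop
  have hdom := orbit_average_le μ (conjRep D V) hW (conjRep_conjTranspose D V) w hfcl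
  -- Removes the weights of the seed from its orbit; moved onto `R`, it keeps positivity and divides
  -- the diagonal of block `j` of `K` by `e_j²`.
  let A : Matrix ((I × I) × D.Mem) ((I × I) × D.Mem) ℂ :=
    Matrix.diagonal fun q => ((e q.2.1)⁻¹ : ℂ)
  have hA : Aᴴ = A := by
    rw [diagonal_conjTranspose]
    congr 1
    funext q
    simp
  let R' := A * R * A
  have hR' : R'.PosSemidef := by
    have := hR.mul_mul_conjTranspose_same A
    rwa [hA] at this
  have hKR' : ∀ i s i' s', ∑ o, R' ((o, i), s) ((o, i'), s') =
      if i = i' then (e s.1 : ℂ)⁻¹ * K s s' * (e s'.1 : ℂ)⁻¹ else 0 := by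
    intro i s i' s'
    simp only [R', A, Matrix.mul_diagonal, Matrix.diagonal_mul]
    rw [← Finset.sum_mul, ← Finset.mul_sum, hK]
    split_ifs <;> simp
  have htarget : ∀ g, target D V g = A *ᵥ (conjRep D V g *ᵥ w) := by
    intro g
    funext q
    rw [mulVec_diagonal, conjRep_mulVec_seed, inv_mul_cancel_left₀ (hec _)]
  have hover : ∀ g, overlap R (V g : Matrix I I ℂ)ᴴ (D.orbit g) =
      (R' * ketbra (conjRep D V g *ᵥ w)).trace := by
    intro g
    rw [overlap_orbit_eq, htarget, ketbra, mul_vecMulVec, trace_vecMulVec, dotProduct_comm (R' *ᵥ _)]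
    simp only [R', star_mulVec, ← dotProduct_mulVec, mulVec_mulVec, conjTranspose_mul, hA,
      Matrix.mul_assoc]
  have hkc : Continuous fun g => ketbra (conjRep D V g *ᵥ w) := by
    have h1 : Continuous fun g => conjRep D V g *ᵥ w := hW.matrix_mulVec continuous_const
    exact h1.matrix_vecMulVec (continuous_star.comp h1)
  have hfW : Continuous fun g => star (f g) • conjRep D V g := (continuous_star.comp hfc).smul hW
  have hX : ∫ g, overlap R (V g : Matrix I I ℂ)ᴴ (D.orbit g) ∂μ =
      (R' * average μ fun g => ketbra (conjRep D V g *ᵥ w)).trace := by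
    rw [← average_mul_left μ _ hkc, trace_average μ (continuous_const.matrix_mul hkc)]
    simp only [hover]
  -- The conjugate of `f` gives `χ ∑_k e_k² χ_k` and the trace over the input gives `χ̄`; their
  -- product is a class function, so the off-diagonal entries of `K` drop out.
  have hY : (R' * average μ fun g => star (f g) • conjRep D V g).trace =
      ∑ s : D.Mem, (e s.1 : ℂ)⁻¹ * K s s * (e s.1 : ℂ)⁻¹ * ((∑ k, (e k : ℂ) ^ 2 *
        ∫ g, χ g * star (χ g) * D.char k g * star (D.char s.1 g) ∂μ) / D.dim s.1) := by
    rw [← average_mul_left μ _ hfW, trace_average μ (continuous_const.matrix_mul hfW)]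
    have h1 : ∀ g, (R' * star (f g) • conjRep D V g).trace =
        ∑ s, ∑ s', (e s.1 : ℂ)⁻¹ * K s s' * (e s'.1 : ℂ)⁻¹ *
          ((star (f g) * star (χ g)) * star (D.memRep g s' s)) := by
      intro g
      rw [Matrix.mul_smul, trace_smul, smul_eq_mul, trace_weighted_conjRep D V R' _ hKR',
        ← mul_assoc, Finset.mul_sum]
      refine Finset.sum_congr rfl fun s _ => ?_
      rw [Finset.mul_sum]
      refine Finset.sum_congr rfl fun s' _ => ?_
      simp only [χ]
      ring
    have hmc : ∀ s' s, Continuous fun g => star (D.memRep g s' s) := fun s' s =>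
      continuous_star.comp ((D.continuous_memRep hρ).matrix_elem s' s)
    have hkk : Continuous fun g => star (f g) * star (χ g) := by fun_prop
    have h2 : ∀ s s', Integrable (fun g => (e s.1 : ℂ)⁻¹ * K s s' * (e s'.1 : ℂ)⁻¹ *
          ((star (f g) * star (χ g)) * star (D.memRep g s' s))) μ := fun s s' =>
      integrable_of_continuous_compact μ (continuous_const.mul (hkk.mul (hmc s' s)))
    simp only [h1]
    rw [integral_finsetSum _ fun s _ => integrable_finsetSum _ fun s' _ => h2 s s']
    refine Finset.sum_congr rfl fun s _ => ?_
    rw [integral_finsetSum _ fun s' _ => h2 s s']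
    simp only [integral_const_mul]
    simp only [integral_class_mul_star_memRep μ D hρ hkk
      (fun g h => by rw [hfcl, hχc])]
    simp only [mul_ite, mul_zero, Finset.sum_ite_eq', Finset.mem_univ, if_true]
    congr 2
    have h3 : ∀ k, Integrable (fun g => (e k : ℂ) ^ 2 *
        (χ g * star (χ g) * D.char k g * star (D.char s.1 g))) μ := fun k =>
      integrable_of_continuous_compact μ (by
        have := D.continuous_char hρ
        fun_prop)
    simp_rw [← integral_const_mul]
    rw [← integral_finsetSum _ fun k _ => h3 k]
    refine integral_congr_ae (Filter.Eventually.of_forall fun g => ?_)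
    simp only [hf, star_mul', star_star, star_sum, star_pow, Finset.mul_sum, Finset.sum_mul]
    refine Finset.sum_congr rfl fun k _ => ?_
    simp only [Complex.star_def, Complex.conj_ofReal]
    ring
  have hle : (R' * average μ fun g => ketbra (conjRep D V g *ᵥ w)).trace ≤
      (R' * average μ fun g => star (f g) • conjRep D V g).trace := by
    rw [← sub_nonneg, ← trace_sub, ← Matrix.mul_sub]
    exact trace_mul_nonneg hR' hdom
  rw [hX]
  refine (Complex.le_def.1 hle).1.trans (le_of_eq ?_)
  rw [hY, Fintype.sum_sigma, Complex.re_sum]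
  refine Finset.sum_congr rfl fun j _ => ?_
  set z : ℂ := ∑ k, (e k : ℂ) ^ 2 *
    ∫ g, χ g * star (χ g) * D.char k g * star (D.char j g) ∂μ with hz
  have hterm : ∀ y : Fin (D.dim j) × Fin (D.dim j),
      ((e j : ℂ)⁻¹ * K ⟨j, y⟩ ⟨j, y⟩ * (e j : ℂ)⁻¹ * (z / D.dim j)).re =
        (K ⟨j, y⟩ ⟨j, y⟩).re * (z.re / D.dim j / e j ^ 2) := by
    intro y
    have h1 : (e j : ℂ)⁻¹ * K ⟨j, y⟩ ⟨j, y⟩ * (e j : ℂ)⁻¹ * (z / D.dim j) =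
        (((K ⟨j, y⟩ ⟨j, y⟩).re * (1 / D.dim j / e j ^ 2) : ℝ) : ℂ) * z := by
      rw [hKreal]
      push_cast
      have := hec j
      simp only [Complex.ofReal_re]
      field_simp
    rw [h1, Complex.re_ofReal_mul]
    ring
  rw [Complex.re_sum]
  refine (Finset.sum_congr rfl fun y _ => hterm y).trans ?_
  have hzre : z.re = ∑ k, e k ^ 2 * charGram μ D V j k := by
    rw [hz, Complex.re_sum]
    refine Finset.sum_congr rfl fun k _ => ?_
    rw [← Complex.ofReal_pow, Complex.re_ofReal_mul]
    rfl
  rw [← Finset.sum_mul, hzre]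
  simp only [weight, Finset.sum_div, Finset.mul_sum]
  refine Finset.sum_congr rfl fun k _ => ?_
  simp only [Finset.sum_mul]
  refine Finset.sum_congr rfl fun y _ => ?_
  ring

/-- The figure of merit of the measure-and-rotate strategy with weights `p`. -/
def merit (p : Fin D.num → ℝ) : ℝ :=
  ∑ j, ∑ k, Real.sqrt (p j) * Real.sqrt (p k) * charGram μ D V j k

theorem continuous_merit : Continuous (merit μ D V) := by
  unfold merit
  fun_prop

theorem weight_nonneg [Nonempty I] {R : Matrix ((I × I) × D.Mem) ((I × I) × D.Mem) ℂ}
    (hR : R.PosSemidef) {K : Matrix D.Mem D.Mem ℂ}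
    (hK : ∀ i s i' s', ∑ o, R ((o, i), s) ((o, i'), s') = if i = i' then K s s' else 0)
    (j : Fin D.num) : 0 ≤ weight D K j := by
  obtain ⟨i⟩ := ‹Nonempty I›
  refine div_nonneg (Finset.sum_nonneg fun q _ => ?_) (Nat.cast_nonneg _)
  have := hK i ⟨j, q⟩ i ⟨j, q⟩
  rw [if_pos rfl] at this
  rw [← this]
  exact (Complex.nonneg_iff.1 (Finset.sum_nonneg fun o _ => hR.diag_nonneg)).1

/-- With `e_j² = √p_j` the factors `p_j / e_j²` and `e_k²` become `√p_j` and `√p_k`. As `e` must be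
positive while `p_j` may vanish, `√p_j + ε` is used and `ε` tends to `0`. -/
theorem integral_overlap_le [Nonempty I] (hρ : Continuous ρ) (hV : Continuous V)
    {R : Matrix ((I × I) × D.Mem) ((I × I) × D.Mem) ℂ} (hR : R.PosSemidef)
    {K : Matrix D.Mem D.Mem ℂ}
    (hK : ∀ i s i' s', ∑ o, R ((o, i), s) ((o, i'), s') = if i = i' then K s s' else 0) :
    (∫ g, overlap R (V g : Matrix I I ℂ)ᴴ (D.orbit g) ∂μ).re ≤ merit μ D V (weight D K) := by
  set p := weight D K with hp
  have hp0 : ∀ j, 0 ≤ p j := weight_nonneg D hR hK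
  have hlim : Filter.Tendsto (fun ε : ℝ => ∑ j, ∑ k, p j / (Real.sqrt (p j) + ε) *
      (Real.sqrt (p k) + ε) * charGram μ D V j k) (nhdsWithin 0 (Set.Ioi 0))
      (nhds (merit μ D V p)) := by
    refine tendsto_finsetSum _ fun j _ => tendsto_finsetSum _ fun k _ => ?_
    refine Filter.Tendsto.mul_const _ (Filter.Tendsto.mul ?_ ?_)
    · rcases (hp0 j).eq_or_lt with h | h
      · rw [← h]; simp
      · have h1 : p j / (Real.sqrt (p j) + 0) = Real.sqrt (p j) := by
          rw [add_zero, Real.div_sqrt]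
        rw [← h1]
        have h2 : ContinuousAt (fun ε : ℝ => p j / (Real.sqrt (p j) + ε)) 0 :=
          continuousAt_const.div (continuousAt_const.add continuousAt_id) (by
            simpa using (Real.sqrt_pos.2 h).ne')
        simpa using h2.tendsto.mono_left nhdsWithin_le_nhds
    · have h2 : ContinuousAt (fun ε : ℝ => Real.sqrt (p k) + ε) 0 :=
        continuousAt_const.add continuousAt_id
      simpa [ContinuousAt] using h2.tendsto.mono_left nhdsWithin_le_nhds
  refine ge_of_tendsto hlim (eventually_nhdsWithin_of_forall fun ε hε => ?_)
  have hpos : ∀ j, 0 < Real.sqrt (p j) + ε := fun j =>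
    add_pos_of_nonneg_of_pos (Real.sqrt_nonneg _) hε
  have h := integral_overlap_le_of_pos μ D V hρ hV hR hK
    (e := fun j => Real.sqrt (Real.sqrt (p j) + ε)) fun j => Real.sqrt_pos.2 (hpos j)
  simpa only [Real.sq_sqrt (hpos _).le] using h

end Bound

/-! ### Combs -/

section Combs

variable {d : ℕ}

theorem sum_idx_succ {N : ℕ} {A : Type*} [AddCommMonoid A] (f : Idx d (N + 1) → A) :
    ∑ x, f x = ∑ x : Idx d N, ∑ a : Fin d, f (Fin.snoc x a) := by
  rw [← (Fin.snocEquiv fun _ => Fin d).sum_comp, Fintype.sum_prod_type, Finset.sum_comm]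
  rfl

theorem tensorPow_snoc {N : ℕ} (A : Matrix (Fin d) (Fin d) ℂ) (y x : Idx d N) (b a : Fin d) :
    tensorPow (N + 1) A (Fin.snoc y b) (Fin.snoc x a) = tensorPow N A y x * A b a := by
  simp [tensorPow_apply, Fin.prod_univ_castSucc]

/-- A storage comb is normalized on every unitary. -/
theorem IsStorageComb.sum_unitary (A : Matrix.unitaryGroup (Fin d) ℂ) :
    ∀ {N : ℕ} {K : Matrix (Idx d N × Idx d N) (Idx d N × Idx d N) ℂ}, IsStorageComb N K →
      ∑ s, ∑ s', K s s' * (dket (tensorPow N (A : Matrix (Fin d) (Fin d) ℂ)) s *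
        star (dket (tensorPow N (A : Matrix (Fin d) (Fin d) ℂ)) s')) = 1
  | 0, K, h => by
    rw [IsStorageComb] at h
    subst h
    simp [dket, tensorPow_apply, Matrix.one_apply]
  | N + 1, K, ⟨Q, _, hK, hQ⟩ => by
    have ih := IsStorageComb.sum_unitary A hQ
    rw [← ih]
    simp only [Fintype.sum_prod_type, sum_idx_succ, dket, tensorPow_snoc, hK, Matrix.of_apply]
    refine Finset.sum_congr rfl fun y _ => ?_
    rw [Finset.sum_comm]
    refine Finset.sum_congr rfl fun x _ => ?_
    -- `K` is the identity on the last output, so inserting `A` in the last slot gives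
    -- `(A†A)_{a'a}`, a Kronecker delta, and the last input is traced out, which leaves the shorter
    -- comb.
    have h1 : ∀ (y' x' : Idx d N) (a a' : Fin d), ∑ b, ∑ b',
        (if b = b' then Q (y, Fin.snoc x a) (y', Fin.snoc x' a') else 0) *
          (tensorPow N (A : Matrix (Fin d) (Fin d) ℂ) y x * (A : Matrix (Fin d) (Fin d) ℂ) b a *
          star (tensorPow N (A : Matrix (Fin d) (Fin d) ℂ) y' x' *
            (A : Matrix (Fin d) (Fin d) ℂ) b' a')) =
        if a' = a then Q (y, Fin.snoc x a) (y', Fin.snoc x' a) *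
          (tensorPow N (A : Matrix (Fin d) (Fin d) ℂ) y x *
            star (tensorPow N (A : Matrix (Fin d) (Fin d) ℂ) y' x')) else 0 := by
      intro y' x' a a'
      have h2 : ∀ b, ∑ b',
        (if b = b' then Q (y, Fin.snoc x a) (y', Fin.snoc x' a') else 0) *
          (tensorPow N (A : Matrix (Fin d) (Fin d) ℂ) y x * (A : Matrix (Fin d) (Fin d) ℂ) b a *
          star (tensorPow N (A : Matrix (Fin d) (Fin d) ℂ) y' x' *
            (A : Matrix (Fin d) (Fin d) ℂ) b' a')) =
        Q (y, Fin.snoc x a) (y', Fin.snoc x' a') *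
          (tensorPow N (A : Matrix (Fin d) (Fin d) ℂ) y x *
            star (tensorPow N (A : Matrix (Fin d) (Fin d) ℂ) y' x')) *
          (star ((A : Matrix (Fin d) (Fin d) ℂ) b a') * (A : Matrix (Fin d) (Fin d) ℂ) b a) := by
        intro b
        rw [Finset.sum_eq_single b]
        · rw [if_pos rfl, star_mul']; ring
        · intro c _ hc
          simp [hc.symm]
        · simp
      simp only [h2]
      rw [← Finset.mul_sum, unitary_sum_col]
      split_ifs with h
      · subst h; rw [mul_one]
      · rw [mul_zero]
    calc ∑ b, ∑ a, ∑ y' : Idx d N, ∑ b', ∑ x' : Idx d N, ∑ a',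
          (if b = b' then Q (y, Fin.snoc x a) (y', Fin.snoc x' a') else 0) *
          (tensorPow N (A : Matrix (Fin d) (Fin d) ℂ) y x * (A : Matrix (Fin d) (Fin d) ℂ) b a *
          star (tensorPow N (A : Matrix (Fin d) (Fin d) ℂ) y' x' *
            (A : Matrix (Fin d) (Fin d) ℂ) b' a'))
        = ∑ y' : Idx d N, ∑ x' : Idx d N, ∑ a, ∑ a', ∑ b, ∑ b',
          (if b = b' then Q (y, Fin.snoc x a) (y', Fin.snoc x' a') else 0) *
          (tensorPow N (A : Matrix (Fin d) (Fin d) ℂ) y x * (A : Matrix (Fin d) (Fin d) ℂ) b a *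
          star (tensorPow N (A : Matrix (Fin d) (Fin d) ℂ) y' x' *
            (A : Matrix (Fin d) (Fin d) ℂ) b' a')) := by
          rw [Finset.sum_congr rfl fun b _ => Finset.sum_comm, Finset.sum_comm]
          refine Finset.sum_congr rfl fun y' _ => ?_
          rw [Finset.sum_congr rfl fun b _ => Finset.sum_congr rfl fun a _ => Finset.sum_comm,
            Finset.sum_congr rfl fun b _ => Finset.sum_comm, Finset.sum_comm]
          refine Finset.sum_congr rfl fun x' _ => ?_
          rw [Finset.sum_comm]
          refine Finset.sum_congr rfl fun a _ => ?_
          rw [Finset.sum_congr rfl fun b _ => Finset.sum_comm, Finset.sum_comm]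
      _ = _ := by
          refine Finset.sum_congr rfl fun y' _ => Finset.sum_congr rfl fun x' _ => ?_
          simp only [h1, Finset.sum_ite_eq', Finset.mem_univ, if_true]
          rw [Finset.sum_mul]

theorem one_kronecker_posSemidef {A B : Type*} [Fintype A] [Fintype B] [DecidableEq A]
    {σ : Matrix B B ℂ} (hσ : σ.PosSemidef) :
    (Matrix.of fun s s' : A × B => if s.1 = s'.1 then σ s.2 s'.2 else 0).PosSemidef := by
  classical
  have h : (Matrix.of fun s s' : A × B => if s.1 = s'.1 then σ s.2 s'.2 else 0) =
      (1 : Matrix A A ℂ) ⊗ₖ σ := by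
    ext s s'
    simp [Matrix.one_apply]
  rw [h]
  exact PosSemidef.one.kronecker hσ

/-- Preparing a fixed input state for `N` parallel uses is a storage comb. -/
theorem isStorageComb_of_state : ∀ {N : ℕ} {σ : Matrix (Idx d N) (Idx d N) ℂ}, σ.PosSemidef →
    σ.trace = 1 →
    IsStorageComb N (Matrix.of fun s s' : Idx d N × Idx d N =>
      if s.1 = s'.1 then σ s.2 s'.2 else 0)
  | 0, σ, _, htr => by
    rw [IsStorageComb]
    ext s s'
    obtain rfl : s = s' := Subsingleton.elim _ _
    rw [Matrix.one_apply_eq, ← htr, Matrix.of_apply, if_pos rfl, Matrix.trace,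
      Fintype.sum_subsingleton _ s.2]
    rfl
  | N + 1, σ, hσ, htr => by
    refine ⟨Matrix.of fun s s' : Idx d N × Idx d (N + 1) =>
      if s.1 = s'.1 then σ s.2 s'.2 else 0, one_kronecker_posSemidef hσ, ?_, ?_⟩
    · intro y y' b b' x x'
      simp only [Matrix.of_apply, Fin.snoc_inj]
      by_cases h1 : y = y' <;> by_cases h2 : b = b' <;> simp [h1, h2]
    · let σ' : Matrix (Idx d N) (Idx d N) ℂ :=
        ∑ a : Fin d, σ.submatrix (fun x => Fin.snoc x a) fun x => Fin.snoc x a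
      have h1 : σ'.PosSemidef := posSemidef_sum _ fun a _ => hσ.submatrix _
      have h2 : σ'.trace = 1 := by
        rw [← htr, Matrix.trace_sum]
        simp only [Matrix.trace, sum_idx_succ, Matrix.diag, Matrix.submatrix_apply]
        exact Finset.sum_comm
      convert isStorageComb_of_state h1 h2 using 1
      ext s s'
      simp only [Matrix.of_apply, σ', Matrix.sum_apply, Matrix.submatrix_apply]
      split_ifs <;> simp

theorem parallelComb_posSemidef {N : ℕ} {O I A : Type*} [Fintype O] [Fintype I] [Fintype A]
    (φ : Idx d N × A → ℂ)
    {R : Matrix ((O × I) × (Idx d N × A)) ((O × I) × (Idx d N × A)) ℂ} (hR : R.PosSemidef) :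
    (parallelComb φ R).PosSemidef := by
  classical
  let B : Matrix ((O × I) × (Idx d N × Idx d N)) ((O × I) × (Idx d N × A)) ℂ :=
    Matrix.of fun q r => if q.1 = r.1 ∧ q.2.1 = r.2.1 then φ (q.2.2, r.2.2) else 0
  have h : parallelComb φ R = B * R * Bᴴ := by
    ext ⟨p, y, x⟩ ⟨p', y', x'⟩
    have h1 : ∀ r, (B * R) (p, (y, x)) r = ∑ a, φ (x, a) * R (p, (y, a)) r := by
      intro r
      simp only [Matrix.mul_apply, B, Matrix.of_apply, Fintype.sum_prod_type (α₁ := O × I),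
        Fintype.sum_prod_type (α₁ := Idx d N)]
      rw [Finset.sum_eq_single p, Finset.sum_eq_single y]
      · simp
      · intro b _ hb; simp [hb.symm]
      · simp
      · intro b _ hb; simp [hb.symm]
      · simp
    rw [Matrix.mul_apply]
    simp only [h1, B, conjTranspose_apply, Matrix.of_apply, Fintype.sum_prod_type (α₁ := O × I),
        Fintype.sum_prod_type (α₁ := Idx d N)]
    rw [Finset.sum_eq_single p', Finset.sum_eq_single y']
    · simp only [parallelComb, Matrix.of_apply, and_self, if_true, Finset.sum_mul]
      rw [Finset.sum_comm]
      refine Finset.sum_congr rfl fun a _ => Finset.sum_congr rfl fun a' _ => ?_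
      ring
    · intro b _ hb; simp [hb.symm]
    · simp
    · intro b _ hb; simp [hb.symm]
    · simp
  rw [h]
  exact hR.mul_mul_conjTranspose_same B

theorem isLearningComb_parallelComb {N M : ℕ} {A : Type*} [Fintype A] [DecidableEq A]
    {φ : Idx d N × A → ℂ} (hφ : IsUnitVector φ)
    {R : Matrix ((Idx d M × Idx d M) × (Idx d N × A)) ((Idx d M × Idx d M) × (Idx d N × A)) ℂ}
    (hR : IsChannel R) : IsLearningComb N M (parallelComb φ R) := by
  -- The reduced state of `φ` on the inputs. As `R` preserves the trace, tracing out the final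
  -- output leaves the identity on the final input and on the outputs of the uses, tensored with
  -- `σ`.
  let σ : Matrix (Idx d N) (Idx d N) ℂ := (Matrix.of fun x a => φ (x, a)) *
    (Matrix.of fun x a => φ (x, a))ᴴ
  have hσ : σ.PosSemidef := posSemidef_self_mul_conjTranspose _
  have htr : σ.trace = 1 := by
    rw [← hφ.sum_mul_star, Fintype.sum_prod_type]
    rfl
  refine ⟨parallelComb_posSemidef φ hR.1, _, isStorageComb_of_state hσ htr, ?_⟩
  rintro i ⟨y, x⟩ i' ⟨y', x'⟩
  simp only [parallelComb, Matrix.of_apply]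
  rw [Finset.sum_comm]
  have h1 : ∀ a, ∑ o, ∑ a', R ((o, i), y, a) ((o, i'), y', a') * (φ (x, a) * star (φ (x', a'))) =
      if i = i' ∧ y = y' then φ (x, a) * star (φ (x', a)) else 0 := by
    intro a
    rw [Finset.sum_comm]
    simp only [← Finset.sum_mul, hR.2, Prod.mk.injEq]
    by_cases h : i = i' ∧ y = y'
    · simp [h]
    · have h2 : ∀ a', ¬(i = i' ∧ y = y' ∧ a = a') := fun a' h3 => h ⟨h3.1, h3.2.1⟩
      simp [h, h2]
  simp only [h1]
  by_cases h3 : i = i' <;> by_cases h4 : y = y' <;> simp [h3, h4, σ, Matrix.mul_apply]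

end Combs

/-! ### Change of memory along a linear map. -/

section Pullback

set_option linter.unusedSectionVars false

variable {S S' I : Type*} [Fintype S] [Fintype S'] [Fintype I]

/-- The operator `(1 ⊗ Jᵀ) R (1 ⊗ Jᵀ)ᴴ`. -/
def pullback (J : Matrix S S' ℂ) (R : Matrix ((I × I) × S) ((I × I) × S) ℂ) :
    Matrix ((I × I) × S') ((I × I) × S') ℂ :=
  Matrix.of fun q q' => ∑ s, ∑ s', J s q.2 * R (q.1, s) (q'.1, s') * star (J s' q'.2)

theorem pullback_posSemidef (J : Matrix S S' ℂ) {R : Matrix ((I × I) × S) ((I × I) × S) ℂ}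
    (hR : R.PosSemidef) : (pullback J R).PosSemidef := by
  classical
  have h : pullback J R = ((1 : Matrix (I × I) (I × I) ℂ) ⊗ₖ Jᵀ) * R *
      ((1 : Matrix (I × I) (I × I) ℂ) ⊗ₖ Jᵀ)ᴴ := by
    ext ⟨p, s⟩ ⟨p', s'⟩
    have h1 : ∀ r, (((1 : Matrix (I × I) (I × I) ℂ) ⊗ₖ Jᵀ) * R) (p, s) r =
        ∑ t, J t s * R (p, t) r := by
      intro r
      rw [Matrix.mul_apply, Fintype.sum_prod_type, Finset.sum_eq_single p]
      · simp
      · intro b _ hb; simp [hb.symm]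
      · simp
    rw [Matrix.mul_apply, Fintype.sum_prod_type, Finset.sum_eq_single p']
    · simp only [h1, conjTranspose_apply, kroneckerMap_apply, Matrix.one_apply_eq, one_mul,
        transpose_apply, pullback, Matrix.of_apply, Finset.sum_mul]
      exact Finset.sum_comm
    · intro b _ hb; simp [hb.symm]
    · simp
  rw [h]
  exact hR.mul_mul_conjTranspose_same _

/-- Reduces memory states of the form `J v` to the single orbit in `H̃`. The map `J` need not be an
isometry, so the pulled back operator need not be a channel; the bound only uses its product
marginal. -/
theorem overlap_pullback (J : Matrix S S' ℂ) (R : Matrix ((I × I) × S) ((I × I) × S) ℂ)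
    (T : Matrix I I ℂ) (v : S' → ℂ) : overlap R T (J *ᵥ v) = overlap (pullback J R) T v := by
  have h : link R (ketbra (J *ᵥ v)) = link (pullback J R) (ketbra v) := by
    ext a b
    simp only [link, ketbra, vecMulVec_apply, Pi.star_apply, mulVec, dotProduct, pullback,
      Matrix.of_apply, star_sum, star_mul', Finset.mul_sum, Finset.sum_mul]
    conv_rhs => rw [Finset.sum_comm]
    rw [Finset.sum_congr rfl fun s _ => Finset.sum_comm, Finset.sum_comm]
    refine Finset.sum_congr rfl fun t _ => ?_
    rw [Finset.sum_congr rfl fun s _ => Finset.sum_comm, Finset.sum_comm]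
    refine Finset.sum_congr rfl fun t' _ => Finset.sum_congr rfl fun s _ =>
      Finset.sum_congr rfl fun s' _ => ?_
    ring
  rw [overlap, overlap, h]

theorem pullback_marginal [DecidableEq I] (J : Matrix S S' ℂ)
    {R : Matrix ((I × I) × S) ((I × I) × S) ℂ} {K : Matrix S S ℂ}
    (hK : ∀ i s i' s', ∑ o, R ((o, i), s) ((o, i'), s') = if i = i' then K s s' else 0)
    (i : I) (t : S') (i' : I) (t' : S') :
    ∑ o, pullback J R ((o, i), t) ((o, i'), t') = if i = i' then (Jᵀ * K * Jᵀᴴ) t t' else 0 := by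
  simp only [pullback, Matrix.of_apply]
  rw [Finset.sum_comm, Finset.sum_congr rfl fun s _ => Finset.sum_comm]
  simp only [← Finset.sum_mul, ← Finset.mul_sum, hK]
  by_cases h : i = i'
  · simp only [h, if_true, Matrix.mul_apply, transpose_apply, conjTranspose_apply, Finset.sum_mul]
    exact Finset.sum_comm
  · simp [h]

end Pullback

/-! ### The measurement -/

section Measurement

set_option linter.unusedSectionVars false

variable {G : Type*} [Group G] [TopologicalSpace G] [IsTopologicalGroup G] [CompactSpace G]
  [MeasurableSpace G] [BorelSpace G] (μ : Measure G) [μ.IsHaarMeasure] [IsProbabilityMeasure μ]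
  {ι : Type*} [Fintype ι] [DecidableEq ι] {ρ : G → Matrix ι ι ℂ} (D : IrrepDecomposition ρ)

open IrrepDecomposition

theorem integral_orbit_mul_star (hρ : Continuous ρ) (s t : D.Mem) :
    ∫ g, D.orbit g s * star (D.orbit g t) ∂μ = if s = t then (D.dim s.1 : ℂ)⁻¹ else 0 := by
  obtain ⟨j, a, b⟩ := s
  obtain ⟨k, c, e⟩ := t
  by_cases h : j = k
  · subst h
    refine (orthogonality_self μ (D.irreducible j) (D.continuous_rep hρ j) a b c e).trans ?_
    simp
  · refine (orthogonality_ne μ (D.irreducible k) (D.irreducible j) (D.continuous_rep hρ k)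
      (D.continuous_rep hρ j) (D.inequivalent k j (Ne.symm h)) a b c e).trans ?_
    simp [h]

theorem povm_apply (g : G) (s t : D.Mem) : D.povm g s t =
    ((Real.sqrt (D.dim s.1) : ℂ) * (Real.sqrt (D.dim t.1) : ℂ)) *
      (D.orbit g s * star (D.orbit g t)) := by
  simp only [povm, ketbra, vecMulVec_apply, Pi.star_apply, eta, dket, orbit, star_mul',
    Complex.star_def, Complex.conj_ofReal]
  ring

theorem continuous_povm (hρ : Continuous ρ) : Continuous D.povm := by
  refine continuous_matrix fun s t => ?_
  have h : ∀ s, Continuous fun g => D.orbit g s := fun s =>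
    (continuous_apply s).comp (D.continuous_orbit hρ)
  have h1 := h s
  have h2 := h t
  simp only [povm_apply]
  fun_prop

/-- The factors `√d_j` in `eta` are chosen to cancel the `1 / d_j` of the orthogonality relations;
inequivalence kills the cross terms between blocks. -/
theorem average_povm (hρ : Continuous ρ) : average μ D.povm = 1 := by
  ext s t
  simp only [average, Matrix.of_apply, povm_apply]
  rw [integral_const_mul, integral_orbit_mul_star μ D hρ, Matrix.one_apply]
  split_ifs with h
  · subst h
    have h1 : (D.dim s.1 : ℂ) ≠ 0 := Nat.cast_ne_zero.2 (D.dim_pos _).ne'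
    rw [← Complex.ofReal_mul, Real.mul_self_sqrt (Nat.cast_nonneg _), Complex.ofReal_natCast,
      mul_inv_cancel₀ h1]
  · rw [mul_zero]

theorem isPOVM_of_average {S : Type*} [Fintype S] [DecidableEq S] {P : G → Matrix S S ℂ}
    (hP : Continuous P) (hpos : ∀ g, (P g).PosSemidef) (h : average μ P = 1) : IsPOVM μ P :=
  ⟨hpos, fun s s' => ⟨integrable_of_continuous_compact μ (hP.matrix_elem s s'), by
    rw [← Matrix.one_apply, ← h]; rfl⟩⟩

theorem isPOVM_povm (hρ : Continuous ρ) : IsPOVM μ D.povm :=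
  isPOVM_of_average μ (continuous_povm D hρ) (fun _ => ketbra_posSemidef _) (average_povm μ D hρ)

theorem embed_isometry : D.embedᴴ * D.embed = 1 := by
  ext ⟨j, a, b⟩ ⟨k, c, e⟩
  have h1 : ∀ p q, ∑ x, D.basis p x * star (D.basis q x) = if p = q then 1 else 0 := by
    intro p q
    have := congrFun (congrFun D.basis_mul p) q
    rwa [Matrix.mul_apply, Matrix.one_apply] at this
  have h2 : (D.embedᴴ * D.embed) ⟨j, a, b⟩ ⟨k, c, e⟩ =
      (∑ x, D.basis ⟨j, a, ⟨0, D.mult_pos j⟩⟩ x * star (D.basis ⟨k, c, ⟨0, D.mult_pos k⟩⟩ x)) *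
      ∑ x, D.basis ⟨k, e, ⟨0, D.mult_pos k⟩⟩ x * star (D.basis ⟨j, b, ⟨0, D.mult_pos j⟩⟩ x) := by
    rw [Matrix.mul_apply, Fintype.sum_prod_type, Finset.sum_mul_sum]
    refine Finset.sum_congr rfl fun x _ => Finset.sum_congr rfl fun y _ => ?_
    simp only [conjTranspose_apply, embed, Matrix.of_apply, star_mul', star_star]
    ring
  rw [h2, h1, h1, Matrix.one_apply]
  by_cases h : j = k
  · subst h
    by_cases ha : a = c <;> by_cases hb : e = b <;> simp [ha, hb, eq_comm]
  · simp [h]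

theorem fullPovm_posSemidef (g : G) : (D.fullPovm g).PosSemidef := by
  refine PosSemidef.add ((ketbra_posSemidef _).mul_mul_conjTranspose_same _) ?_
  have h : (1 - D.embed * D.embedᴴ) = (1 - D.embed * D.embedᴴ)ᴴ * (1 - D.embed * D.embedᴴ) := by
    have h1 : D.embed * D.embedᴴ * (D.embed * D.embedᴴ) = D.embed * D.embedᴴ := by
      rw [Matrix.mul_assoc, ← Matrix.mul_assoc D.embedᴴ, embed_isometry, Matrix.one_mul]
    rw [conjTranspose_sub, conjTranspose_one, conjTranspose_mul, conjTranspose_conjTranspose,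
      Matrix.sub_mul, Matrix.mul_sub, Matrix.mul_sub, h1]
    simp
  rw [h]
  exact posSemidef_conjTranspose_mul_self _

theorem continuous_fullPovm (hρ : Continuous ρ) : Continuous D.fullPovm :=
  ((continuous_const.matrix_mul (continuous_povm D hρ)).matrix_mul continuous_const).add
    continuous_const

theorem isPOVM_fullPovm (hρ : Continuous ρ) : IsPOVM μ D.fullPovm := by
  refine isPOVM_of_average μ (continuous_fullPovm D hρ) (fullPovm_posSemidef D) ?_
  have hc := continuous_povm D hρ
  have h1 : average μ D.fullPovm = average μ (fun g => D.embed * D.povm g * D.embedᴴ) +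
      average μ fun _ => (1 - D.embed * D.embedᴴ) := by
    ext s t
    have hc' := ((continuous_const.matrix_mul hc).matrix_mul continuous_const :
      Continuous fun g => D.embed * D.povm g * D.embedᴴ)
    simp only [average, fullPovm, Matrix.add_apply, Matrix.of_apply]
    exact integral_add (integrable_of_continuous_compact μ (hc'.matrix_elem s t))
      (integrable_const _)
  rw [h1, average_const, average_mul_right μ (continuous_const.matrix_mul hc),
    average_mul_left μ _ hc, average_povm μ D hρ, Matrix.mul_one]
  abel

/-- The embedding intertwines the representation on the memory with `ρ ⊗ 1`. -/
theorem embed_mulVec_memRep (g : G) (φ : D.Mem → ℂ) (y x : ι) :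
    (D.embed *ᵥ (D.memRep g *ᵥ φ)) (y, x) = ∑ z, ρ g y z * (D.embed *ᵥ φ) (z, x) := by
  have h1 : ∀ j (a : Fin (D.dim j)) (m : Fin (D.mult j)) (y : ι),
      ∑ z, ρ g y z * star (D.basis ⟨j, a, m⟩ z) =
        ∑ c, star (D.basis ⟨j, c, m⟩ y) *
          (D.rep j g : Matrix (Fin (D.dim j)) (Fin (D.dim j)) ℂ) c a := by
    intro j a m y
    have h2 : ρ g * D.basisᴴ = D.basisᴴ * (D.basis * ρ g * D.basisᴴ) := by
      rw [← Matrix.mul_assoc, ← Matrix.mul_assoc, D.mul_basis, Matrix.one_mul]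
    have h3 := congrFun (congrFun h2 y) ⟨j, a, m⟩
    rw [D.decomp, Matrix.mul_apply, Matrix.mul_apply, Fintype.sum_sigma,
      Finset.sum_eq_single j] at h3
    · refine h3.trans ?_
      rw [Fintype.sum_prod_type]
      refine Finset.sum_congr rfl fun c _ => ?_
      rw [Finset.sum_eq_single m]
      · rw [blockDiagonal'_apply_eq]; simp
      · intro n _ hn
        rw [blockDiagonal'_apply_eq]; simp [hn]
      · simp
    · intro k _ hk
      refine Finset.sum_eq_zero fun p _ => ?_
      rw [blockDiagonal'_apply_ne _ _ _ hk, mul_zero]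
    · simp
  have h4 : D.embed * D.memRep g = Matrix.of fun (p : ι × ι) s => ∑ z, ρ g p.1 z * D.embed (z, p.2) s := by
    ext ⟨y, x⟩ ⟨j, a, b⟩
    rw [Matrix.mul_apply, Fintype.sum_sigma, Finset.sum_eq_single j]
    · simp only [embed, Matrix.of_apply, memRep, blockDiagonal'_apply_eq, kroneckerMap_apply,
        Fintype.sum_prod_type, Matrix.one_apply, ← mul_assoc, ← Finset.sum_mul, h1]
      simp only [mul_ite, mul_one, mul_zero, Finset.sum_ite_eq', Finset.mem_univ, if_true,
        Finset.sum_mul]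
      refine Finset.sum_congr rfl fun c _ => ?_
      ring
    · intro k _ hk
      refine Finset.sum_eq_zero fun p _ => ?_
      rw [memRep, blockDiagonal'_apply_ne _ _ _ hk, mul_zero]
    · simp
  rw [mulVec_mulVec, h4]
  simp only [mulVec, dotProduct, Matrix.of_apply, Finset.sum_mul, Finset.mul_sum]
  rw [Finset.sum_comm]
  refine Finset.sum_congr rfl fun z _ => Finset.sum_congr rfl fun s _ => ?_
  ring

theorem isUnitVector_iff {S : Type*} [Fintype S] (v : S → ℂ) :
    IsUnitVector v ↔ star v ⬝ᵥ v = 1 := by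
  have h1 : star v ⬝ᵥ v = ((∑ x, ‖v x‖ ^ 2 : ℝ) : ℂ) := by
    rw [dotProduct, Complex.ofReal_sum]
    refine Finset.sum_congr rfl fun x _ => ?_
    rw [Complex.ofReal_pow]
    exact Complex.conj_mul' (v x)
  rw [IsUnitVector, h1, Complex.ofReal_eq_one]

theorem IsUnitVector.mulVec {S S' : Type*} [Fintype S] [Fintype S'] [DecidableEq S]
    {v : S → ℂ} (hv : IsUnitVector v) {A : Matrix S' S ℂ} (hA : Aᴴ * A = 1) :
    IsUnitVector (A *ᵥ v) := by
  rw [isUnitVector_iff] at hv ⊢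
  rw [star_mulVec, ← dotProduct_mulVec, mulVec_mulVec, hA, one_mulVec, hv]

theorem isUnitVector_state {p : Fin D.num → ℝ} (hp : p ∈ stdSimplex ℝ (Fin D.num)) :
    IsUnitVector (D.state p) := by
  rw [IsUnitVector, ← hp.2, Fintype.sum_sigma]
  refine Finset.sum_congr rfl fun j _ => ?_
  have hd : (D.dim j : ℝ) ≠ 0 := Nat.cast_ne_zero.2 (D.dim_pos j).ne'
  have h1 : ∀ q : Fin (D.dim j) × Fin (D.dim j), ‖D.state p ⟨j, q⟩‖ ^ 2 =
      if q.1 = q.2 then p j / D.dim j else 0 := by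
    intro q
    simp only [state, dket, Matrix.one_apply]
    split_ifs
    · rw [mul_one, Complex.norm_real, Real.norm_eq_abs, sq_abs,
        Real.sq_sqrt (div_nonneg (hp.1 j) (Nat.cast_nonneg _))]
    · simp
  simp only [h1, Fintype.sum_prod_type, Finset.sum_ite_eq, Finset.mem_univ, if_true,
    Finset.sum_const, Finset.card_univ, Fintype.card_fin, nsmul_eq_mul]
  field_simp

theorem isUnitVector_stored {φ : D.Mem → ℂ} (hφ : IsUnitVector φ) (g : G) :
    IsUnitVector (D.stored φ g) :=
  hφ.mulVec (D.memRep_unitary g)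

theorem continuous_stored (hρ : Continuous ρ) (φ : D.Mem → ℂ) : Continuous (D.stored φ) :=
  (D.continuous_memRep hρ).matrix_mulVec continuous_const

variable {d : ℕ} {U : G →* Matrix.unitaryGroup (Fin d) ℂ} {M : ℕ}

theorem continuous_tensorPow_conjTranspose (hU : Continuous U) :
    Continuous fun g => tensorPow M (U g : Matrix (Fin d) (Fin d) ℂ)ᴴ := by
  simp only [tensorPow_conjTranspose]
  exact (continuous_subtype_val.comp (continuous_tensorRep M U hU)).matrix_conjTranspose

theorem isChannel_measureRotate (hU : Continuous U) {S : Type*} [Fintype S] [DecidableEq S]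
    {P : G → Matrix S S ℂ} (hP : Continuous P) (h : IsPOVM μ P) :
    IsChannel (measureRotate μ U M P) := by
  have hT := continuous_tensorPow_conjTranspose (M := M) hU
  let T : G → Idx d M × Idx d M → ℂ := fun g =>
    dket (tensorPow M (U g : Matrix (Fin d) (Fin d) ℂ)ᴴ)
  have hTc : ∀ a b, Continuous fun g => ketbra (T g) a b := by
    intro a b
    have h1 : ∀ i j, Continuous fun g => tensorPow M (U g : Matrix (Fin d) (Fin d) ℂ)ᴴ i j :=
      fun i j => hT.matrix_elem i j
    simp only [T, ketbra, vecMulVec_apply, Pi.star_apply, dket]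
    fun_prop
  have hPc : ∀ s t, Continuous fun g => P g s t := fun s t => hP.matrix_elem s t
  have hmr : measureRotate μ U M P = average μ fun g => ketbra (T g) ⊗ₖ (P g)ᵀ := rfl
  refine ⟨?_, ?_⟩
  · rw [hmr]
    refine average_posSemidef μ (continuous_matrix fun q q' => (hTc q.1 q'.1).mul (hPc q'.2 q.2))
      fun g => (ketbra_posSemidef _).kronecker (h.1 g).transpose
  · intro i s i' s'
    simp only [measureRotate, Matrix.of_apply]
    have hI : ∀ o, Integrable (fun g => ketbra (T g) (o, i) (o, i') * P g s' s) μ := fun o =>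
      integrable_of_continuous_compact μ ((hTc _ _).mul (hPc _ _))
    change ∑ o, ∫ g, ketbra (T g) (o, i) (o, i') * P g s' s ∂μ = _
    rw [← integral_finsetSum _ fun o _ => hI o]
    have h1 : ∀ g, ∑ o, ketbra (T g) (o, i) (o, i') = if i = i' then 1 else 0 := by
      intro g
      have h2 := unitary_sum_row (tensorRep M U g) i' i
      rw [coe_tensorRep] at h2
      simp only [T, ketbra, vecMulVec_apply, Pi.star_apply, dket, tensorPow_conjTranspose,
        conjTranspose_apply, star_star]
      exact (Finset.sum_congr rfl fun o _ => mul_comm _ _).trans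
        (h2.trans (if_congr eq_comm rfl rfl))
    have h3 : ∀ g, ∑ o, ketbra (T g) (o, i) (o, i') * P g s' s =
        (if i = i' then 1 else 0) * P g s' s := by
      intro g; rw [← Finset.sum_mul, h1]
    refine Eq.trans (integral_congr_ae (Filter.Eventually.of_forall h3)) ?_
    rw [integral_const_mul, (h.2 s' s).2]
    by_cases h4 : i = i' <;> by_cases h5 : s = s' <;> simp [h4, h5, eq_comm]

/-- The overlap for measure-and-rotate averages the squared overlap with the estimate over the
outcome distribution. -/
theorem overlap_measureRotate (hU : Continuous U) {S : Type*} [Fintype S]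
    {P : G → Matrix S S ℂ} (hP : Continuous P) (T : Matrix (Idx d M) (Idx d M) ℂ) (Φ : S → ℂ) :
    overlap (measureRotate μ U M P) T Φ =
      ∫ h, (star (dket T) ⬝ᵥ dket (tensorPow M (U h : Matrix (Fin d) (Fin d) ℂ)ᴴ)) *
        (star (dket (tensorPow M (U h : Matrix (Fin d) (Fin d) ℂ)ᴴ)) ⬝ᵥ dket T) *
        (star Φ ⬝ᵥ (P h *ᵥ Φ)) ∂μ := by
  have hT := continuous_tensorPow_conjTranspose (M := M) hU
  have h1 : ∀ q, Continuous fun g =>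
      dket (tensorPow M (U g : Matrix (Fin d) (Fin d) ℂ)ᴴ) q := fun q => hT.matrix_elem q.1 q.2
  have hPc : ∀ s t, Continuous fun g => P g s t := fun s t => hP.matrix_elem s t
  have hI : ∀ a b s s', Integrable (fun h => star (dket T a) * (dket T b) *
      (ketbra (dket (tensorPow M (U h : Matrix (Fin d) (Fin d) ℂ)ᴴ)) a b * P h s' s) *
      (Φ s * star (Φ s'))) μ := fun a b s s' => integrable_of_continuous_compact μ (by
    simp only [ketbra, vecMulVec_apply, Pi.star_apply]
    fun_prop)
  have h2 : overlap (measureRotate μ U M P) T Φ = ∑ a, ∑ b, ∑ s, ∑ s', ∫ h,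
      star (dket T a) * (dket T b) *
      (ketbra (dket (tensorPow M (U h : Matrix (Fin d) (Fin d) ℂ)ᴴ)) a b * P h s' s) *
      (Φ s * star (Φ s')) ∂μ := by
    simp only [integral_mul_const, integral_const_mul]
    simp only [overlap, link, dotProduct, mulVec, Matrix.of_apply, measureRotate, Pi.star_apply,
      Finset.mul_sum, Finset.sum_mul]
    refine Finset.sum_congr rfl fun a _ => Finset.sum_congr rfl fun b _ =>
      Finset.sum_congr rfl fun s _ => Finset.sum_congr rfl fun s' _ => ?_
    rw [show ketbra Φ s s' = Φ s * star (Φ s') from rfl]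
    ring
  rw [h2]
  simp_rw [← integral_finsetSum _ fun s' _ => hI _ _ _ s']
  simp_rw [← integral_finsetSum _ fun s _ => integrable_finsetSum _ fun s' _ => hI _ _ s s']
  simp_rw [← integral_finsetSum _ fun b _ => integrable_finsetSum _ fun s _ =>
    integrable_finsetSum _ fun s' _ => hI _ b s s']
  rw [← integral_finsetSum _ fun a _ => integrable_finsetSum _ fun b _ =>
    integrable_finsetSum _ fun s _ => integrable_finsetSum _ fun s' _ => hI a b s s']
  refine integral_congr_ae (Filter.Eventually.of_forall fun h => ?_)
  simp only [dotProduct, mulVec, ketbra, vecMulVec_apply, Pi.star_apply]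
  rw [Finset.sum_mul_sum, Finset.sum_mul]
  refine Finset.sum_congr rfl fun a _ => ?_
  rw [Finset.sum_mul]
  refine Finset.sum_congr rfl fun b _ => ?_
  rw [Finset.mul_sum, Finset.sum_comm]
  refine Finset.sum_congr rfl fun s' _ => ?_
  simp only [Finset.mul_sum]
  refine Finset.sum_congr rfl fun s _ => ?_
  ring

/-- On the range of the isometry the completing term `1 - D.embed * D.embedᴴ` vanishes. -/
theorem expectation_fullPovm (h : G) (Φ : D.Mem → ℂ) :
    star (D.embed *ᵥ Φ) ⬝ᵥ (D.fullPovm h *ᵥ (D.embed *ᵥ Φ)) = star Φ ⬝ᵥ (D.povm h *ᵥ Φ) := by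
  have h1 : D.fullPovm h * D.embed = D.embed * D.povm h := by
    rw [fullPovm, Matrix.add_mul, Matrix.sub_mul, Matrix.mul_assoc _ _ D.embed,
      Matrix.mul_assoc D.embed D.embedᴴ, embed_isometry]
    simp
  rw [mulVec_mulVec, h1, star_mulVec, ← dotProduct_mulVec, mulVec_mulVec, ← Matrix.mul_assoc,
    embed_isometry, Matrix.one_mul]

/-- The outcome density is a squared amplitude. In block `j`, `√d_j` from `eta` times `√(p_j / d_j)`
from the state is `√p_j`, and what remains is a trace, the character at `h⁻¹ g`. -/
theorem expectation_povm_state (p : Fin D.num → ℝ) (g h : G) :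
    star (D.stored (D.state p) g) ⬝ᵥ (D.povm h *ᵥ D.stored (D.state p) g) =
      star (∑ j, (Real.sqrt (p j) : ℂ) * D.char j (h⁻¹ * g)) *
        ∑ j, (Real.sqrt (p j) : ℂ) * D.char j (h⁻¹ * g) := by
  have h1 : star (D.eta h) ⬝ᵥ D.stored (D.state p) g =
      ∑ j, (Real.sqrt (p j) : ℂ) * D.char j (h⁻¹ * g) := by
    rw [dotProduct, Fintype.sum_sigma]
    refine Finset.sum_congr rfl fun j _ => ?_
    have hd : (0 : ℝ) < D.dim j := Nat.cast_pos.2 (D.dim_pos j)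
    have hs : (Real.sqrt (D.dim j) : ℂ) * (Real.sqrt (p j / D.dim j) : ℂ) = Real.sqrt (p j) := by
      rw [← Complex.ofReal_mul, ← Real.sqrt_mul hd.le, mul_div_cancel₀ _ hd.ne']
    have h2 : ∀ a b, D.stored (D.state p) g ⟨j, a, b⟩ = (Real.sqrt (p j / D.dim j) : ℂ) *
        (D.rep j g : Matrix (Fin (D.dim j)) (Fin (D.dim j)) ℂ) a b := by
      intro a b
      rw [stored, memRep_mulVec]
      simp only [state, dket, Matrix.one_apply]
      rw [Finset.sum_eq_single b]
      · simp; ring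
      · intro c _ hc; simp [hc]
      · simp
    rw [IrrepDecomposition.char, map_mul, Submonoid.coe_mul, ← unitary_conjTranspose_inv, ← hs,
      Fintype.sum_prod_type, Matrix.trace, Finset.mul_sum, Finset.sum_comm]
    refine Finset.sum_congr rfl fun b _ => ?_
    rw [Matrix.diag, Matrix.mul_apply, Finset.mul_sum]
    refine Finset.sum_congr rfl fun a _ => ?_
    rw [h2]
    simp only [Pi.star_apply, eta, dket, star_mul', conjTranspose_apply, Complex.star_def,
      Complex.conj_ofReal]
    ring
  rw [povm, ketbra, vecMulVec_mulVec, ← h1]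
  simp only [dotProduct_smul, MulOpposite.smul_eq_mul_unop, MulOpposite.unop_op]
  congr 1
  rw [← star_dotProduct_star, star_star]

theorem dket_overlap (V : G →* Matrix.unitaryGroup (Idx d M) ℂ) (g h : G) :
    star (dket (V h : Matrix (Idx d M) (Idx d M) ℂ)ᴴ) ⬝ᵥ dket (V g : Matrix (Idx d M) (Idx d M) ℂ)ᴴ =
      star (V (h⁻¹ * g) : Matrix (Idx d M) (Idx d M) ℂ).trace := by
  rw [map_mul, Submonoid.coe_mul, ← unitary_conjTranspose_inv, Matrix.trace, star_sum, dotProduct,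
    Fintype.sum_prod_type]
  refine Finset.sum_congr rfl fun o _ => ?_
  rw [Matrix.diag, Matrix.mul_apply, star_sum]
  refine Finset.sum_congr rfl fun i _ => ?_
  simp [dket]

/-- Every factor depends on `h⁻¹ g` only, so the overlap is the same for all `g`, namely `∫ |χ|²
|∑_j √p_j χ_j|²`, whose expansion is `merit`. -/
theorem overlap_measureRotate_state (hU : Continuous U) (hρ : Continuous ρ) (p : Fin D.num → ℝ)
    (g : G) :
    (overlap (measureRotate μ U M D.povm) (tensorPow M (U g : Matrix (Fin d) (Fin d) ℂ)ᴴ)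
      (D.stored (D.state p) g)).re = merit μ D (tensorRep M U) p := by
  have hinv := isInvInvariant_of_compact μ
  have hright := isMulRightInvariant_of_compact μ
  let V := tensorRep M U
  let χ : G → ℂ := fun g => (V g : Matrix (Idx d M) (Idx d M) ℂ).trace
  let ξ : G → ℂ := fun g => ∑ j, (Real.sqrt (p j) : ℂ) * D.char j g
  have hχ : Continuous χ :=
    (continuous_subtype_val.comp (continuous_tensorRep M U hU)).matrix_trace
  have h1 : overlap (measureRotate μ U M D.povm) (tensorPow M (U g : Matrix (Fin d) (Fin d) ℂ)ᴴ)
      (D.stored (D.state p) g) = ∫ h, χ h * star (χ h) * (star (ξ h) * ξ h) ∂μ := by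
    rw [overlap_measureRotate μ hU (continuous_povm D hρ),
      -- Right translation by `g` followed by inversion is the substitution of `h⁻¹ * g` for `h`.
      ← integral_mul_right_eq_self (fun h => χ h * star (χ h) * (star (ξ h) * ξ h)) g,
      ← integral_inv_eq_self (fun h => χ (h * g) * star (χ (h * g)) * (star (ξ (h * g)) * ξ (h * g)))]
    refine integral_congr_ae (Filter.Eventually.of_forall fun h => ?_)
    simp only
    rw [expectation_povm_state D p, tensorPow_conjTranspose, tensorPow_conjTranspose,
      ← coe_tensorRep, ← coe_tensorRep]
    have h2 : star (dket (tensorRep M U g : Matrix (Idx d M) (Idx d M) ℂ)ᴴ) ⬝ᵥ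
        dket (tensorRep M U h : Matrix (Idx d M) (Idx d M) ℂ)ᴴ = χ (h⁻¹ * g) := by
      have := congrArg star (dket_overlap (tensorRep M U) g h)
      rwa [← star_dotProduct_star, star_star, star_star] at this
    rw [h2, dket_overlap (tensorRep M U) g h]
  have hc := D.continuous_char hρ
  have hI : ∀ j k, Integrable (fun h => ((Real.sqrt (p j) * Real.sqrt (p k) : ℝ) : ℂ) *
      (χ h * star (χ h) * D.char k h * star (D.char j h))) μ := fun j k =>
    integrable_of_continuous_compact μ (by
      have := hc j
      have := hc k
      fun_prop)
  have h3 : ∫ h, χ h * star (χ h) * (star (ξ h) * ξ h) ∂μ = ∑ j, ∑ k,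
      ((Real.sqrt (p j) * Real.sqrt (p k) : ℝ) : ℂ) *
        ∫ h, χ h * star (χ h) * D.char k h * star (D.char j h) ∂μ := by
    simp_rw [← integral_const_mul]
    simp_rw [← integral_finsetSum _ fun k _ => hI _ k]
    rw [← integral_finsetSum _ fun j _ => integrable_finsetSum _ fun k _ => hI j k]
    refine integral_congr_ae (Filter.Eventually.of_forall fun h => ?_)
    simp only [ξ, star_sum, star_mul', Complex.star_def, Complex.conj_ofReal,
      Complex.ofReal_mul]
    rw [Finset.sum_mul_sum]
    simp only [Finset.mul_sum]
    refine Finset.sum_congr rfl fun j _ => Finset.sum_congr rfl fun k _ => ?_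
    ring
  rw [h1, h3, Complex.re_sum, merit]
  refine Finset.sum_congr rfl fun j _ => ?_
  rw [Complex.re_sum]
  refine Finset.sum_congr rfl fun k _ => ?_
  rw [Complex.re_ofReal_mul]
  rfl

end Measurement

/-! ### Optimality -/

section Optimality

set_option linter.unusedSectionVars false

variable {G : Type*} [Group G] [TopologicalSpace G] [IsTopologicalGroup G] [CompactSpace G]
  [MeasurableSpace G] [BorelSpace G] (μ : Measure G) [μ.IsHaarMeasure] [IsProbabilityMeasure μ]
  {ι : Type*} [Fintype ι] [DecidableEq ι] {ρ : G → Matrix ι ι ℂ} (D : IrrepDecomposition ρ)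

open IrrepDecomposition

theorem sum_transpose_conj {S S' : Type*} [Fintype S] [Fintype S'] (J : Matrix S S' ℂ)
    (K : Matrix S S ℂ) (v : S' → ℂ) :
    ∑ t, ∑ t', (Jᵀ * K * Jᵀᴴ) t t' * (v t * star (v t')) =
      ∑ s, ∑ s', K s s' * ((J *ᵥ v) s * star ((J *ᵥ v) s')) := by
  simp only [Matrix.mul_apply, transpose_apply, conjTranspose_apply, mulVec, dotProduct,
    star_sum, star_mul', Finset.mul_sum, Finset.sum_mul]
  rw [Finset.sum_congr rfl fun t _ => Finset.sum_congr rfl fun t' _ => Finset.sum_comm]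
  rw [Finset.sum_congr rfl fun t _ => Finset.sum_comm, Finset.sum_comm]
  refine Finset.sum_congr rfl fun s _ => ?_
  rw [Finset.sum_congr rfl fun t _ => Finset.sum_comm, Finset.sum_comm]
  refine Finset.sum_congr rfl fun s' _ => ?_
  rw [Finset.sum_comm]
  refine Finset.sum_congr rfl fun t' _ => Finset.sum_congr rfl fun t _ => ?_
  ring

/-- Averaging the normalization over the group, orthogonality retains only the diagonal entries of
`K`, each divided by `d_j`: this is the sum of the weights. -/
theorem sum_weight_eq_one (μ : Measure G) [μ.IsHaarMeasure] [IsProbabilityMeasure μ]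
    (hρ : Continuous ρ) (K : Matrix D.Mem D.Mem ℂ)
    (hK : ∀ g, ∑ t, ∑ t', K t t' * (D.orbit g t * star (D.orbit g t')) = 1) :
    ∑ j, weight D K j = 1 := by
  have ho : ∀ s, Continuous fun g => D.orbit g s := fun s =>
    (continuous_apply s).comp (D.continuous_orbit hρ)
  have hI : ∀ t t', Integrable (fun g => K t t' * (D.orbit g t * star (D.orbit g t'))) μ :=
    fun t t' => integrable_of_continuous_compact μ
      (continuous_const.mul ((ho t).mul (continuous_star.comp (ho t'))))
  have h1 : ∑ t : D.Mem, K t t * (D.dim t.1 : ℂ)⁻¹ = 1 := by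
    have h2 : ∫ g, ∑ t, ∑ t', K t t' * (D.orbit g t * star (D.orbit g t')) ∂μ = 1 := by
      simp only [hK]
      simp
    rw [integral_finsetSum _ fun t _ => integrable_finsetSum _ fun t' _ => hI t t'] at h2
    rw [← h2]
    refine Finset.sum_congr rfl fun t _ => ?_
    rw [integral_finsetSum _ fun t' _ => hI t t']
    simp only [integral_const_mul, integral_orbit_mul_star μ D hρ]
    simp
  have h3 := congrArg Complex.re h1
  rw [Fintype.sum_sigma, Complex.re_sum, Complex.one_re] at h3
  rw [← h3]
  refine Finset.sum_congr rfl fun j _ => ?_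
  rw [weight, Complex.re_sum, Finset.sum_div]
  refine Finset.sum_congr rfl fun q _ => ?_
  rw [← Complex.ofReal_natCast, ← Complex.ofReal_inv, Complex.re_mul_ofReal, div_eq_mul_inv]

variable {d : ℕ} {U : G →* Matrix.unitaryGroup (Fin d) ℂ} {M : ℕ}

theorem retrievalFidelity_eq (hU : Continuous U) {S : Type*} [Fintype S] [DecidableEq S]
    {φ : G → S → ℂ}
    (hφ : Continuous φ) (R : Matrix ((Idx d M × Idx d M) × S) ((Idx d M × Idx d M) × S) ℂ) :
    retrievalFidelity μ U M φ R =
      (∫ g, overlap R (tensorPow M (U g : Matrix (Fin d) (Fin d) ℂ)ᴴ) (φ g) ∂μ).re /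
        (Fintype.card (Idx d M) : ℝ) ^ 2 := by
  simp only [retrievalFidelity, channelFidelity]
  rw [integral_div]
  congr 1
  exact integral_re (integrable_of_continuous_compact μ
    (continuous_overlap R (continuous_tensorPow_conjTranspose hU) hφ))

/-- The covariant bound on the retrieval fidelity, for a family of states that is a linear image of
the orbit of the maximally entangled vectors. -/
theorem retrievalFidelity_le_merit (hd : 0 < d) (hU : Continuous U) (hρ : Continuous ρ)
    {S : Type*} [Fintype S] [DecidableEq S] (J : Matrix S D.Mem ℂ)
    {R : Matrix ((Idx d M × Idx d M) × S) ((Idx d M × Idx d M) × S) ℂ} (hR : R.PosSemidef)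
    {K : Matrix S S ℂ}
    (hK : ∀ i s i' s', ∑ o, R ((o, i), s) ((o, i'), s') = if i = i' then K s s' else 0) :
    retrievalFidelity μ U M (fun g => J *ᵥ D.orbit g) R ≤
      merit μ D (tensorRep M U) (weight D (Jᵀ * K * Jᵀᴴ)) /
        (Fintype.card (Idx d M) : ℝ) ^ 2 := by
  have hne : Nonempty (Idx d M) := ⟨fun _ => ⟨0, hd⟩⟩
  have hc : Continuous fun g => J *ᵥ D.orbit g :=
    continuous_const.matrix_mulVec (D.continuous_orbit hρ)
  rw [retrievalFidelity_eq μ hU hc]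
  refine div_le_div_of_nonneg_right ?_ (sq_nonneg _)
  have h := integral_overlap_le μ D (tensorRep M U) hρ (continuous_tensorRep M U hU)
    (pullback_posSemidef J hR) (pullback_marginal J hK)
  simp only [overlap_pullback, tensorPow_conjTranspose]
  exact h

theorem weight_mem_stdSimplex (μ : Measure G) [μ.IsHaarMeasure] [IsProbabilityMeasure μ]
    (hd : 0 < d) (hρ : Continuous ρ)
    {S : Type*} [Fintype S] [DecidableEq S] (J : Matrix S D.Mem ℂ)
    {R : Matrix ((Idx d M × Idx d M) × S) ((Idx d M × Idx d M) × S) ℂ} (hR : R.PosSemidef)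
    {K : Matrix S S ℂ}
    (hK : ∀ i s i' s', ∑ o, R ((o, i), s) ((o, i'), s') = if i = i' then K s s' else 0)
    (h1 : ∀ g, ∑ s, ∑ s', K s s' * ((J *ᵥ D.orbit g) s * star ((J *ᵥ D.orbit g) s')) = 1) :
    weight D (Jᵀ * K * Jᵀᴴ) ∈ stdSimplex ℝ (Fin D.num) := by
  have hne : Nonempty (Idx d M) := ⟨fun _ => ⟨0, hd⟩⟩
  refine ⟨weight_nonneg D (pullback_posSemidef J hR) (pullback_marginal J hK), ?_⟩
  refine sum_weight_eq_one D μ hρ _ fun g => ?_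
  rw [sum_transpose_conj, h1]

/-- The operator sending the orbit of the maximally entangled vectors to that of `φ`. -/
def tokenMatrix (φ : D.Mem → ℂ) : Matrix D.Mem D.Mem ℂ :=
  Matrix.blockDiagonal' fun j => (1 : Matrix (Fin (D.dim j)) (Fin (D.dim j)) ℂ) ⊗ₖ
    Matrix.of fun b c => φ ⟨j, c, b⟩

theorem tokenMatrix_mulVec_orbit (φ : D.Mem → ℂ) (g : G) :
    tokenMatrix D φ *ᵥ D.orbit g = D.stored φ g := by
  funext ⟨j, a, b⟩
  rw [stored, memRep_mulVec, mulVec, dotProduct, Fintype.sum_sigma, Finset.sum_eq_single j]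
  · simp only [tokenMatrix, blockDiagonal'_apply_eq, kroneckerMap_apply, Fintype.sum_prod_type,
      Matrix.of_apply, orbit]
    rw [Finset.sum_eq_single a]
    · simp [mul_comm]
    · intro c _ hc; simp [hc.symm]
    · simp
  · intro k _ hk
    refine Finset.sum_eq_zero fun q _ => ?_
    rw [tokenMatrix, blockDiagonal'_apply_ne _ _ _ hk.symm, zero_mul]
  · simp

/-- Block `j` of the token matrix is `√(p_j / d_j)` times the identity, so each of its `d_j²`
diagonal entries contributes `p_j / d_j`. The bound for `φ^p` thus has the weights `p` that
measure-and-rotate attains. -/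
theorem weight_tokenMatrix_state {p : Fin D.num → ℝ} (hp : ∀ j, 0 ≤ p j) :
    weight D ((tokenMatrix D (D.state p))ᵀ * (1 : Matrix D.Mem D.Mem ℂ) * (tokenMatrix D (D.state p))ᵀᴴ) = p := by
  funext j
  have hdim : (D.dim j : ℝ) ≠ 0 := Nat.cast_ne_zero.2 (D.dim_pos j).ne'
  have h1 : ∀ q : Fin (D.dim j) × Fin (D.dim j),
      ((tokenMatrix D (D.state p))ᵀ * (1 : Matrix D.Mem D.Mem ℂ) * (tokenMatrix D (D.state p))ᵀᴴ) ⟨j, q⟩ ⟨j, q⟩ =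
        ((p j / D.dim j : ℝ) : ℂ) := by
    rintro ⟨c, e⟩
    rw [Matrix.mul_one, Matrix.mul_apply, Fintype.sum_sigma, Finset.sum_eq_single j]
    · simp only [tokenMatrix, transpose_apply, conjTranspose_apply, blockDiagonal'_apply_eq,
        kroneckerMap_apply, Fintype.sum_prod_type, Matrix.of_apply]
      rw [Finset.sum_eq_single c, Finset.sum_eq_single e]
      · have h2 : 0 ≤ p j / D.dim j := div_nonneg (hp j) (Nat.cast_nonneg _)
        simp only [state, dket, Matrix.one_apply_eq, mul_one, one_mul, Complex.star_def,
          Complex.conj_ofReal]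
        rw [← Complex.ofReal_mul, Real.mul_self_sqrt h2]
      · intro b _ hb
        simp [state, dket, hb.symm]
      · simp
      · intro b _ hb
        simp [hb]
      · simp
    · intro k _ hk
      refine Finset.sum_eq_zero fun q _ => ?_
      rw [transpose_apply, tokenMatrix, blockDiagonal'_apply_ne _ _ _ hk, zero_mul]
    · simp
  simp only [weight, h1, Complex.ofReal_re, Finset.sum_const, Finset.card_univ,
    Fintype.card_prod, Fintype.card_fin, nsmul_eq_mul]
  push_cast
  field_simp

theorem IsChannel.marginal {O I S : Type*} [Fintype O] [Fintype I] [Fintype S] [DecidableEq I]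
    [DecidableEq S] {R : Matrix ((O × I) × S) ((O × I) × S) ℂ} (hR : IsChannel R) (i : I) (s : S)
    (i' : I) (s' : S) :
    ∑ o, R ((o, i), s) ((o, i'), s') = if i = i' then (1 : Matrix S S ℂ) s s' else 0 := by
  rw [hR.2, Matrix.one_apply]
  by_cases h : i = i' <;> simp [h]

theorem retrievalFidelity_state_le (hd : 0 < d) (hU : Continuous U) (hρ : Continuous ρ)
    {p : Fin D.num → ℝ} (hp : ∀ j, 0 ≤ p j)
    {R : Matrix ((Idx d M × Idx d M) × D.Mem) ((Idx d M × Idx d M) × D.Mem) ℂ}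
    (hR : IsChannel R) :
    retrievalFidelity μ U M (D.stored (D.state p)) R ≤
      merit μ D (tensorRep M U) p / (Fintype.card (Idx d M) : ℝ) ^ 2 := by
  have h := retrievalFidelity_le_merit μ D hd hU hρ (tokenMatrix D (D.state p)) hR.1 hR.marginal
  rw [weight_tokenMatrix_state D hp] at h
  simpa only [tokenMatrix_mulVec_orbit] using h

theorem exists_retrievalFidelity_le (hd : 0 < d) (hU : Continuous U) (hρ : Continuous ρ)
    {φ : D.Mem → ℂ} (hφ : IsUnitVector φ)
    {R : Matrix ((Idx d M × Idx d M) × D.Mem) ((Idx d M × Idx d M) × D.Mem) ℂ}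
    (hR : IsChannel R) :
    ∃ q ∈ stdSimplex ℝ (Fin D.num), retrievalFidelity μ U M (D.stored φ) R ≤
      merit μ D (tensorRep M U) q / (Fintype.card (Idx d M) : ℝ) ^ 2 := by
  refine ⟨_, weight_mem_stdSimplex D μ hd hρ (tokenMatrix D φ) hR.1 hR.marginal fun g => ?_, ?_⟩
  · rw [tokenMatrix_mulVec_orbit, ← (isUnitVector_stored D hφ g).sum_mul_star]
    simp [Matrix.one_apply]
  · have h := retrievalFidelity_le_merit μ D hd hU hρ (tokenMatrix D φ) hR.1 hR.marginal
    simpa only [tokenMatrix_mulVec_orbit] using h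

theorem retrievalFidelity_measureRotate (hU : Continuous U) (hρ : Continuous ρ)
    (p : Fin D.num → ℝ) :
    retrievalFidelity μ U M (D.stored (D.state p)) (measureRotate μ U M D.povm) =
      merit μ D (tensorRep M U) p / (Fintype.card (Idx d M) : ℝ) ^ 2 := by
  have h : ∀ g, (star (dket (tensorPow M (U g : Matrix (Fin d) (Fin d) ℂ)ᴴ)) ⬝ᵥ
      (link (measureRotate μ U M D.povm) (ketbra (D.stored (D.state p) g)) *ᵥ
        dket (tensorPow M (U g : Matrix (Fin d) (Fin d) ℂ)ᴴ))).re =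
      merit μ D (tensorRep M U) p := overlap_measureRotate_state μ D hU hρ p
  simp [retrievalFidelity, channelFidelity, h]

/-- The operator sending the orbit of the maximally entangled vectors to that of `|1⟩⟩`. -/
def combMatrix : Matrix (ι × ι) D.Mem ℂ := Matrix.of fun s t =>
  ∑ m, star (D.basis ⟨t.1, t.2.1, m⟩ s.1) * D.basis ⟨t.1, t.2.2, m⟩ s.2

/-- Multiplicities only repeat the block `U_j`, so `|ρ(g)⟩⟩` depends linearly on `⨁_j |U_j⟩⟩`. Hence
arbitrary boards, sequential ones included, obey the same bound as parallel storage in `H̃`. -/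
theorem combMatrix_mulVec_orbit (g : G) : combMatrix D *ᵥ D.orbit g = dket (ρ g) := by
  have h1 : ρ g = D.basisᴴ * (D.basis * ρ g * D.basisᴴ) * D.basis := by
    rw [← Matrix.mul_assoc, ← Matrix.mul_assoc, D.mul_basis, Matrix.one_mul, Matrix.mul_assoc,
      D.mul_basis, Matrix.mul_one]
  have h2 : ∀ y (j : Fin D.num) (b : Fin (D.dim j)) (m : Fin (D.mult j)),
      (D.basisᴴ * Matrix.blockDiagonal' fun j =>
        (D.rep j g : Matrix (Fin (D.dim j)) (Fin (D.dim j)) ℂ) ⊗ₖ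
        (1 : Matrix (Fin (D.mult j)) (Fin (D.mult j)) ℂ)) y ⟨j, b, m⟩ =
      ∑ a, star (D.basis ⟨j, a, m⟩ y) *
        (D.rep j g : Matrix (Fin (D.dim j)) (Fin (D.dim j)) ℂ) a b := by
    intro y j b m
    rw [Matrix.mul_apply, Fintype.sum_sigma, Finset.sum_eq_single j]
    · rw [Fintype.sum_prod_type]
      refine Finset.sum_congr rfl fun a _ => ?_
      rw [Finset.sum_eq_single m]
      · rw [blockDiagonal'_apply_eq]; simp
      · intro n _ hn
        rw [blockDiagonal'_apply_eq]; simp [hn]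
      · simp
    · intro k _ hk
      refine Finset.sum_eq_zero fun q _ => ?_
      rw [blockDiagonal'_apply_ne _ _ _ hk, mul_zero]
    · simp
  funext ⟨y, x⟩
  rw [dket, h1, D.decomp, Matrix.mul_apply, mulVec, dotProduct, Fintype.sum_sigma,
    Fintype.sum_sigma]
  refine Finset.sum_congr rfl fun j _ => ?_
  simp only [Fintype.sum_prod_type, h2, combMatrix, Matrix.of_apply, orbit, Finset.sum_mul]
  rw [Finset.sum_comm]
  refine Finset.sum_congr rfl fun b _ => ?_
  rw [Finset.sum_comm]
  refine Finset.sum_congr rfl fun m _ => Finset.sum_congr rfl fun a _ => ?_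
  ring

theorem nonempty_num [Nonempty ι] : Nonempty (Fin D.num) := by
  by_contra h
  rw [not_nonempty_iff] at h
  obtain ⟨x⟩ := ‹Nonempty ι›
  have h1 := congrFun (congrFun D.mul_basis x) x
  rw [Matrix.mul_apply, Fintype.sum_sigma, Fintype.sum_empty, Matrix.one_apply_eq] at h1
  exact zero_ne_one h1

theorem exists_merit_max [Nonempty ι] {I : Type*} [Fintype I] [DecidableEq I]
    (V : G →* Matrix.unitaryGroup I ℂ) :
    ∃ p ∈ stdSimplex ℝ (Fin D.num), ∀ q ∈ stdSimplex ℝ (Fin D.num),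
      merit μ D V q ≤ merit μ D V p := by
  obtain ⟨j⟩ := nonempty_num D
  obtain ⟨p, hp, hmax⟩ := (isCompact_stdSimplex ℝ (Fin D.num)).exists_isMaxOn
    ⟨_, single_mem_stdSimplex ℝ j⟩ (continuous_merit μ D V).continuousOn
  exact ⟨p, hp, fun q hq => hmax hq⟩

variable {N : ℕ}

/-- Inserting `T` into the slots amounts to preparing the memory in the state `(T ⊗ 1) φ`, which
turns the board into a retrieval problem. -/
theorem link_parallelComb {O I A : Type*} [Fintype A] (φ : Idx d N × A → ℂ)
    (R : Matrix ((O × I) × (Idx d N × A)) ((O × I) × (Idx d N × A)) ℂ)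
    (T : Matrix (Idx d N) (Idx d N) ℂ) :
    link (parallelComb φ R) (ketbra (dket T)) =
      link R (ketbra fun s => ∑ x, T s.1 x * φ (x, s.2)) := by
  ext p p'
  simp only [link, parallelComb, ketbra, vecMulVec_apply, Pi.star_apply, dket, Matrix.of_apply,
    Fintype.sum_prod_type, star_sum, star_mul', Finset.sum_mul_sum]
  simp only [Finset.mul_sum, Finset.sum_mul]
  refine Finset.sum_congr rfl fun y _ => ?_
  rw [Finset.sum_congr rfl fun x _ => Finset.sum_congr rfl fun y' _ => Finset.sum_comm,
    Finset.sum_congr rfl fun x _ => Finset.sum_comm, Finset.sum_comm]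
  refine Finset.sum_congr rfl fun a _ => ?_
  rw [Finset.sum_comm]
  refine Finset.sum_congr rfl fun y' _ => ?_
  rw [Finset.sum_congr rfl fun x _ => Finset.sum_comm, Finset.sum_comm]
  refine Finset.sum_congr rfl fun a' _ => Finset.sum_congr rfl fun x _ =>
    Finset.sum_congr rfl fun x' _ => ?_
  ring

variable (D' : IrrepDecomposition fun g => tensorPow N (U g : Matrix (Fin d) (Fin d) ℂ))

/-- The memory state stays in the range of `embed`, where the completed measurement has the
statistics of the measurement on `H̃`. -/
theorem inversionFidelity_measureRotateComb (hU : Continuous U) (p : Fin D'.num → ℝ) :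
    inversionFidelity μ U N M (measureRotateComb μ U N M D' p) =
      merit μ D' (tensorRep M U) p / (Fintype.card (Idx d M) : ℝ) ^ 2 := by
  have hρ : Continuous fun g => tensorPow N (U g : Matrix (Fin d) (Fin d) ℂ) :=
    continuous_subtype_val.comp (continuous_tensorRep N U hU)
  rw [← retrievalFidelity_measureRotate μ D' hU hρ]
  simp only [inversionFidelity, retrievalFidelity, measureRotateComb, link_parallelComb]
  refine integral_congr_ae (Filter.Eventually.of_forall fun g => ?_)
  have h1 : (fun s : Idx d N × Idx d N => ∑ x, tensorPow N (U g : Matrix (Fin d) (Fin d) ℂ) s.1 x *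
      (D'.embed *ᵥ D'.state p) (x, s.2)) = D'.embed *ᵥ D'.stored (D'.state p) g := by
    funext ⟨y, x⟩
    rw [stored, embed_mulVec_memRep]
  simp only [h1, channelFidelity]
  congr 2
  change overlap _ _ _ = overlap _ _ _
  rw [overlap_measureRotate μ hU (continuous_fullPovm D' hρ),
    overlap_measureRotate μ hU (continuous_povm D' hρ)]
  simp only [expectation_fullPovm]

/-- The weights come from the storage part `K` of the board, pulled back along `combMatrix`; they
sum to one because `K` is normalized on the unitaries of the group. -/
theorem exists_inversionFidelity_le (hd : 0 < d) (hU : Continuous U)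
    {L : Matrix ((Idx d M × Idx d M) × (Idx d N × Idx d N))
      ((Idx d M × Idx d M) × (Idx d N × Idx d N)) ℂ} (hL : IsLearningComb N M L) :
    ∃ q ∈ stdSimplex ℝ (Fin D'.num), inversionFidelity μ U N M L ≤
      merit μ D' (tensorRep M U) q / (Fintype.card (Idx d M) : ℝ) ^ 2 := by
  have hρ : Continuous fun g => tensorPow N (U g : Matrix (Fin d) (Fin d) ℂ) :=
    continuous_subtype_val.comp (continuous_tensorRep N U hU)
  obtain ⟨hpos, K, hK, hmarg⟩ := hL
  refine ⟨_, weight_mem_stdSimplex D' μ hd hρ (combMatrix D') hpos hmarg fun g => ?_, ?_⟩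
  · rw [combMatrix_mulVec_orbit]
    exact hK.sum_unitary (U g)
  · have h := retrievalFidelity_le_merit μ D' hd hU hρ (combMatrix D') hpos hmarg
    simp only [combMatrix_mulVec_orbit] at h
    exact h

/-- The message fidelity is an increasing affine function of the inversion fidelity. -/
theorem messageFidelity_le_iff (hd : 0 < d) (hU : Continuous U) (hρ : Continuous ρ)
    {φ₁ φ₂ : D.Mem → ℂ} (h₁ : IsUnitVector φ₁) (h₂ : IsUnitVector φ₂)
    {R₁ R₂ : Matrix ((Idx d M × Idx d M) × D.Mem) ((Idx d M × Idx d M) × D.Mem) ℂ}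
    (hR₁ : IsChannel R₁) (hR₂ : IsChannel R₂) :
    messageFidelity μ U M (D.stored φ₁) R₁ ≤ messageFidelity μ U M (D.stored φ₂) R₂ ↔
      retrievalFidelity μ U M (D.stored φ₁) R₁ ≤ retrievalFidelity μ U M (D.stored φ₂) R₂ := by
  have hne : Nonempty (Idx d M) := ⟨fun _ => ⟨0, hd⟩⟩
  have hD : (0 : ℝ) < Fintype.card (Idx d M) := Nat.cast_pos.2 Fintype.card_pos
  rw [messageFidelity_eq μ hd hU (continuous_stored D hρ φ₁) (isUnitVector_stored D h₁) hR₁,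
    messageFidelity_eq μ hd hU (continuous_stored D hρ φ₂) (isUnitVector_stored D h₂) hR₂,
    div_le_div_iff_of_pos_right (by positivity), add_le_add_iff_left, mul_le_mul_iff_right₀ hD]

end Optimality

end UnitaryInversion

end

/-! ### The main theorem. -/

theorem mainTheorem5 {G : Type*} [Group G] [TopologicalSpace G] [IsTopologicalGroup G]
    [CompactSpace G] [MeasurableSpace G] [BorelSpace G]
    (μ : Measure G) [μ.IsHaarMeasure] [μ.Regular] [IsProbabilityMeasure μ]
    {d : ℕ} (hd : 0 < d) (U : G →* Matrix.unitaryGroup (Fin d) ℂ) (hU : Continuous U)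
    (N M : ℕ) :
    Nonempty (IrrepDecomposition fun g => tensorPow N (U g : Matrix (Fin d) (Fin d) ℂ)) ∧
    ∀ D : IrrepDecomposition (fun g => tensorPow N (U g : Matrix (Fin d) (Fin d) ℂ)),
      -- the measurement is a POVM, and measure-and-rotate is a retrieving channel
      IsPOVM μ D.povm ∧
      IsPOVM μ D.fullPovm ∧
      IsChannel (measureRotate μ U M D.povm) ∧
      -- for each state of the stated form, measure-and-rotate is the optimal retrieving channel,
      -- both for inversion and for the realignment of reference frames
      (∀ p ∈ stdSimplex ℝ (Fin D.num),
        ∀ R : Matrix ((Idx d M × Idx d M) × D.Mem) ((Idx d M × Idx d M) × D.Mem) ℂ, IsChannel R →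
          retrievalFidelity μ U M (D.stored (D.state p)) R ≤
            retrievalFidelity μ U M (D.stored (D.state p)) (measureRotate μ U M D.povm) ∧
          messageFidelity μ U M (D.stored (D.state p)) R ≤
            messageFidelity μ U M (D.stored (D.state p)) (measureRotate μ U M D.povm)) ∧
      -- maximizing the message fidelity is equivalent to maximizing the inversion fidelity
      (∀ φ₁ φ₂ : D.Mem → ℂ, IsUnitVector φ₁ → IsUnitVector φ₂ →
        ∀ R₁ R₂ : Matrix ((Idx d M × Idx d M) × D.Mem) ((Idx d M × Idx d M) × D.Mem) ℂ,
          IsChannel R₁ → IsChannel R₂ →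
          (messageFidelity μ U M (D.stored φ₁) R₁ ≤ messageFidelity μ U M (D.stored φ₂) R₂ ↔
            retrievalFidelity μ U M (D.stored φ₁) R₁ ≤
              retrievalFidelity μ U M (D.stored φ₂) R₂)) ∧
      -- an optimal state
      ∃ p ∈ stdSimplex ℝ (Fin D.num),
        IsUnitVector (D.state p) ∧
        IsUnitVector (D.embed *ᵥ D.state p) ∧
        -- storing in parallel, measuring and rotating is optimal among all learning boards
        IsLearningComb N M (measureRotateComb μ U N M D p) ∧
        (∀ L, IsLearningComb N M L →
          inversionFidelity μ U N M L ≤ inversionFidelity μ U N M (measureRotateComb μ U N M D p)) ∧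
        -- the same state and strategy are optimal for the realignment of reference frames
        (∀ φ : D.Mem → ℂ, IsUnitVector φ →
          ∀ R : Matrix ((Idx d M × Idx d M) × D.Mem) ((Idx d M × Idx d M) × D.Mem) ℂ,
            IsChannel R →
            messageFidelity μ U M (D.stored φ) R ≤
              messageFidelity μ U M (D.stored (D.state p)) (measureRotate μ U M D.povm)) := by
  have hρ : Continuous fun g => tensorPow N (U g : Matrix (Fin d) (Fin d) ℂ) :=
    continuous_subtype_val.comp (continuous_tensorRep N U hU)
  -- Ensures that the decomposition has at least one component, so that the simplex over which
  -- `merit` is maximized is nonempty.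
  have hne : Nonempty (Idx d N) := ⟨fun _ => ⟨0, hd⟩⟩
  refine ⟨nonempty_irrepDecomposition (tensorRep N U), fun D => ?_⟩
  have hpovm := isPOVM_povm μ D hρ
  have hchan := isChannel_measureRotate (M := M) μ hU (continuous_povm D hρ) hpovm
  have hfull := isChannel_measureRotate (M := M) μ hU (continuous_fullPovm D hρ)
    (isPOVM_fullPovm μ D hρ)
  refine ⟨hpovm, isPOVM_fullPovm μ D hρ, hchan, ?_, ?_, ?_⟩
  · intro p hp R hR
    have h := retrievalFidelity_state_le μ D hd hU hρ hp.1 hR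
    rw [← retrievalFidelity_measureRotate μ D hU hρ] at h
    exact ⟨h, (messageFidelity_le_iff μ D hd hU hρ (isUnitVector_state D hp)
      (isUnitVector_state D hp) hR hchan).2 h⟩
  · intro φ₁ φ₂ h₁ h₂ R₁ R₂ hR₁ hR₂
    exact messageFidelity_le_iff μ D hd hU hρ h₁ h₂ hR₁ hR₂
  -- One maximizer serves both tasks: boards and tokens are bounded by the same function `merit`,
  -- evaluated at weights of their own.
  · obtain ⟨p, hp, hmax⟩ := exists_merit_max μ D (tensorRep M U)
    have hunit := (isUnitVector_state D hp).mulVec (embed_isometry D)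
    refine ⟨p, hp, isUnitVector_state D hp, hunit, isLearningComb_parallelComb hunit hfull, ?_, ?_⟩
    · intro L hL
      obtain ⟨q, hq, hle⟩ := exists_inversionFidelity_le μ D hd hU hL
      rw [inversionFidelity_measureRotateComb μ D hU]
      exact hle.trans (div_le_div_of_nonneg_right (hmax q hq) (sq_nonneg _))
    · intro φ hφ R hR
      rw [messageFidelity_le_iff μ D hd hU hρ hφ (isUnitVector_state D hp) hR hchan,
        retrievalFidelity_measureRotate μ D hU hρ]
      obtain ⟨q, hq, hle⟩ := exists_retrievalFidelity_le μ D hd hU hρ hφ hR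
      exact hle.trans (div_le_div_of_nonneg_right (hmax q hq) (sq_nonneg _))
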